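/- Let $t\ge 0$ be an integer and let $H$ be a finite simple graph without loops; both are fixed. An instance of Max Partial $H$-Coloring is a pair $(G,\mathsf{rev})$ of a finite simple graph $G$ and a revenue function $\mathsf{rev}\colon V(G)\times V(H)\to\mathbb{R}$. A partial $H$-coloring of $G$ is a partial function $\phi\colon V(G)\rightharpoonup V(H)$ that is a homomorphism from $G[\mathrm{dom}\,\phi]$ to $H$; its revenue is $\sum_{u\in\mathrm{dom}\,\phi}\mathsf{rev}(u,\phi(u))$, and the task is to find a partial $H$-coloring of maximum revenue. Let $P_6$ be the path on six vertices and let $S_t$ be the graph obtained from the star $K_{1,t}$ by subdividing every edge once. A graph is $\{P_6,S_t\}$-free if it has no induced subgraph isomorphic to $P_6$ or to $S_t$. Then Max Partial $H$-Coloring can be solved on $\{P_6,S_t\}$-free graphs in time $n^{\mathcal{O}(n^{t/(t+1)})}$, where $n=|V(G)|$. Precisely: there are a constant $C$ and a program, both depending only on $t$ and $H$, such that for every $\{P_6,S_t\}$-free graph $G$ on $n$ vertices and every $\mathsf{rev}$ the program, given $G$ (as an adjacency matrix) and $\mathsf{rev}$, halts after at most $N^{C\cdot N^{t/(t+1)}}$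 steps, where $N=\max(n,2)$, and outputs a partial $H$-coloring of $G$ of maximum revenue. Programs are those of a random access machine with arrays of natural numbers and of real numbers, whose elementary operations (reading and writing a cell with a computed index, the natural constants, the real constants $0$ and $1$, addition, subtraction, comparison and branching) cost one step each; subtraction of natural numbers is truncated at $0$, and there is no multiplication, division or rounding. The case $t=3$ gives time $n^{\mathcal{O}(n^{3/4})}$ on graphs excluding $P_6$ and the 1-subdivided claw $S_3$. -/

import Mathlib

/-! Additive real RAM.  The store consists of arrays of natural numbers and arrays of real numbers;
each program uses finitely many arrays, named by constants, with computed indices.  The available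
operations are addition, (truncated) subtraction and comparison, and the real constants `0`, `1`.
There is no multiplication, division or rounding, so that unit cost per operation is a realistic
measure.  Programs are built with `seq`, `cond`, `loop`. -/

namespace RealRAM

/-- Contents of the memory: `σ.nat a i` is entry `i` of the array of naturals with name `a`,
`σ.real a i` is entry `i` of the array of reals with name `a`. -/
structure Store where
  nat : ℕ → ℕ → ℕ
  real : ℕ → ℕ → ℝ

/-- Overwrite one entry of an array of naturals. -/
def Store.setNat (σ : Store) (a i v : ℕ) : Store :=
  { σ with nat := Function.update σ.nat a (Function.update (σ.nat a) i v) }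

/-- Overwrite one entry of an array of reals. -/
noncomputable def Store.setReal (σ : Store) (a i : ℕ) (v : ℝ) : Store :=
  { σ with real := Function.update σ.real a (Function.update (σ.real a) i v) }

/-- Expressions with values in the natural numbers. -/
inductive NatExpr where
  | const (c : ℕ)
  | cell (a : ℕ) (i : NatExpr)
  | add (e f : NatExpr)
  | sub (e f : NatExpr)

/-- Value of an expression; subtraction is truncated at `0`. -/
def NatExpr.eval (σ : Store) : NatExpr → ℕ
  | const c => c
  | cell a i => σ.nat a (i.eval σ)
  | add e f => e.eval σ + f.eval σ
  | sub e f => e.eval σ - f.eval σ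

/-- Number of elementary operations needed to evaluate an expression. -/
def NatExpr.cost : NatExpr → ℕ
  | const _ => 1
  | cell _ i => i.cost + 1
  | add e f => e.cost + f.cost + 1
  | sub e f => e.cost + f.cost + 1

/-- Expressions with values in the real numbers. -/
inductive RealExpr where
  | zero
  | one
  | cell (a : ℕ) (i : NatExpr)
  | add (r s : RealExpr)
  | sub (r s : RealExpr)

/-- Value of a real expression. -/
noncomputable def RealExpr.eval (σ : Store) : RealExpr → ℝ
  | zero => 0
  | one => 1
  | cell a i => σ.real a (i.eval σ)
  | add r s => r.eval σ + s.eval σ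
  | sub r s => r.eval σ - s.eval σ

/-- Number of elementary operations needed to evaluate a real expression. -/
def RealExpr.cost : RealExpr → ℕ
  | zero => 1
  | one => 1
  | cell _ i => i.cost + 1
  | add r s => r.cost + s.cost + 1
  | sub r s => r.cost + s.cost + 1

/-- Conditions on which a program can branch. -/
inductive Test where
  | natLt (e f : NatExpr)
  | realLt (r s : RealExpr)
  | not (b : Test)
  | and (b c : Test)

/-- Truth of a condition. -/
def Test.Holds (σ : Store) : Test → Prop
  | natLt e f => e.eval σ < f.eval σ
  | realLt r s => r.eval σ < s.eval σ
  | not b => ¬ b.Holds σ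
  | and b c => b.Holds σ ∧ c.Holds σ

/-- Number of elementary operations needed to evaluate a condition. -/
def Test.cost : Test → ℕ
  | natLt e f => e.cost + f.cost + 1
  | realLt r s => r.cost + s.cost + 1
  | not b => b.cost + 1
  | and b c => b.cost + c.cost + 1

/-- Programs. -/
inductive Program where
  | skip
  | setNat (a : ℕ) (i e : NatExpr)
  | setReal (a : ℕ) (i : NatExpr) (r : RealExpr)
  | seq (p q : Program)
  | cond (b : Test) (p q : Program)
  | loop (b : Test) (p : Program)

/-- `Exec p σ m τ`: started in the store `σ`, the program `p` halts in the store `τ` after exactly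
`m` elementary steps. -/
inductive Exec : Program → Store → ℕ → Store → Prop
  | skip (σ : Store) : Exec .skip σ 1 σ
  | setNat (σ : Store) (a : ℕ) (i e : NatExpr) :
      Exec (.setNat a i e) σ (i.cost + e.cost + 1) (σ.setNat a (i.eval σ) (e.eval σ))
  | setReal (σ : Store) (a : ℕ) (i : NatExpr) (r : RealExpr) :
      Exec (.setReal a i r) σ (i.cost + r.cost + 1) (σ.setReal a (i.eval σ) (r.eval σ))
  | seq {p q : Program} {σ τ υ : Store} {m k : ℕ} :
      Exec p σ m τ → Exec q τ k υ → Exec (.seq p q) σ (m + k) υ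
  | cond_pos {b : Test} {p q : Program} {σ τ : Store} {m : ℕ} :
      b.Holds σ → Exec p σ m τ → Exec (.cond b p q) σ (b.cost + 1 + m) τ
  | cond_neg {b : Test} {p q : Program} {σ τ : Store} {m : ℕ} :
      ¬ b.Holds σ → Exec q σ m τ → Exec (.cond b p q) σ (b.cost + 1 + m) τ
  | loop_stop {b : Test} {p : Program} {σ : Store} :
      ¬ b.Holds σ → Exec (.loop b p) σ (b.cost + 1) σ
  | loop_step {b : Test} {p : Program} {σ τ υ : Store} {m k : ℕ} :
      b.Holds σ → Exec p σ m τ → Exec (.loop b p) τ k υ →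
        Exec (.loop b p) σ (b.cost + 1 + m + k) υ

/-- Programs are deterministic: the final store and the number of steps are unique. -/
theorem Exec.unique {p : Program} {σ τ τ' : Store} {m m' : ℕ}
    (h : Exec p σ m τ) (h' : Exec p σ m' τ') : m = m' ∧ τ = τ' := by
  induction h generalizing m' τ' with
  | skip => cases h'; exact ⟨rfl, rfl⟩
  | setNat => cases h'; exact ⟨rfl, rfl⟩
  | setReal => cases h'; exact ⟨rfl, rfl⟩
  | seq _ _ ih₁ ih₂ =>
    cases h' with
    | seq g₁ g₂ =>
      obtain ⟨rfl, rfl⟩ := ih₁ g₁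
      obtain ⟨rfl, rfl⟩ := ih₂ g₂
      exact ⟨rfl, rfl⟩
  | cond_pos hb _ ih =>
    cases h' with
    | cond_pos _ g => obtain ⟨rfl, rfl⟩ := ih g; exact ⟨rfl, rfl⟩
    | cond_neg hn _ => exact absurd hb hn
  | cond_neg hb _ ih =>
    cases h' with
    | cond_pos hn _ => exact absurd hn hb
    | cond_neg _ g => obtain ⟨rfl, rfl⟩ := ih g; exact ⟨rfl, rfl⟩
  | loop_stop hb =>
    cases h' with
    | loop_stop _ => exact ⟨rfl, rfl⟩
    | loop_step hn _ _ => exact absurd hn hb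
  | loop_step hb _ _ ih₁ ih₂ =>
    cases h' with
    | loop_stop hn => exact absurd hb hn
    | loop_step _ g₁ g₂ =>
      obtain ⟨rfl, rfl⟩ := ih₁ g₁
      obtain ⟨rfl, rfl⟩ := ih₂ g₂
      exact ⟨rfl, rfl⟩

end RealRAM

namespace MaxPartialColoring

/-- `S_t`: the star `K_{1,t}` with every edge subdivided once.  `none` is the centre,
`some (i, false)` the vertex subdividing the `i`-th edge, `some (i, true)` the `i`-th leaf. -/
def subdividedStar (t : ℕ) : SimpleGraph (Option (Fin t × Bool)) :=
  SimpleGraph.fromRel fun x y =>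
    ∃ i : Fin t, (x = none ∧ y = some (i, false)) ∨ (x = some (i, false) ∧ y = some (i, true))

/-- `{P₆, S_t}`-free graphs: neither the path on six vertices nor `S_t` is an induced subgraph. -/
def P6StFree (t : ℕ) {n : ℕ} (G : SimpleGraph (Fin n)) : Prop :=
  ¬ (SimpleGraph.pathGraph 6).IsIndContained G ∧ ¬ (subdividedStar t).IsIndContained G

/-- A partial function `φ` from `V(G)` to `V(H)` (`φ u = none` where it is undefined) is a partial
`H`-coloring if it is a homomorphism from the subgraph induced by its domain to `H`. -/
def IsPartialColoring {n k : ℕ} (H : SimpleGraph (Fin k)) (G : SimpleGraph (Fin n))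
    (φ : Fin n → Option (Fin k)) : Prop :=
  ∀ u v a b, G.Adj u v → φ u = some a → φ v = some b → H.Adj a b

/-- Total revenue of a partial function: the sum of `rev u (φ u)` over the domain of `φ`. -/
noncomputable def revenue {n k : ℕ} (rev : Fin n → Fin k → ℝ) (φ : Fin n → Option (Fin k)) : ℝ :=
  ∑ u, (φ u).elim 0 (rev u)

/-- Optimum solutions of the instance `(G, rev)` of Max Partial `H`-Coloring. -/
def IsOptimum {n k : ℕ} (H : SimpleGraph (Fin k)) (G : SimpleGraph (Fin n))
    (rev : Fin n → Fin k → ℝ) (φ : Fin n → Option (Fin k)) : Prop :=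
  IsPartialColoring H G φ ∧
    ∀ ψ : Fin n → Option (Fin k), IsPartialColoring H G ψ → revenue rev ψ ≤ revenue rev φ

open Classical in
/-- The store that holds the input `(G, rev)`, and `0` everywhere else: the number `n` of vertices
is entry `0` of natural array `0`, the adjacency matrix is in natural array `1` (row by row,
entry `u * n + v`), the revenues are in real array `0` (row by row, entry `u * k + c`). -/
noncomputable def inputStore {n k : ℕ} (G : SimpleGraph (Fin n)) (rev : Fin n → Fin k → ℝ) :
    RealRAM.Store where
  nat a i :=
    if a = 0 ∧ i = 0 then n
    else if a = 1 ∧ ∃ u v : Fin n, i = u * n + v ∧ G.Adj u v then 1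
    else 0
  real a i :=
    if h : a = 0 ∧ i < n * k then
      rev ⟨i / k, Nat.div_lt_of_lt_mul (by rw [Nat.mul_comm]; exact h.2)⟩
        ⟨i % k, Nat.mod_lt i (Nat.pos_of_ne_zero fun hk => by simp [hk] at h)⟩
    else 0

/-- The output is read from natural array `2`: entry `u` is `0` if the vertex `u` is uncolored, and
`c + 1` if it has color `c`. -/
def Outputs {n k : ℕ} (τ : RealRAM.Store) (φ : Fin n → Option (Fin k)) : Prop :=
  ∀ u : Fin n, τ.nat 2 u = (φ u).elim 0 fun c => (c : ℕ) + 1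

/-- Max Partial `H`-Coloring restricted to the graph class `𝒢` can be solved in time `T n`, where
`n` is the number of vertices of the input graph: a single program halts within that many steps on
every instance and outputs an optimum solution. -/
def SolvableInTime {k : ℕ} (H : SimpleGraph (Fin k))
    (𝒢 : ∀ {n : ℕ}, SimpleGraph (Fin n) → Prop) (T : ℕ → ℝ) : Prop :=
  ∃ p : RealRAM.Program, ∀ (n : ℕ) (G : SimpleGraph (Fin n)), 𝒢 G →
    ∀ rev : Fin n → Fin k → ℝ, ∃ (m : ℕ) (τ : RealRAM.Store) (φ : Fin n → Option (Fin k)),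
      RealRAM.Exec p (inputStore G rev) m τ ∧ (m : ℝ) ≤ T n ∧ Outputs τ φ ∧ IsOptimum H G rev φ

end MaxPartialColoring

/-! Partial `H`-colorings of `G` are the independent sets of the conflict graph `E` on the pairs
(vertex, color), where two pairs are adjacent if they share the vertex, or if their vertices are
adjacent in `G` while their colors are not adjacent in `H`. With `k = |V(H)|`, `E` has `N = n * k`
vertices, and the task is maximum weight independent set in `E`. The argument gives time `n ^
O(√n)`, which is within the required bound because `1/2 ≤ t/(t+1)` for `t ≥ 1`; for `t = 0` the
graph has no vertices.

The structural core is `exists_separator`: a set of pairs in which all closed `E`-neighborhoods have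
at most `Δ` elements has a balanced separator of size `O(Δ)`. This is a Gyárfás path argument. For a
vertex `v` of `G`, the conflicts between neighbors and non-neighbors of `v` are covered by `O(Δ)`
pairs (`exists_cover`), because for each choice of two colors a large induced matching among them
would be an induced `S_t` centred at `v`. After deletion of the cover, the large component lies on
one side of `v`. On the non-neighbor side an induced path in `G` can be extended, which cannot
happen five times in a `P₆`-free graph. On the neighbor side the color used at `v` is lost, and
induction on the number of colors applies.

Given separators, a set of `m` pairs is solved by branching: put pairs with more than `√m` elements
in their closed neighborhood into the solution, at most about `√m` times; discard the other pairs of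
high degree; decide about each element of a separator of size `O(√m)`; split into components of at
most half the size. The depth is a geometric sum, hence `O(√N)` (`budget_le`, `solved_of_room`).

The program never searches for a separator. It lists all `(5N+1) ^ O(√N)` sets reachable by
sequences of five elementary operations (`item`, `runs_genProg`). From the largest index down, it
then improves the solution of each set by trying all unions of two stored solutions (`runs_dpProg`).
`Cov` records which sets such unions are certain to compete with, and `solved_of_room` shows that
every independent set is among them at the root. `Runs` and `Program.bound_le` turn this into a step
count, and `time_le` estimates it. -/

namespace RealRAM

/-! ### Program logic for the machine: frames, running time, rule for counting loops. -/

/-- Nat arrays that a program may write to. -/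
def Program.natWrites : Program → List ℕ
  | .skip => []
  | .setNat a _ _ => [a]
  | .setReal _ _ _ => []
  | .seq p q => p.natWrites ++ q.natWrites
  | .cond _ p q => p.natWrites ++ q.natWrites
  | .loop _ p => p.natWrites

/-- Real arrays that a program may write to. -/
def Program.realWrites : Program → List ℕ
  | .skip => []
  | .setNat _ _ _ => []
  | .setReal a _ _ => [a]
  | .seq p q => p.realWrites ++ q.realWrites
  | .cond _ p q => p.realWrites ++ q.realWrites
  | .loop _ p => p.realWrites

/-- `τ` differs from `σ` only in arrays that `p` writes to. -/
structure Frame (p : Program) (σ τ : Store) : Prop where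
  nat : ∀ a, a ∉ p.natWrites → τ.nat a = σ.nat a
  real : ∀ a, a ∉ p.realWrites → τ.real a = σ.real a

@[simp] theorem setNat_nat_same (σ : Store) (a i v j : ℕ) :
    (σ.setNat a i v).nat a j = if j = i then v else σ.nat a j := by
  simp [Store.setNat, Function.update_apply]

@[simp] theorem setNat_nat_ne (σ : Store) (a i v b : ℕ) (h : b ≠ a) :
    (σ.setNat a i v).nat b = σ.nat b := by
  simp [Store.setNat, h]

@[simp] theorem setNat_real (σ : Store) (a i v : ℕ) : (σ.setNat a i v).real = σ.real := rfl

@[simp] theorem setReal_real_same (σ : Store) (a i : ℕ) (v : ℝ) (j : ℕ) :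
    (σ.setReal a i v).real a j = if j = i then v else σ.real a j := by
  simp [Store.setReal, Function.update_apply]

@[simp] theorem setReal_real_ne (σ : Store) (a i : ℕ) (v : ℝ) (b : ℕ) (h : b ≠ a) :
    (σ.setReal a i v).real b = σ.real b := by
  simp [Store.setReal, h]

@[simp] theorem setReal_nat (σ : Store) (a i : ℕ) (v : ℝ) : (σ.setReal a i v).nat = σ.nat := rfl

theorem Frame.of_exec {p : Program} {σ τ : Store} {m : ℕ} (h : Exec p σ m τ) : Frame p σ τ := by
  induction h with
  | skip => exact ⟨fun _ _ => rfl, fun _ _ => rfl⟩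
  | setNat σ a i e =>
    refine ⟨fun b hb => ?_, fun _ _ => rfl⟩
    simp only [Program.natWrites, List.mem_singleton] at hb
    exact setNat_nat_ne _ _ _ _ _ hb
  | setReal σ a i e =>
    refine ⟨fun _ _ => rfl, fun b hb => ?_⟩
    simp only [Program.realWrites, List.mem_singleton] at hb
    exact setReal_real_ne _ _ _ _ _ hb
  | seq _ _ ih₁ ih₂ =>
    refine ⟨fun b hb => ?_, fun b hb => ?_⟩
    · simp only [Program.natWrites, List.mem_append, not_or] at hb
      rw [ih₂.nat b hb.2, ih₁.nat b hb.1]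
    · simp only [Program.realWrites, List.mem_append, not_or] at hb
      rw [ih₂.real b hb.2, ih₁.real b hb.1]
  | cond_pos _ _ ih =>
    refine ⟨fun b hb => ?_, fun b hb => ?_⟩
    · simp only [Program.natWrites, List.mem_append, not_or] at hb
      exact ih.nat b hb.1
    · simp only [Program.realWrites, List.mem_append, not_or] at hb
      exact ih.real b hb.1
  | cond_neg _ _ ih =>
    refine ⟨fun b hb => ?_, fun b hb => ?_⟩
    · simp only [Program.natWrites, List.mem_append, not_or] at hb
      exact ih.nat b hb.2
    · simp only [Program.realWrites, List.mem_append, not_or] at hb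
      exact ih.real b hb.2
  | loop_stop => exact ⟨fun _ _ => rfl, fun _ _ => rfl⟩
  | loop_step _ _ _ ih₁ ih₂ =>
    exact ⟨fun b hb => (ih₂.nat b hb).trans (ih₁.nat b hb),
      fun b hb => (ih₂.real b hb).trans (ih₁.real b hb)⟩

/-- Running time of a program each of whose loops makes at most `B` iterations. -/
def Program.bound (B : ℕ) : Program → ℕ
  | .skip => 1
  | .setNat _ i e => i.cost + e.cost + 1
  | .setReal _ i r => i.cost + r.cost + 1
  | .seq p q => p.bound B + q.bound B
  | .cond b p q => b.cost + 1 + (p.bound B + q.bound B)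
  | .loop b p => (b.cost + 1 + p.bound B) * (B + 1)

/-- Syntactic size of a program, weighted with the cost of its elementary operations. -/
def Program.size : Program → ℕ
  | .skip => 1
  | .setNat _ i e => i.cost + e.cost + 1
  | .setReal _ i r => i.cost + r.cost + 1
  | .seq p q => p.size + q.size
  | .cond b p q => b.cost + 1 + (p.size + q.size)
  | .loop b p => b.cost + 1 + p.size

/-- Nesting depth of the loops of a program. -/
def Program.depth : Program → ℕ
  | .skip => 0
  | .setNat _ _ _ => 0
  | .setReal _ _ _ => 0
  | .seq p q => max p.depth q.depth
  | .cond _ p q => max p.depth q.depth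
  | .loop _ p => p.depth + 1

/-- Only nesting of loops multiplies, so the bound is polynomial in `B`, with degree and leading
factor fixed by the program text. -/
theorem Program.bound_le (B : ℕ) (p : Program) : p.bound B ≤ p.size * (B + 1) ^ p.depth := by
  have mono : ∀ (s d d' : ℕ), d ≤ d' → s * (B + 1) ^ d ≤ s * (B + 1) ^ d' := fun s d d' h =>
    Nat.mul_le_mul_left _ (Nat.pow_le_pow_right (Nat.succ_pos _) h)
  have one : ∀ s d : ℕ, s ≤ s * (B + 1) ^ d := fun s d =>
    Nat.le_mul_of_pos_right _ (Nat.pow_pos (Nat.succ_pos _))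
  induction p with
  | skip => exact one _ _
  | setNat => exact one _ _
  | setReal => exact one _ _
  | seq p q ihp ihq =>
    have h1 := ihp.trans (mono _ _ _ (le_max_left p.depth q.depth))
    have h2 := ihq.trans (mono _ _ _ (le_max_right p.depth q.depth))
    simp only [Program.bound, Program.size, Program.depth, add_mul]
    omega
  | cond b p q ihp ihq =>
    have h1 := ihp.trans (mono _ _ _ (le_max_left p.depth q.depth))
    have h2 := ihq.trans (mono _ _ _ (le_max_right p.depth q.depth))
    have h3 := one (b.cost + 1) (max p.depth q.depth)
    simp only [Program.bound, Program.size, Program.depth]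
    rw [add_mul (b.cost + 1), add_mul p.size]
    omega
  | loop b p ih =>
    simp only [Program.bound, Program.size, Program.depth, pow_succ]
    rw [← mul_assoc]
    refine Nat.mul_le_mul_right _ ?_
    have h3 := one (b.cost + 1) p.depth
    rw [add_mul]
    omega

/-- Started in `σ`, the program `p` halts within `p.bound B` steps in a store that satisfies `Q`. -/
def Runs (B : ℕ) (p : Program) (σ : Store) (Q : Store → Prop) : Prop :=
  ∃ (m : ℕ) (τ : Store), Exec p σ m τ ∧ m ≤ p.bound B ∧ Q τ

namespace Runs

variable {B : ℕ} {σ : Store} {Q R : Store → Prop} {p q : Program}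

theorem mono_frame (h : Runs B p σ Q) (hQ : ∀ τ, Frame p σ τ → Q τ → R τ) : Runs B p σ R := by
  obtain ⟨m, τ, he, hm, hq⟩ := h
  exact ⟨m, τ, he, hm, hQ τ (.of_exec he) hq⟩

theorem skip (h : Q σ) : Runs B .skip σ Q := ⟨_, _, .skip _, le_rfl, h⟩

theorem setNat {a : ℕ} {i e : NatExpr} (h : Q (σ.setNat a (i.eval σ) (e.eval σ))) :
    Runs B (.setNat a i e) σ Q := ⟨_, _, .setNat _ _ _ _, le_rfl, h⟩

theorem setReal {a : ℕ} {i : NatExpr} {r : RealExpr}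
    (h : Q (σ.setReal a (i.eval σ) (r.eval σ))) :
    Runs B (.setReal a i r) σ Q := ⟨_, _, .setReal _ _ _ _, le_rfl, h⟩

theorem seq (h : Runs B p σ fun τ => Runs B q τ Q) : Runs B (.seq p q) σ Q := by
  obtain ⟨m, τ, he, hm, m', υ, he', hm', hq⟩ := h
  exact ⟨_, _, .seq he he', Nat.add_le_add hm hm', hq⟩

theorem cond {b : Test} (h₁ : b.Holds σ → Runs B p σ Q) (h₂ : ¬ b.Holds σ → Runs B q σ Q) :
    Runs B (.cond b p q) σ Q := by
  by_cases hb : b.Holds σ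
  · obtain ⟨m, τ, he, hm, hq⟩ := h₁ hb
    exact ⟨_, _, .cond_pos hb he, by simp only [Program.bound]; omega, hq⟩
  · obtain ⟨m, τ, he, hm, hq⟩ := h₂ hb
    exact ⟨_, _, .cond_neg hb he, by simp only [Program.bound]; omega, hq⟩

end Runs

/-- Scalar variables are entries `0` of arrays. -/
abbrev NatExpr.var (a : ℕ) : NatExpr := .cell a (.const 0)

/-- Assignment to a scalar variable. -/
abbrev Program.assign (a : ℕ) (e : NatExpr) : Program := .setNat a (.const 0) e

/-- `for i in [0, e): p`. -/
def Program.for (i : ℕ) (e : NatExpr) (p : Program) : Program :=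
  .seq (.assign i (.const 0))
    (.loop (.natLt (.var i) e) (.seq p (.assign i (.add (.var i) (.const 1)))))

/-- The invariant `I` has to survive changes of the counter cell, because the counter is written
outside the body. The frames handed to `he`, `hs` and `hQ` relate every intermediate store to `σ`,
so an invariant need only mention what the loop changes. -/
theorem Runs.for {B : ℕ} {σ : Store} {Q : Store → Prop} {p : Program} {i : ℕ} {e : NatExpr}
    (b : ℕ) (I : ℕ → Store → Prop) (hb : b ≤ B)
    (he : ∀ τ, Frame (.for i e p) σ τ → e.eval τ = b)
    (hi : i ∉ p.natWrites)
    (hI : ∀ j τ v, I j τ → I j (τ.setNat i 0 v))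
    (h0 : I 0 σ)
    (hs : ∀ j < b, ∀ τ, Frame (.for i e p) σ τ → τ.nat i 0 = j → I j τ → Runs B p τ (I (j + 1)))
    (hQ : ∀ τ, Frame (.for i e p) σ τ → I b τ → Q τ) :
    Runs B (.for i e p) σ Q := by
  have wr : ∀ a, a ∉ (Program.for i e p).natWrites ↔ a ≠ i ∧ a ∉ p.natWrites := by
    intro a
    simp only [Program.for, Program.natWrites, List.mem_append, List.mem_singleton]
    tauto
  have wr' : ∀ a, a ∉ (Program.for i e p).realWrites ↔ a ∉ p.realWrites := by
    intro a
    simp [Program.for, Program.realWrites]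
  -- Induction on the number `d` of remaining iterations. The summand `e.cost + 4` pays for the test
  -- and `6` for the increment; `d + 1` instead of `d` pays for the final failing test.
  have key : ∀ d j τ, j + d = b → Frame (.for i e p) σ τ → τ.nat i 0 = j → I j τ →
      ∃ (m : ℕ) (υ : Store),
        Exec (.loop (.natLt (.var i) e) (.seq p (.assign i (.add (.var i) (.const 1))))) τ m υ ∧
        m ≤ ((e.cost + 4) + (p.bound B + 6)) * (d + 1) ∧ Q υ := by
    intro d
    induction d with
    | zero =>
      intro j τ hj hF hv hIj
      have hn : ¬ (Test.natLt (.var i) e).Holds τ := by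
        simp [Test.Holds, NatExpr.eval, he τ hF, hv]; omega
      refine ⟨_, _, Exec.loop_stop hn, ?_, hQ τ hF ?_⟩
      · simp only [Test.cost, NatExpr.cost]; omega
      · obtain rfl : j = b := by omega
        exact hIj
    | succ d ih =>
      intro j τ hj hF hv hIj
      have hn : (Test.natLt (.var i) e).Holds τ := by
        simp [Test.Holds, NatExpr.eval, he τ hF, hv]; omega
      obtain ⟨m, υ, hx, hm, hIυ⟩ := hs j (by omega) τ hF hv hIj
      have hf := Frame.of_exec hx
      have hv' : υ.nat i 0 = j := by rw [hf.nat i hi, hv]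
      have hx2 := Exec.setNat υ i (.const 0) (.add (.var i) (.const 1))
      simp only [NatExpr.eval, hv', NatExpr.cost] at hx2
      have hfr : Frame (.for i e p) σ (υ.setNat i 0 (j + 1)) := by
        refine ⟨fun a ha => ?_, fun a ha => ?_⟩
        · rw [setNat_nat_ne _ _ _ _ _ ((wr a).1 ha).1, hf.nat a ((wr a).1 ha).2, hF.nat a ha]
        · rw [setNat_real, hf.real a ((wr' a).1 ha), hF.real a ha]
      obtain ⟨m', ω, hx', hm', hq⟩ := ih (j + 1) (υ.setNat i 0 (j + 1)) (by omega)
        hfr (by simp) (hI _ _ _ hIυ)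
      refine ⟨_, _, .loop_step hn (.seq hx hx2) hx', ?_, hq⟩
      simp only [Test.cost, NatExpr.cost]
      rw [mul_add _ (d + 1)]
      omega
  obtain ⟨m, υ, hx, hm, hq⟩ := key b 0 (σ.setNat i 0 0) (by omega)
    ⟨fun a ha => setNat_nat_ne _ _ _ _ _ ((wr a).1 ha).1, fun a _ => rfl⟩ (by simp) (hI _ _ _ h0)
  refine ⟨_, _, .seq (.setNat σ i (.const 0) (.const 0)) hx, ?_, hq⟩
  have h1 : ((e.cost + 4) + (p.bound B + 6)) * (b + 1) ≤
      ((e.cost + 4) + (p.bound B + 6)) * (B + 1) := Nat.mul_le_mul_left _ (by omega)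
  have h2 : ((e.cost + 4) + (p.bound B + 6)) * (B + 1) =
    (Program.loop (.natLt (.var i) e) (.seq p (.assign i (.add (.var i) (.const 1))))).bound B := by
    simp only [Program.bound, Test.cost, NatExpr.cost]
    ring
  simp only [Program.for, Program.bound, NatExpr.cost] at h2 ⊢
  omega

end RealRAM

/-! ### Components and neighborhoods inside a vertex set. -/

namespace MaxPartialColoring

open Classical

/-- The edges of `E` between vertices of `Y`. -/
def restr {ι : Type*} (E : SimpleGraph ι) (Y : Set ι) : SimpleGraph ι where
  Adj x y := x ∈ Y ∧ y ∈ Y ∧ E.Adj x y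
  symm := ⟨fun _ _ h => ⟨h.2.1, h.1, h.2.2.symm⟩⟩
  loopless := ⟨fun _ h => h.2.2.ne rfl⟩

theorem restr_mono {ι : Type*} (E : SimpleGraph ι) {Y Z : Set ι} (h : Y ⊆ Z) :
    restr E Y ≤ restr E Z := fun _ _ hxy => ⟨h hxy.1, h hxy.2.1, hxy.2.2⟩

/-- A set that is closed under adjacency is closed under reachability. -/
theorem mem_of_reachable {ι : Type*} {E : SimpleGraph ι} {S : Set ι} {x y : ι}
    (h : E.Reachable x y) (hx : x ∈ S) (hS : ∀ a b, E.Adj a b → a ∈ S → b ∈ S) : y ∈ S := by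
  obtain ⟨p⟩ := h
  induction p with
  | nil => exact hx
  | cons hab _ ih => exact ih (hS _ _ hab hx)

/-- Reachability is inherited by a larger graph on a closed set. -/
theorem reachable_of_reachable {ι κ : Type*} {E : SimpleGraph ι} {F : SimpleGraph κ} (f : ι → κ)
    {x y : ι} (h : E.Reachable x y)
    (hS : ∀ a b, E.Reachable x a → E.Adj a b → F.Reachable (f a) (f b)) :
    F.Reachable (f x) (f y) :=
  (mem_of_reachable (S := {z | E.Reachable x z ∧ F.Reachable (f x) (f z)}) h
    ⟨.refl _, .refl _⟩
    fun a b hab ha => ⟨ha.1.trans hab.reachable, ha.2.trans (hS a b ha.1 hab)⟩).2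

/-- The component of `x` in the subgraph of `E` induced by `Y`. -/
noncomputable def comp {ι : Type*} (E : SimpleGraph ι) (Y : Finset ι) (x : ι) : Finset ι :=
  Y.filter fun y => (restr E Y).Reachable x y

theorem mem_comp {ι : Type*} {E : SimpleGraph ι} {Y : Finset ι} {x y : ι} :
    y ∈ comp E Y x ↔ y ∈ Y ∧ (restr E Y).Reachable x y := by simp [comp]

/-- The closed neighborhood of `x` in the subgraph of `E` induced by `Y`. -/
noncomputable def nbhd {ι : Type*} (E : SimpleGraph ι) (Y : Finset ι) (x : ι) : Finset ι :=
  Y.filter fun y => y = x ∨ E.Adj x y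

theorem mem_nbhd {ι : Type*} {E : SimpleGraph ι} {Y : Finset ι} {x y : ι} :
    y ∈ nbhd E Y x ↔ y ∈ Y ∧ (y = x ∨ E.Adj x y) := by simp [nbhd]

theorem nbhd_subset {ι : Type*} {E : SimpleGraph ι} {Y : Finset ι} {x : ι} : nbhd E Y x ⊆ Y :=
  fun _ h => (mem_nbhd.1 h).1

theorem nbhd_mono {ι : Type*} {E : SimpleGraph ι} {Y Z : Finset ι} {x : ι} (h : Y ⊆ Z) :
    nbhd E Y x ⊆ nbhd E Z x := fun _ hy => mem_nbhd.2 ⟨h (mem_nbhd.1 hy).1, (mem_nbhd.1 hy).2⟩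

/-- In a set with at most `2m+1` elements, the component with more than `m` elements contains every
connected set with more than `m` elements. -/
theorem comp_subset_comp {ι : Type*} {E : SimpleGraph ι} {Y : Finset ι} {m : ℕ}
    (hm : Y.card < 2 * (m + 1)) {A B : Finset ι} (hA : A ⊆ Y) (hBA : B ⊆ A) {x y : ι}
    (hx : m < (comp E A x).card) (hy : m < (comp E B y).card) : comp E B y ⊆ comp E A x := by
  have h1 : ¬ Disjoint (comp E A x) (comp E B y) := fun hd => by
    have hsub : comp E A x ∪ comp E B y ⊆ Y := by
      intro z hz
      rcases Finset.mem_union.1 hz with hz | hz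
      · exact hA (mem_comp.1 hz).1
      · exact hA (hBA (mem_comp.1 hz).1)
    have := Finset.card_le_card hsub
    rw [Finset.card_union_of_disjoint hd] at this
    omega
  obtain ⟨z, hzA, hzB⟩ := Finset.not_disjoint_iff.1 h1
  intro w hw
  have hmono : restr E (B : Set ι) ≤ restr E (A : Set ι) := restr_mono E (by exact_mod_cast hBA)
  rw [mem_comp] at *
  exact ⟨hBA hw.1, hzA.2.trans ((hzB.2.symm.trans hw.2).mono hmono)⟩

/-! ### Balanced separators of sparse conflict graphs. -/

section structure_theorem

variable {ι V κ : Type*} {E : SimpleGraph ι} {G : SimpleGraph V} {H : SimpleGraph κ}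
  {vtx : ι → V} {col : ι → κ}

/-- `E` is the graph of conflicts between assignments of colors to vertices. -/
def IsConflict (E : SimpleGraph ι) (G : SimpleGraph V) (H : SimpleGraph κ) (vtx : ι → V)
    (col : ι → κ) (Y : Finset ι) : Prop :=
  ∀ x ∈ Y, ∀ y ∈ Y, E.Adj x y ↔
    x ≠ y ∧ (vtx x = vtx y ∨ (G.Adj (vtx x) (vtx y) ∧ ¬ H.Adj (col x) (col y)))

/-- An induced matching whose edges have exactly one end adjacent to `v` is smaller than `t`
if there is no induced subdivided star `S_t`. -/
theorem card_lt_of_not_isIndContained {t : ℕ} (hS : ¬ (subdividedStar t).IsIndContained G)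
    (v : V) {μ : Type*} (P : Finset μ) (a b : μ → V)
    (hva : ∀ i ∈ P, G.Adj v (a i)) (hvb : ∀ i ∈ P, v ≠ b i ∧ ¬ G.Adj v (b i))
    (hab : ∀ i ∈ P, G.Adj (a i) (b i))
    (haa : ∀ i ∈ P, ∀ j ∈ P, i ≠ j → a i ≠ a j ∧ ¬ G.Adj (a i) (a j))
    (hbb : ∀ i ∈ P, ∀ j ∈ P, i ≠ j → b i ≠ b j ∧ ¬ G.Adj (b i) (b j))
    (hab' : ∀ i ∈ P, ∀ j ∈ P, i ≠ j → ¬ G.Adj (a i) (b j)) : P.card < t := by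
  by_contra hlt
  push Not at hlt
  obtain ⟨e⟩ : Nonempty (Fin t ↪ P) :=
    Function.Embedding.nonempty_of_card_le (by simpa using hlt)
  apply hS
  have hne : ∀ i j : Fin t, i ≠ j → (e i : μ) ≠ e j := fun i j h h' => h (e.injective (Subtype.ext h'))
  have hneab : ∀ i j : Fin t, a (e i) ≠ b (e j) := fun i j h =>
    (hvb _ (e j).2).2 (h ▸ hva _ (e i).2)
  let f : Option (Fin t × Bool) → V
    | none => v
    | some (i, false) => a (e i)
    | some (i, true) => b (e i)
  refine ⟨⟨⟨f, ?_⟩, ?_⟩⟩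
  · rintro (_ | ⟨i, _ | _⟩) (_ | ⟨j, _ | _⟩) h
    · rfl
    · exact absurd h (hva _ (e j).2).ne
    · exact absurd h (hvb _ (e j).2).1
    · exact absurd h.symm (hva _ (e i).2).ne
    · by_contra hij
      exact (haa _ (e i).2 _ (e j).2 (hne i j fun h => hij (by rw [h]))).1 h
    · exact absurd h (hneab i j)
    · exact absurd h.symm (hvb _ (e i).2).1
    · exact absurd h.symm (hneab j i)
    · by_contra hij
      exact (hbb _ (e i).2 _ (e j).2 (hne i j fun h => hij (by rw [h]))).1 h
  · intro x y
    have key : ∀ i j : Fin t, i ≠ j → ¬ G.Adj (b (e i)) (a (e j)) := fun i j hij h =>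
      hab' _ (e j).2 _ (e i).2 (hne _ _ hij.symm) h.symm
    change G.Adj (f x) (f y) ↔ _
    simp only [subdividedStar, SimpleGraph.fromRel_adj]
    rcases x with _ | ⟨i, _ | _⟩ <;> rcases y with _ | ⟨j, _ | _⟩
    · simp [f]
    · simpa [f] using hva _ (e j).2
    · simpa [f] using (hvb _ (e j).2).2
    · simpa [f] using (hva _ (e i).2).symm
    · by_cases hij : i = j
      · subst hij; simp [f]
      · simpa [f] using (haa _ (e i).2 _ (e j).2 (hne _ _ hij)).2
    · by_cases hij : i = j
      · subst hij; simpa [f] using hab _ (e i).2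
      · simp [f, hij, Ne.symm hij, hab' _ (e i).2 _ (e j).2 (hne _ _ hij)]
    · simpa [f] using fun h : G.Adj _ _ => (hvb _ (e i).2).2 h.symm
    · by_cases hij : i = j
      · subst hij; simpa [f] using (hab _ (e i).2).symm
      · simp [f, hij, key i j hij]
    · by_cases hij : i = j
      · subst hij; simp [f]
      · simpa [f] using (hbb _ (e i).2 _ (e j).2 (hne _ _ hij)).2

/-- The conflicts between neighbors and non-neighbors of `v` with fixed colors have a small vertex
cover. -/
theorem exists_cover_of_colors {t Δ : ℕ} (hS : ¬ (subdividedStar t).IsIndContained G)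
    {Y : Finset ι} (hE : IsConflict E G H vtx col Y) (hΔ : ∀ x ∈ Y, (nbhd E Y x).card ≤ Δ)
    (v : V) (c d : κ) (hcd : ¬ H.Adj c d) :
    ∃ Z : Finset ι, Z.card ≤ t * (2 * Δ) ∧ ∀ x ∈ Y, ∀ y ∈ Y, E.Adj x y → col x = c → col y = d →
      G.Adj v (vtx x) → v ≠ vtx y → ¬ G.Adj v (vtx y) → x ∈ Z ∨ y ∈ Z := by
  -- A `good` set of pairs is an induced matching of `E` that crosses from the neighbors of `v` with
  -- color `c` to the non-neighbors with color `d`. The cover comes from one of maximum size.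
  let far : ι → ι → Prop := fun x y => x ≠ y ∧ ¬ E.Adj x y
  let good : Finset (ι × ι) → Prop := fun P =>
    (∀ p ∈ P, E.Adj p.1 p.2 ∧ col p.1 = c ∧ col p.2 = d ∧ G.Adj v (vtx p.1) ∧ v ≠ vtx p.2 ∧
      ¬ G.Adj v (vtx p.2)) ∧
    ∀ p ∈ P, ∀ q ∈ P, p ≠ q → far p.1 q.1 ∧ far p.1 q.2 ∧ far p.2 q.1 ∧ far p.2 q.2
  obtain ⟨P, hP, hmax⟩ := Finset.exists_max_image ((Y ×ˢ Y).powerset.filter good) Finset.card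
    ⟨∅, by simp [good]⟩
  simp only [Finset.mem_filter, Finset.mem_powerset] at hP hmax
  obtain ⟨hPY, hP1, hP2⟩ := hP
  have hY1 : ∀ p ∈ P, p.1 ∈ Y := fun p hp => (Finset.mem_product.1 (hPY hp)).1
  have hY2 : ∀ p ∈ P, p.2 ∈ Y := fun p hp => (Finset.mem_product.1 (hPY hp)).2
  -- For nonadjacent colors, absence of a conflict means absence of an edge of `G`. This applies to
  -- `c, c` and `d, d` because `H` has no loops, and to `c, d` by assumption, so the matching is
  -- also induced in `G`.
  have hfar : ∀ x ∈ Y, ∀ y ∈ Y, ¬ H.Adj (col x) (col y) → far x y →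
      vtx x ≠ vtx y ∧ ¬ G.Adj (vtx x) (vtx y) := fun x hx y hy hH hf =>
    ⟨fun h => hf.2 ((hE x hx y hy).2 ⟨hf.1, .inl h⟩),
      fun h => hf.2 ((hE x hx y hy).2 ⟨hf.1, .inr ⟨h, hH⟩⟩)⟩
  have hcard : P.card < t := by
    refine card_lt_of_not_isIndContained hS v P (fun p => vtx p.1) (fun p => vtx p.2)
      (fun p hp => (hP1 p hp).2.2.2.1) (fun p hp => (hP1 p hp).2.2.2.2) ?_ ?_ ?_ ?_
    · intro p hp
      have h := hP1 p hp
      rcases ((hE _ (hY1 p hp) _ (hY2 p hp)).1 h.1).2 with h' | h'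
      · exact absurd (h' ▸ h.2.2.2.1) h.2.2.2.2.2
      · exact h'.1
    · intro p hp q hq hpq
      exact hfar _ (hY1 p hp) _ (hY1 q hq)
        (by rw [(hP1 p hp).2.1, (hP1 q hq).2.1]; exact H.loopless.irrefl _) (hP2 p hp q hq hpq).1
    · intro p hp q hq hpq
      exact hfar _ (hY2 p hp) _ (hY2 q hq)
        (by rw [(hP1 p hp).2.2.1, (hP1 q hq).2.2.1]; exact H.loopless.irrefl _)
        (hP2 p hp q hq hpq).2.2.2
    · intro p hp q hq hpq
      exact (hfar _ (hY1 p hp) _ (hY2 q hq)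
        (by rw [(hP1 p hp).2.1, (hP1 q hq).2.2.1]; exact hcd) (hP2 p hp q hq hpq).2.1).2
  -- A crossing conflict that avoids the closed neighborhoods of all matched pairs could be added to
  -- `P`, against maximality.
  refine ⟨P.biUnion fun p => nbhd E Y p.1 ∪ nbhd E Y p.2, ?_, ?_⟩
  · refine (Finset.card_biUnion_le_card_mul _ _ (2 * Δ) fun p hp => ?_).trans
      (Nat.mul_le_mul_right _ hcard.le)
    have h1 := hΔ _ (hY1 p hp)
    have h2 := hΔ _ (hY2 p hp)
    have h3 := Finset.card_union_le (nbhd E Y p.1) (nbhd E Y p.2)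
    omega
  · intro x hx y hy hxy hc hd hvx hvy hvy'
    by_contra hno
    push Not at hno
    have hn : ∀ z ∈ Y, z ∉ (P.biUnion fun p => nbhd E Y p.1 ∪ nbhd E Y p.2) → ∀ p ∈ P,
        far z p.1 ∧ far z p.2 := by
      intro z hz hzn p hp
      simp only [Finset.mem_biUnion, Finset.mem_union, mem_nbhd, not_exists, not_and, not_or] at hzn
      obtain ⟨h1, h2⟩ := hzn p hp
      obtain ⟨h1, h1'⟩ := h1 hz
      obtain ⟨h2, h2'⟩ := h2 hz
      exact ⟨⟨h1, fun h => h1' h.symm⟩, ⟨h2, fun h => h2' h.symm⟩⟩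
    have symm : ∀ a b, far a b → far b a := fun a b h => ⟨h.1.symm, fun h' => h.2 h'.symm⟩
    have hxn := hn x hx hno.1
    have hyn := hn y hy hno.2
    have hnew : (x, y) ∉ P := fun h => (hxn _ h).1.1 rfl
    have := hmax (insert (x, y) P) ⟨?_, ?_, ?_⟩
    · rw [Finset.card_insert_of_notMem hnew] at this
      omega
    · exact Finset.insert_subset (Finset.mem_product.2 ⟨hx, hy⟩) hPY
    · intro p hp
      rcases Finset.mem_insert.1 hp with rfl | hp
      · exact ⟨hxy, hc, hd, hvx, hvy, hvy'⟩
      · exact hP1 p hp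
    · intro p hp q hq hpq
      rcases Finset.mem_insert.1 hp with rfl | hp <;> rcases Finset.mem_insert.1 hq with rfl | hq
      · exact absurd rfl hpq
      · exact ⟨(hxn q hq).1, (hxn q hq).2, (hyn q hq).1, (hyn q hq).2⟩
      · exact ⟨symm _ _ (hxn p hp).1, symm _ _ (hyn p hp).1, symm _ _ (hxn p hp).2,
          symm _ _ (hyn p hp).2⟩
      · exact hP2 p hp q hq hpq

/-- The conflicts between neighbors and non-neighbors of `v` have a small vertex cover. -/
theorem exists_cover [Fintype κ] {t Δ : ℕ} (hS : ¬ (subdividedStar t).IsIndContained G)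
    {Y : Finset ι} (hE : IsConflict E G H vtx col Y) (hΔ : ∀ x ∈ Y, (nbhd E Y x).card ≤ Δ)
    (v : V) :
    ∃ Z : Finset ι, Z.card ≤ Fintype.card (κ × κ) * (t * (2 * Δ)) ∧
      ∀ x ∈ Y, ∀ y ∈ Y, E.Adj x y → G.Adj v (vtx x) → v ≠ vtx y → ¬ G.Adj v (vtx y) →
        x ∈ Z ∨ y ∈ Z := by
  have h := fun q : κ × κ => fun hq : ¬ H.Adj q.1 q.2 =>
    exists_cover_of_colors hS hE hΔ v q.1 q.2 hq
  choose Z hZ hZ' using h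
  refine ⟨Finset.univ.biUnion fun q : κ × κ => if hq : ¬ H.Adj q.1 q.2 then Z q hq else ∅, ?_, ?_⟩
  · refine Finset.card_biUnion_le_card_mul _ _ _ fun q _ => ?_
    split_ifs with hq
    · simp
    · exact hZ q hq
  · intro x hx y hy hxy hvx hvy hvy'
    -- A conflict across the two sides joins different vertices, so it comes from nonadjacent
    -- colors; pairs of adjacent colors may contribute the empty set.
    have hq : ¬ H.Adj (col x) (col y) := by
      rcases ((hE x hx y hy).1 hxy).2 with h | h
      · exact absurd (h ▸ hvx) hvy'
      · exact h.2
    have := hZ' (col x, col y) hq x hx y hy hxy rfl rfl hvx hvy hvy'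
    simp only [Finset.mem_biUnion, Finset.mem_univ, true_and]
    rcases this with h | h
    · exact .inl ⟨(col x, col y), by rw [dif_pos hq]; exact h⟩
    · exact .inr ⟨(col x, col y), by rw [dif_pos hq]; exact h⟩


/-- The first `i + 1` vertices of an induced path are `p 0, …, p i`. -/
structure IsPrefix (G : SimpleGraph V) (p : ℕ → V) (i : ℕ) : Prop where
  adj : ∀ a < i, G.Adj (p a) (p (a + 1))
  ne : ∀ a b, a < b → b ≤ i → p a ≠ p b
  not_adj : ∀ a b, a + 1 < b → b ≤ i → ¬ G.Adj (p a) (p b)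

theorem IsPrefix.isIndContained {p : ℕ → V} {i : ℕ} (h : IsPrefix G p i) :
    (SimpleGraph.pathGraph (i + 1)).IsIndContained G := by
  refine ⟨⟨⟨fun a => p a, fun a b hab => ?_⟩, fun {a b} => ?_⟩⟩
  · by_contra hne
    have hne' : (a : ℕ) ≠ b := fun h => hne (Fin.ext h)
    rcases lt_or_gt_of_ne hne' with h' | h'
    · exact h.ne _ _ h' (by omega) hab
    · exact h.ne _ _ h' (by omega) hab.symm
  · change G.Adj (p a) (p b) ↔ _
    rw [SimpleGraph.pathGraph_adj]
    constructor
    · intro hadj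
      by_contra hno
      push Not at hno
      rcases lt_trichotomy (a : ℕ) b with h' | h' | h'
      · exact h.not_adj a b (by omega) (by omega) hadj
      · rw [h'] at hadj; exact hadj.ne rfl
      · exact h.not_adj b a (by omega) (by omega) hadj.symm
    · rintro (h' | h')
      · rw [← h']; exact h.adj a (by omega)
      · rw [← h']; exact (h.adj b (by omega)).symm

/-- In a connected set `D ∋ v` with a vertex `w` that is neither `v` nor a neighbor of `v`, some
neighbor of `v` sees the component of `w` in the complement of the closed neighborhood of `v`. -/
theorem exists_adj_comp {D : Set V} {v w : V} (hw : (restr G D).Reachable v w)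
    (hvw : v ≠ w) (hvw' : ¬ G.Adj v w) (hwD : w ∈ D) :
    ∃ u ∈ D, G.Adj v u ∧ ∃ z, G.Adj u z ∧ z ∈ D ∧ z ≠ v ∧ ¬ G.Adj v z ∧
      (restr G {z | z ∈ D ∧ z ≠ v ∧ ¬ G.Adj v z}).Reachable w z := by
  set D0 : Set V := {z | z ∈ D ∧ z ≠ v ∧ ¬ G.Adj v z} with hD0
  by_contra hno
  push Not at hno
  -- If no such `u` existed, the component of `w` in `D0` would be closed under adjacency in `D`,
  -- although it misses `v`, which is reachable from `w`.
  have := mem_of_reachable (S := {z | z ∈ D0 ∧ (restr G D0).Reachable w z}) hw.symm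
    ⟨⟨hwD, hvw.symm, hvw'⟩, .refl _⟩ ?_
  · exact this.1.2.1 rfl
  · rintro a b ⟨haD, hbD, hab⟩ ⟨ha, hra⟩
    by_cases hb : b ∈ D0
    · exact ⟨hb, hra.trans (SimpleGraph.Adj.reachable ⟨ha, hb, hab⟩)⟩
    · exfalso
      have hbv : b ≠ v := fun h => ha.2.2 (h ▸ hab.symm)
      have hadj : G.Adj v b := by
        by_contra h
        exact hb ⟨hbD, hbv, h⟩
      exact hno b hbD hadj a hab.symm ha.1 ha.2.1 ha.2.2 hra

/-- A state of the construction of a path in `G` that dominates a separator of `E`: the vertices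
`p 0, …, p i` form an induced path, only `p i` sees the rest of the connected set `D`, and `D`
contains the component of `x` after the removal of `Z`, which is large. -/
structure PathState (E : SimpleGraph ι) (G : SimpleGraph V) (vtx : ι → V) (Y : Finset ι)
    (m K i : ℕ) (p : ℕ → V) (D : Set V) (Z : Finset ι) (x : ι) : Prop where
  path : IsPrefix G p i
  mem : p i ∈ D
  conn : ∀ v ∈ D, (restr G D).Reachable (p i) v
  notMem : ∀ a < i, p a ∉ D
  not_adj : ∀ a < i, ∀ v ∈ D, v ≠ p i → ¬ G.Adj (p a) v
  sub : D ⊆ vtx '' Y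
  large : m < (comp E (Y \ Z) x).card
  comp_sub : ∀ y ∈ comp E (Y \ Z) x, vtx y ∈ D
  card : Z.card ≤ i * K

/-- A connected set of conflicts projects to a connected set of vertices. -/
theorem reachable_vtx {Y W : Finset ι} (hE : IsConflict E G H vtx col Y) (hW : W ⊆ Y) {x y : ι}
    {D : Set V} (hxy : (restr E W).Reachable x y) (hD : ∀ z ∈ comp E W x, vtx z ∈ D) :
    (restr G D).Reachable (vtx x) (vtx y) := by
  refine reachable_of_reachable vtx hxy fun a b hxa hab => ?_
  have ha : vtx a ∈ D := hD a (mem_comp.2 ⟨hab.1, hxa⟩)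
  have hb : vtx b ∈ D := hD b (mem_comp.2 ⟨hab.2.1, hxa.trans hab.reachable⟩)
  rcases ((hE a (hW hab.1) b (hW hab.2.1)).1 hab.2.2).2 with h | h
  · rw [h]
  · exact SimpleGraph.Adj.reachable ⟨ha, hb, h.1⟩

/-- Induction on the number `s` of colors that occur in `Y`. If no small set separates, a Gyárfás
path grows until it is an induced `P₆`. Each step deletes at most `K` elements, and five steps are
made for each color, hence `s * (5 * K)`. -/
theorem exists_separator_aux {t Δ m : ℕ} [Fintype κ]
    (hS : ¬ (subdividedStar t).IsIndContained G)
    (hP : ¬ (SimpleGraph.pathGraph 6).IsIndContained G) {Y₀ : Finset ι}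
    (hE : IsConflict E G H vtx col Y₀) (hΔ : ∀ x ∈ Y₀, (nbhd E Y₀ x).card ≤ Δ)
    (hm : Y₀.card < 2 * (m + 1)) (K : ℕ) (hK : Δ + Fintype.card (κ × κ) * (t * (2 * Δ)) ≤ K) :
    ∀ (s : ℕ) (Y : Finset ι), Y ⊆ Y₀ → (Y.image col).card ≤ s →
      ∃ Z : Finset ι, Z.card ≤ s * (5 * K) ∧ ∀ x ∈ Y \ Z, (comp E (Y \ Z) x).card ≤ m := by
  intro s
  induction s with
  | zero =>
    intro Y hY hc
    have : Y = ∅ := by simpa using hc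
    subst this
    exact ⟨∅, by simp, by simp⟩
  | succ s ihs =>
    intro Y hY hc
    by_contra hno
    push Not at hno
    have hbig : ∀ Z : Finset ι, Z.card ≤ (s + 1) * (5 * K) →
        ∃ x ∈ Y \ Z, m < (comp E (Y \ Z) x).card := hno
    have key : ∀ i ≤ 5, ∃ p D Z x, PathState E G vtx Y m K i p D Z x := by
      intro i
      induction i with
      | zero =>
        intro _
        obtain ⟨x, hx, hlarge⟩ := hbig ∅ (by simp)
        have hvtx : ∀ z ∈ comp E (Y \ ∅) x, vtx z ∈ vtx '' (comp E (Y \ ∅) x : Set ι) := fun z hz =>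
          ⟨z, hz, rfl⟩
        refine ⟨fun _ => vtx x, vtx '' (comp E (Y \ ∅) x : Set ι), ∅, x, ⟨?_, ?_, ?_⟩, ?_, ?_, ?_, ?_,
          ?_, hlarge, hvtx, by simp⟩
        · intro a ha; omega
        · intro a b h1 h2; omega
        · intro a b h1 h2; omega
        · exact hvtx x (mem_comp.2 ⟨hx, .refl _⟩)
        · rintro v ⟨y, hy, rfl⟩
          exact reachable_vtx hE (Finset.sdiff_subset.trans hY) (mem_comp.1 hy).2 hvtx
        · intro a ha; omega
        · intro a ha; omega
        · rintro _ ⟨y, hy, rfl⟩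
          exact ⟨y, (Finset.mem_sdiff.1 (mem_comp.1 hy).1).1, rfl⟩
      | succ i ih =>
        intro hi
        obtain ⟨p, D, Z, x, st⟩ := ih (by omega)
        obtain ⟨y, hyY, hyp⟩ := st.sub st.mem
        obtain ⟨Zc, hZc, hcov⟩ := exists_cover hS hE hΔ (vtx y)
        have hyY' : y ∈ Y := hyY
        -- Deleting the closed neighborhood of `y` removes all pairs with the vertex `p i` and all
        -- conflicts with `y`; deleting `Zc` removes all conflicts between the two sides of `p i`.
        set Z' := Z ∪ (nbhd E Y₀ y ∪ Zc) with hZ'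
        have hZ'card : Z'.card ≤ (i + 1) * K := by
          have h1 := Finset.card_union_le Z (nbhd E Y₀ y ∪ Zc)
          have h2 := Finset.card_union_le (nbhd E Y₀ y) Zc
          have h3 := hΔ y (hY hyY)
          have h4 := st.card
          rw [hZ', add_mul]
          omega
        have h5K : (i + 1) * K ≤ 5 * K := Nat.mul_le_mul_right _ hi
        obtain ⟨x', hx', hlarge'⟩ := hbig Z' (by rw [add_mul]; omega)
        have hsub : Y \ Z' ⊆ Y \ Z := Finset.sdiff_subset_sdiff le_rfl Finset.subset_union_left
        have hcsub : comp E (Y \ Z') x' ⊆ comp E (Y \ Z) x :=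
          comp_subset_comp hm (Finset.sdiff_subset.trans hY) hsub st.large hlarge'
        have hWY : Y \ Z' ⊆ Y₀ := Finset.sdiff_subset.trans hY
        have hne : ∀ z ∈ Y \ Z', vtx z ≠ vtx y ∧ (G.Adj (vtx y) (vtx z) → H.Adj (col y) (col z)) := by
          intro z hz
          have hz0 := hWY hz
          have hzn : z ∉ nbhd E Y₀ y := fun h => (Finset.mem_sdiff.1 hz).2 (by
            rw [hZ']; simp [h])
          rw [mem_nbhd] at hzn
          push Not at hzn
          obtain ⟨hzy, hzE⟩ := hzn hz0
          have hzE' := fun h => hzE ((hE y (hY hyY) z hz0).2 h)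
          refine ⟨fun h => hzE' ⟨hzy.symm, .inl h.symm⟩, fun h => ?_⟩
          by_contra hH
          exact hzE' ⟨hzy.symm, .inr ⟨h, hH⟩⟩
        have hcross : ∀ a ∈ Y \ Z', ∀ b ∈ Y \ Z', E.Adj a b → G.Adj (vtx y) (vtx a) →
            G.Adj (vtx y) (vtx b) := by
          intro a ha b hb hab hya
          by_contra hyb
          have := hcov a (hWY ha) b (hWY hb) hab hya (hne b hb).1.symm hyb
          rw [Finset.mem_sdiff] at ha hb
          rcases this with h | h
          · exact ha.2 (by rw [hZ']; simp [h])
          · exact hb.2 (by rw [hZ']; simp [h])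
        -- With no crossing conflict left, the large component stays on one side of `vtx y`.
        have hside : ∀ z ∈ comp E (Y \ Z') x',
            (G.Adj (vtx y) (vtx x') ↔ G.Adj (vtx y) (vtx z)) := by
          intro z hz
          refine mem_of_reachable (S := {z | G.Adj (vtx y) (vtx x') ↔ G.Adj (vtx y) (vtx z)})
            (mem_comp.1 hz).2 Iff.rfl fun a b hab ha => ?_
          exact Iff.trans ha ⟨hcross a hab.1 b hab.2.1 hab.2.2,
            hcross b hab.2.1 a hab.1 hab.2.2.symm⟩
        by_cases hyx : G.Adj (vtx y) (vtx x')
        · exfalso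
          set B := comp E (Y \ Z') x' with hB
          have hBY : B ⊆ Y := fun z hz => (Finset.mem_sdiff.1 (mem_comp.1 hz).1).1
          -- All of `B` sits at neighbors of `vtx y` without conflict with `y`, so its colors are
          -- neighbors of `col y` in `H`. As `H` has no loops, `col y` itself no longer occurs.
          have hcol : (B.image col).card ≤ s := by
            have hlt : B.image col ⊂ Y.image col := by
              refine Finset.ssubset_iff_subset_ne.2 ⟨Finset.image_subset_image hBY, fun h => ?_⟩
              have : col y ∈ B.image col := by
                rw [h]; exact Finset.mem_image_of_mem _ hyY'
              obtain ⟨z, hz, hzy⟩ := Finset.mem_image.1 this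
              have := (hne z (mem_comp.1 hz).1).2 ((hside z hz).1 hyx)
              rw [hzy] at this
              exact this.ne rfl
            have := Finset.card_lt_card hlt
            omega
          -- A separator of `B` together with `Z'` costs at most `s * (5 * K) + 5 * K`. A large
          -- component that survives it would lie in `B` and be connected in `B \ Z2`, which is
          -- impossible.
          obtain ⟨Z2, hZ2, hZ2'⟩ := ihs B (hBY.trans hY) hcol
          obtain ⟨x2, hx2, hl2⟩ := hbig (Z' ∪ Z2) (by
            have := Finset.card_union_le Z' Z2
            rw [add_mul]; omega)
          have hsub2 : Y \ (Z' ∪ Z2) ⊆ Y \ Z' :=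
            Finset.sdiff_subset_sdiff le_rfl Finset.subset_union_left
          have hB2 : comp E (Y \ (Z' ∪ Z2)) x2 ⊆ B := comp_subset_comp hm hWY hsub2 hlarge' hl2
          have hmem : ∀ z ∈ comp E (Y \ (Z' ∪ Z2)) x2, z ∈ B \ Z2 := fun z hz =>
            Finset.mem_sdiff.2 ⟨hB2 hz, fun h => (Finset.mem_sdiff.1 (mem_comp.1 hz).1).2
              (Finset.mem_union_right _ h)⟩
          have hle : comp E (Y \ (Z' ∪ Z2)) x2 ⊆ comp E (B \ Z2) x2 := by
            intro z hz
            refine mem_comp.2 ⟨hmem z hz, ?_⟩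
            refine reachable_of_reachable id (mem_comp.1 hz).2 fun a b hxa hab => ?_
            exact SimpleGraph.Adj.reachable ⟨hmem a (mem_comp.2 ⟨hab.1, hxa⟩),
              hmem b (mem_comp.2 ⟨hab.2.1, hxa.trans hab.reachable⟩), hab.2.2⟩
          have h1 := hZ2' x2 (hmem x2 (mem_comp.2 ⟨hx2, .refl _⟩))
          have h2 := Finset.card_le_card hle
          omega
        · have hxx : x' ∈ comp E (Y \ Z') x' := mem_comp.2 ⟨hx', .refl _⟩
          have hxD : vtx x' ∈ D := st.comp_sub _ (hcsub hxx)
          have hyv := (hne x' hx').1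
          rw [hyp] at hyv hyx
          obtain ⟨u, huD, hpu, z, huz, hzD, hzp, hzp', hxz⟩ :=
            exists_adj_comp (st.conn _ hxD) hyv.symm hyx hxD
          -- The path is extended by `u`, and the new connected set is `u` together with the
          -- component `D1` of `vtx x'` among the vertices of `D` not seen by `p i`. Thus `p i` sees
          -- only `u` in the new set, and the earlier path vertices see nothing there.
          set D0 : Set V := {z | z ∈ D ∧ z ≠ p i ∧ ¬ G.Adj (p i) z} with hD0
          have hxD0 : vtx x' ∈ D0 := ⟨hxD, hyv, hyx⟩
          set D1 : Set V := {w | w ∈ D0 ∧ (restr G D0).Reachable (vtx x') w} with hD1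
          have hzD1 : z ∈ D1 := ⟨⟨hzD, hzp, hzp'⟩, hxz⟩
          have hD1D : ∀ w ∈ insert u D1, w ∈ D := by
            rintro w (rfl | hw)
            · exact huD
            · exact hw.1.1
          have hnp : ∀ w ∈ insert u D1, w ≠ p i := by
            rintro w (rfl | hw)
            · exact hpu.ne.symm
            · exact hw.1.2.1
          have hcD0 : ∀ w ∈ comp E (Y \ Z') x', vtx w ∈ D0 := by
            intro w hw
            refine ⟨st.comp_sub _ (hcsub hw), ?_, ?_⟩
            · rw [← hyp]; exact (hne w (mem_comp.1 hw).1).1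
            · rw [← hyp] at hyx ⊢
              exact fun h => hyx ((hside w hw).2 h)
          have hpe : ∀ a ≤ i, Function.update p (i + 1) u a = p a := fun a ha =>
            Function.update_of_ne (by omega) _ _
          have hpn : Function.update p (i + 1) u (i + 1) = u := Function.update_self _ _ _
          refine ⟨Function.update p (i + 1) u, insert u D1, Z', x', ⟨?_, ?_, ?_⟩, ?_, ?_, ?_, ?_, ?_,
            hlarge', ?_, hZ'card⟩
          · intro a ha
            rw [hpe a (by omega)]
            rcases Nat.lt_succ_iff_lt_or_eq.1 ha with h | rfl
            · rw [hpe _ (by omega)]; exact st.path.adj a h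
            · rw [hpn]; exact hpu
          · intro a b hab hb
            rw [hpe a (by omega)]
            rcases Nat.lt_succ_iff_lt_or_eq.1 (Nat.lt_succ_of_le hb) with h | rfl
            · rw [hpe _ (by omega)]; exact st.path.ne a b hab (by omega)
            · rw [hpn]
              rcases Nat.lt_succ_iff_lt_or_eq.1 hab with h | rfl
              · exact fun h' => st.notMem a h (h' ▸ huD)
              · exact hpu.ne
          · intro a b hab hb
            rw [hpe a (by omega)]
            rcases Nat.lt_succ_iff_lt_or_eq.1 (Nat.lt_succ_of_le hb) with h | rfl
            · rw [hpe _ (by omega)]; exact st.path.not_adj a b hab (by omega)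
            · rw [hpn]
              exact st.not_adj a (by omega) u huD hpu.ne.symm
          · rw [hpn]; exact Set.mem_insert _ _
          · rw [hpn]
            have huz' : (restr G (insert u D1)).Reachable u z :=
              SimpleGraph.Adj.reachable ⟨.inl rfl, .inr hzD1, huz⟩
            have hx1 : ∀ w ∈ D1, (restr G (insert u D1)).Reachable (vtx x') w := by
              intro w hw
              refine reachable_of_reachable id hw.2 fun a b hxa hab => ?_
              exact SimpleGraph.Adj.reachable ⟨.inr ⟨hab.1, hxa⟩,
                .inr ⟨hab.2.1, hxa.trans hab.reachable⟩, hab.2.2⟩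
            rintro v (rfl | hv)
            · exact .refl _
            · exact huz'.trans ((hx1 z hzD1).symm.trans (hx1 v hv))
          · intro a ha hmem
            rw [hpe a (by omega)] at hmem
            rcases Nat.lt_succ_iff_lt_or_eq.1 ha with h | rfl
            · exact st.notMem a h (hD1D _ hmem)
            · exact hnp _ hmem rfl
          · intro a ha v hv hvu
            rw [hpn] at hvu
            rw [hpe a (by omega)]
            rcases Nat.lt_succ_iff_lt_or_eq.1 ha with h | rfl
            · exact st.not_adj a h v (hD1D v hv) (hnp v hv)
            · rcases hv with hv | hv
              · exact absurd hv hvu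
              · exact hv.1.2.2
          · exact fun w hw => st.sub (hD1D w hw)
          · intro w hw
            exact .inr ⟨hcD0 w hw, reachable_vtx hE hWY (mem_comp.1 hw).2 hcD0⟩
    obtain ⟨p, D, Z, x, st⟩ := key 5 le_rfl
    exact hP st.path.isIndContained

/-- Sparse conflict graphs of `{P₆, S_t}`-free graphs have small balanced separators. -/
theorem exists_separator {t Δ : ℕ} [Fintype κ]
    (hS : ¬ (subdividedStar t).IsIndContained G)
    (hP : ¬ (SimpleGraph.pathGraph 6).IsIndContained G) {Y : Finset ι}
    (hE : IsConflict E G H vtx col Y) (hΔ : ∀ x ∈ Y, (nbhd E Y x).card ≤ Δ) :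
    ∃ Z : Finset ι,
      Z.card ≤ (Fintype.card κ * 5 * (1 + Fintype.card κ * Fintype.card κ * (t * 2))) * Δ ∧
      ∀ x ∈ Y \ Z, (comp E (Y \ Z) x).card ≤ Y.card / 2 := by
  obtain ⟨Z, hZ, hZ'⟩ := exists_separator_aux hS hP hE hΔ (m := Y.card / 2) (by omega) _ le_rfl
    (Fintype.card κ) Y le_rfl (Finset.card_le_univ _)
  refine ⟨Z, hZ.trans (le_of_eq ?_), hZ'⟩
  rw [Fintype.card_prod]
  ring

end structure_theorem
end MaxPartialColoring

/-! ### The tree of subproblems, and why it contains enough of them. -/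

namespace MaxPartialColoring

open Classical

section search

variable (E : SimpleGraph ℕ) (N : ℕ)

/-- The least vertex of the component of `x` in the subgraph of `E` induced by `Y`. -/
noncomputable def lab (Y : Finset ℕ) (x : ℕ) : ℕ := sInf {y | (restr E Y).Reachable x y}

theorem reachable_lab (Y : Finset ℕ) (x : ℕ) : (restr E Y).Reachable x (lab E Y x) :=
  Nat.sInf_mem (s := {y | (restr E Y).Reachable x y}) ⟨x, .refl _⟩

theorem lab_le {Y : Finset ℕ} {x y : ℕ} (h : (restr E Y).Reachable x y) : lab E Y x ≤ y :=
  Nat.sInf_le h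

theorem lab_eq_of_reachable {Y : Finset ℕ} {x y : ℕ} (h : (restr E Y).Reachable x y) :
    lab E Y x = lab E Y y :=
  le_antisymm (lab_le E (h.trans (reachable_lab E Y y)))
    (lab_le E (h.symm.trans (reachable_lab E Y x)))

theorem reachable_of_lab_eq {Y : Finset ℕ} {x y : ℕ} (h : lab E Y x = lab E Y y) :
    (restr E Y).Reachable x y :=
  (reachable_lab E Y x).trans (h ▸ (reachable_lab E Y y).symm)

/-- The number of neighbors of `x` in `Y`. -/
noncomputable def deg (Y : Finset ℕ) (x : ℕ) : ℕ := (Y.filter fun y => E.Adj x y).card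

theorem card_nbhd {Y : Finset ℕ} {x : ℕ} (hx : x ∈ Y) : (nbhd E Y x).card = deg E Y x + 1 := by
  have : nbhd E Y x = insert x (Y.filter fun y => E.Adj x y) := by
    ext y
    simp only [mem_nbhd, Finset.mem_insert, Finset.mem_filter]
    constructor
    · rintro ⟨hy, rfl | h⟩
      · exact .inl rfl
      · exact .inr ⟨hy, h⟩
    · rintro (rfl | h)
      · exact ⟨hx, .inl rfl⟩
      · exact ⟨h.1, .inr h.2⟩
  rw [this, Finset.card_insert_of_notMem (by simp), deg]

/-- The operations on vertex sets from which the subproblems are built: put the vertex `i` into the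
solution (`0`), delete it (`1`), delete the vertices of degree more than `i` (`2`), keep the
components whose least vertex is at least `i` (`3`), or equal to `i` (`4`). -/
def keeps (Y : Finset ℕ) (i x : ℕ) : ℕ → Prop
  | 0 => x ≠ i ∧ ¬ E.Adj i x
  | 1 => x ≠ i
  | 2 => deg E Y x ≤ i
  | 3 => i ≤ lab E Y x
  | _ => lab E Y x = i

/-- The tree of subproblems, in breadth first order. -/
noncomputable def item : ℕ → Finset ℕ
  | 0 => Finset.range N
  | j + 1 => (item (j / (5 * N))).filter fun x =>
      keeps E (item (j / (5 * N))) (j % (5 * N) / 5) x (j % (5 * N) % 5)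
decreasing_by all_goals exact Nat.lt_succ_of_le (Nat.div_le_self _ _)

/-- The index of the subproblem obtained from subproblem `j` by operation `o` with parameter `i`. -/
def child (j i o : ℕ) : ℕ := j * (5 * N) + (5 * i + o) + 1

theorem item_child (j : ℕ) {i o : ℕ} (hi : i < N) (ho : o < 5) :
    item E N (child N j i o) = (item E N j).filter fun x => keeps E (item E N j) i x o := by
  have h1 : (j * (5 * N) + (5 * i + o)) / (5 * N) = j := by
    rw [mul_comm, Nat.mul_add_div (by omega), Nat.div_eq_of_lt (by omega), add_zero]
  have h2 : (j * (5 * N) + (5 * i + o)) % (5 * N) = 5 * i + o := by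
    rw [mul_comm, Nat.mul_add_mod, Nat.mod_eq_of_lt (by omega)]
  have h3 : (5 * i + o) / 5 = i := by omega
  have h4 : (5 * i + o) % 5 = o := by omega
  rw [child, item]
  simp only [h1, h2, h3, h4]

theorem item_subset (j : ℕ) : item E N j ⊆ Finset.range N := by
  induction j using Nat.strong_induction_on with
  | _ j ih =>
    rcases j with _ | j
    · rw [item]
    · rw [item]
      exact (Finset.filter_subset _ _).trans (ih _ (Nat.lt_succ_of_le (Nat.div_le_self _ _)))

variable (M : ℕ)

/-- The sets that can be combined: the subproblems with index less than `M`, the singletons, and the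
empty set. -/
noncomputable def part (p : ℕ) : Finset ℕ :=
  if p < M then item E N p else if p < M + N then {p - M} else ∅

/-- `Cov j I`: the set `I` is obtained within subproblem `j` by combining sets that are obtained
within anticomplete sets of larger index. -/
inductive Cov : ℕ → Finset ℕ → Prop
  | empty (j : ℕ) : j < M ∨ j = M + N → Cov j ∅
  | single (v : ℕ) : v < N → Cov (M + v) {v}
  | join (j p q : ℕ) (I J : Finset ℕ) : j < M → j < p → p ≤ M + N → j < q → q ≤ M + N →
      part E N M p ⊆ item E N j → part E N M q ⊆ item E N j →
      Disjoint (part E N M p) (part E N M q) →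
      (∀ x ∈ part E N M p, ∀ y ∈ part E N M q, ¬ E.Adj x y) →
      Cov p I → Cov q J → Cov j (I ∪ J)

/-- No two vertices of `I` are adjacent. -/
def IsIndep (I : Finset ℕ) : Prop := ∀ x ∈ I, ∀ y ∈ I, ¬ E.Adj x y

variable {E N M}

theorem Cov.subset {j : ℕ} {I : Finset ℕ} (h : Cov E N M j I) : I ⊆ part E N M j := by
  induction h with
  | empty => simp
  | single v hv => simp [part, hv]
  | join j p q I J hj _ _ _ _ hp hq _ _ _ _ ih₁ ih₂ =>
    have : part E N M j = item E N j := if_pos hj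
    rw [this]
    exact Finset.union_subset (ih₁.trans hp) (ih₂.trans hq)

theorem IsIndep.mono {I J : Finset ℕ} (h : IsIndep E J) (hIJ : I ⊆ J) : IsIndep E I :=
  fun x hx y hy => h x (hIJ hx) y (hIJ hy)

/-- A solution is passed to a superset of smaller index by a union with the empty set, which is kept
at index `M + N` for this purpose. -/
theorem Cov.keep {j c : ℕ} {I : Finset ℕ} (hjc : j < c) (hc : c < M)
    (hsub : item E N c ⊆ item E N j) (h : Cov E N M c I) : Cov E N M j I := by
  have hp : part E N M c = item E N c := if_pos hc
  have he : part E N M (M + N) = ∅ := by simp [part]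
  have := Cov.join j c (M + N) I ∅ (by omega) hjc (by omega) (by omega) le_rfl (by rwa [hp])
    (by simp [he]) (by simp [he]) (by simp [he]) h (.empty _ (.inr rfl))
  rwa [Finset.union_empty] at this

/-- There are at least `b` more levels of subproblems below subproblem `j`. -/
def Room (N M j b : ℕ) : Prop := (j + 1) * (5 * N + 1) ^ b ≤ M

theorem Room.mono {j b b' : ℕ} (h : Room N M j b) (hb : b' ≤ b) : Room N M j b' :=
  (Nat.mul_le_mul_left _ (Nat.pow_le_pow_right (Nat.succ_pos _) hb)).trans h

theorem Room.lt {j b : ℕ} (h : Room N M j b) : j < M :=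
  (Nat.le_mul_of_pos_right (j + 1) (Nat.pow_pos (Nat.succ_pos (5 * N)))).trans h

/-- The successor of the index of a child is at most `(j + 1) * (5 * N + 1)`, so one level of the
breadth first numbering costs one factor `5 * N + 1`. -/
theorem Room.child {j b i o : ℕ} (h : Room N M j (b + 1)) (hi : i < N) (ho : o < 5) :
    Room N M (child N j i o) b := by
  refine le_trans ?_ h
  rw [pow_succ', ← mul_assoc]
  refine Nat.mul_le_mul_right _ ?_
  rw [MaxPartialColoring.child, add_mul, mul_add]
  omega

theorem lt_child {j i o : ℕ} (hi : i < N) : j < child N j i o := by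
  have : j * 1 ≤ j * (5 * N) := Nat.mul_le_mul_left _ (by omega)
  rw [child]
  omega

theorem Cov.keep_child {j b i o : ℕ} {I : Finset ℕ} (h : Room N M j (b + 1)) (hi : i < N)
    (ho : o < 5) (hc : Cov E N M (child N j i o) I) : Cov E N M j I :=
  hc.keep (lt_child hi) (h.child hi ho).lt
    (by rw [item_child E N j hi ho]; exact Finset.filter_subset _ _)

/-- Operation `0` has removed `i` and its neighbors, so the child is anticomplete to `{i}`. The
singleton has index `M + i`, larger than that of any subproblem, as a union requires. -/
theorem Cov.take_child {j b i : ℕ} {I : Finset ℕ} (h : Room N M j (b + 1)) (hi : i ∈ item E N j)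
    (hI : i ∈ I) (hc : Cov E N M (child N j i 0) (I.erase i)) : Cov E N M j I := by
  have hiN : i < N := Finset.mem_range.1 (item_subset E N j hi)
  have hp : part E N M (child N j i 0) = item E N (child N j i 0) :=
    if_pos (h.child hiN (by omega)).lt
  have hs : part E N M (M + i) = {i} := by simp [part, hiN]
  have hcM := (h.child hiN (o := 0) (by omega)).lt
  have hlt := lt_child (j := j) (o := 0) hiN
  have := Cov.join j (M + i) (child N j i 0) {i} (I.erase i) (by omega) (by omega)
    (by omega) hlt (by omega) (by simpa [hs] using hi)
    (by rw [hp, item_child E N j hiN (by omega)]; exact Finset.filter_subset _ _)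
    (by
      rw [hs, hp, item_child E N j hiN (by omega), Finset.disjoint_singleton_left]
      simp [keeps])
    (by
      intro x hx y hy
      rw [hs, Finset.mem_singleton] at hx
      rw [hp, item_child E N j hiN (by omega), Finset.mem_filter] at hy
      subst hx
      exact hy.2.2)
    (.single i hiN) hc
  rwa [← Finset.insert_eq, Finset.insert_erase hI] at this

/-- Every independent subset of subproblem `j` is obtained. -/
def Solved (E : SimpleGraph ℕ) (N M j : ℕ) : Prop :=
  ∀ I ⊆ item E N j, IsIndep E I → Cov E N M j I

theorem cov_take {j b i : ℕ} {I : Finset ℕ} (h : Room N M j (b + 1)) (hij : i ∈ item E N j)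
    (hI : I ⊆ item E N j) (hind : IsIndep E I) (hi : i ∈ I)
    (hs : ∀ I' ⊆ item E N (child N j i 0), IsIndep E I' → Cov E N M (child N j i 0) I') :
    Cov E N M j I := by
  have hiN : i < N := Finset.mem_range.1 (item_subset E N j hij)
  refine Cov.take_child h hij hi (hs _ ?_ (hind.mono (Finset.erase_subset _ _)))
  intro x hx
  rw [Finset.mem_erase] at hx
  rw [item_child E N j hiN (by omega), Finset.mem_filter]
  exact ⟨hI hx.2, hx.1, hind i hi x hx.2⟩

/-- Deciding about the vertices of a set `Z` one by one. -/
theorem solved_of_delete (b : ℕ) (Z : Finset ℕ) : ∀ j, Room N M j (b + Z.card) →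
    (∀ j', Room N M j' b → item E N j' ⊆ item E N j \ Z → Solved E N M j') → Solved E N M j := by
  induction Z using Finset.induction_on with
  | empty =>
    intro j hr hs
    exact hs j hr (by simp)
  | insert z Z hz ih =>
    intro j hr hs I hI hind
    rw [Finset.card_insert_of_notMem hz] at hr
    by_cases hzj : z ∈ item E N j
    · have hzN : z < N := Finset.mem_range.1 (item_subset E N j hzj)
      have hr' : Room N M j ((b + Z.card) + 1) := hr
      -- Putting `z` into the solution and deleting it both remove `z` from the subproblem. Which of
      -- the two is right depends on `I`, hence the quantification over all `j'` in the hypothesis.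
      have hcont : ∀ o < 2, Solved E N M (child N j z o) := by
        intro o ho
        refine ih _ (hr'.child hzN (by omega)) fun j' hr'' hsub => hs j' hr'' ?_
        intro x hx
        have := hsub hx
        rw [Finset.mem_sdiff, item_child E N j hzN (by omega), Finset.mem_filter] at this
        have hxz : x ≠ z := by
          obtain rfl | rfl : o = 0 ∨ o = 1 := by omega
          · exact this.1.2.1
          · exact this.1.2
        simp only [Finset.mem_sdiff, Finset.mem_insert, not_or]
        exact ⟨this.1.1, hxz, this.2⟩
      by_cases hzI : z ∈ I
      · exact cov_take hr' hzj hI hind hzI (hcont 0 (by omega))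
      · refine Cov.keep_child hr' hzN (by omega) (hcont 1 (by omega) I ?_ hind)
        intro x hx
        rw [item_child E N j hzN (by omega), Finset.mem_filter]
        exact ⟨hI hx, fun h => hzI (h ▸ hx)⟩
    · refine ih j (hr.mono (by omega)) (fun j' hr' hsub => hs j' hr' fun x hx => ?_) I hI hind
      have := Finset.mem_sdiff.1 (hsub hx)
      simp only [Finset.mem_sdiff, Finset.mem_insert, not_or]
      exact ⟨this.1, fun h => hzj (h ▸ this.1), this.2⟩

/-- Choosing vertices of large degree in the solution, until none is left. -/
theorem solved_of_sparse (b s : ℕ) (hs0 : 0 < s) (hsN : s ≤ N) : ∀ g j, Room N M j (b + 1 + g) →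
    (item E N j).card < (g + 1) * (s + 1) →
    (∀ j', Room N M j' b → item E N j' ⊆ item E N j →
      (∀ x ∈ item E N j', (nbhd E (item E N j') x).card ≤ s) → Solved E N M j') →
    Solved E N M j := by
  intro g
  induction g with
  | zero =>
    intro j hr hcard hs
    -- Here at most `s` vertices are left, so every closed neighborhood is small.
    refine hs j (hr.mono (by omega)) le_rfl fun x hx => ?_
    have := Finset.card_le_card (nbhd_subset (E := E) (Y := item E N j) (x := x))
    omega
  | succ g ih =>
    intro j hr hcard hs I hI hind
    -- Choosing such a `v` removes at least `s + 1` vertices, which decreases `g`.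
    by_cases hv : ∃ v ∈ I, s < (nbhd E (item E N j) v).card
    · obtain ⟨v, hvI, hv⟩ := hv
      have hvN : v < N := Finset.mem_range.1 (item_subset E N j (hI hvI))
      have hr' : Room N M j (b + 1 + g + 1) := hr
      refine cov_take hr' (hI hvI) hI hind hvI (ih _ (hr'.child hvN (by omega)) ?_ ?_)
      · have : item E N (child N j v 0) = item E N j \ nbhd E (item E N j) v := by
          rw [item_child E N j hvN (by omega)]
          ext x
          simp only [Finset.mem_filter, keeps, Finset.mem_sdiff, mem_nbhd]
          tauto
        rw [this, Finset.card_sdiff_of_subset nbhd_subset]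
        rw [add_mul] at hcard
        have : 0 < (g + 1) * (s + 1) := Nat.mul_pos (Nat.succ_pos _) (Nat.succ_pos _)
        omega
      · intro j' hr'' hsub
        refine hs j' hr'' (hsub.trans ?_)
        rw [item_child E N j hvN (by omega)]
        exact Finset.filter_subset _ _
    · push Not at hv
      have hr' : Room N M j (b + 1) := hr.mono (by omega)
      -- No vertex of `I` has a large neighborhood, so operation `2` deletes only vertices outside
      -- `I`. The parameter is `s - 1` because a closed neighborhood has one element more than the
      -- degree.
      have hitem := item_child E N j (i := s - 1) (o := 2) (by omega) (by omega)
      have hsub : item E N (child N j (s - 1) 2) ⊆ item E N j := by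
        rw [hitem]; exact Finset.filter_subset _ _
      refine Cov.keep_child hr' (i := s - 1) (o := 2) (by omega) (by omega)
        (hs _ (hr'.child (by omega) (by omega)) hsub ?_ I ?_ hind)
      · intro x hx
        have hx' := hx
        rw [hitem, Finset.mem_filter] at hx'
        have h1 : deg E (item E N j) x ≤ s - 1 := hx'.2
        have h2 := card_nbhd E hx'.1
        have h3 : (nbhd E (item E N (child N j (s - 1) 2)) x).card ≤
            (nbhd E (item E N j) x).card := Finset.card_le_card (nbhd_mono hsub)
        omega
      · intro x hx
        rw [hitem, Finset.mem_filter]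
        refine ⟨hI hx, ?_⟩
        have h1 := hv x hx
        have h2 := card_nbhd E (hI hx)
        change deg E (item E N j) x ≤ s - 1
        omega

/-- Solving the components one by one. -/
theorem solved_of_components (b j : ℕ) (hN : 0 < N) (hr : Room N M j (b + 1))
    (hs : ∀ i < N, Solved E N M (child N j i 4)) : Solved E N M j := by
  intro I hI hind
  have hge : ∀ i < N, item E N (child N j i 3) =
      (item E N j).filter fun x => i ≤ lab E (item E N j) x := fun i hi => by
    ext x
    simp [item_child E N j (o := 3) hi, keeps]
  have heq : ∀ i < N, item E N (child N j i 4) =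
      (item E N j).filter fun x => lab E (item E N j) x = i := fun i hi => by
    ext x
    simp [item_child E N j (o := 4) hi, keeps]
  have hlt : ∀ i o, i < N → o < 5 → child N j i o < M := fun i o hi ho => (hr.child hi ho).lt
  have hpart : ∀ i o, i < N → o < 5 → part E N M (child N j i o) = item E N (child N j i o) :=
    fun i o hi ho => if_pos (hlt i o hi ho)
  have hcomp : ∀ i < N, Cov E N M (child N j i 4)
      (I.filter fun x => lab E (item E N j) x = i) := fun i hi => by
    refine hs i hi _ ?_ (hind.mono (Finset.filter_subset _ _))
    rw [heq i hi]
    exact Finset.filter_subset_filter _ hI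
  -- The components are joined from the largest label down. The sets of labels at least `i` are
  -- children of the same `j`, so joining any number of components costs one level only. The
  -- numbering gives operation `3` at `i` a smaller index than operation `4` at `i` and operation
  -- `3` at `i + 1`, as `Cov.join` demands.
  have key : ∀ d i, i + d + 1 = N → Cov E N M (child N j i 3)
      (I.filter fun x => i ≤ lab E (item E N j) x) := by
    intro d
    induction d with
    | zero =>
      intro i hi
      have hiN : i < N := by omega
      have h : (I.filter fun x => i ≤ lab E (item E N j) x) =
          I.filter fun x => lab E (item E N j) x = i := by
        refine Finset.filter_congr fun x hx => ?_
        have h1 := lab_le E (.refl x : (restr E (item E N j)).Reachable x x)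
        have h2 := Finset.mem_range.1 (item_subset E N j (hI hx))
        omega
      rw [h]
      refine (hcomp i hiN).keep (by simp only [child]; omega) (hlt _ _ hiN (by omega)) ?_
      rw [hge i hiN, heq i hiN]
      intro x
      simp only [Finset.mem_filter]
      exact fun h => ⟨h.1, h.2.ge⟩
    | succ d ih =>
      intro i hi
      have hiN : i < N := by omega
      have hiN' : i + 1 < N := by omega
      have h : (I.filter fun x => i ≤ lab E (item E N j) x) =
          (I.filter fun x => lab E (item E N j) x = i) ∪
          I.filter fun x => i + 1 ≤ lab E (item E N j) x := by
        ext x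
        simp only [Finset.mem_filter, Finset.mem_union, ← and_or_left]
        refine and_congr_right fun _ => ?_
        omega
      rw [h]
      have h1 := hlt i 3 hiN (by omega)
      have h2 := hlt i 4 hiN (by omega)
      have h3 := hlt (i + 1) 3 hiN' (by omega)
      refine .join _ (child N j i 4) (child N j (i + 1) 3) _ _ h1
        (by simp only [child]; omega) (by omega) (by simp only [child]; omega) (by omega)
        ?_ ?_ ?_ ?_ (hcomp i hiN) (ih (i + 1) (by omega))
      · rw [hpart i 4 hiN (by omega), hge i hiN, heq i hiN]
        intro x
        simp only [Finset.mem_filter]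
        exact fun h => ⟨h.1, h.2.ge⟩
      · rw [hpart (i + 1) 3 hiN' (by omega), hge i hiN, hge _ hiN']
        intro x
        simp only [Finset.mem_filter]
        exact fun h => ⟨h.1, by omega⟩
      · rw [hpart i 4 hiN (by omega), hpart (i + 1) 3 hiN' (by omega), heq i hiN, hge _ hiN',
          Finset.disjoint_left]
        intro x hx hx'
        rw [Finset.mem_filter] at hx hx'
        omega
      · rw [hpart i 4 hiN (by omega), hpart (i + 1) 3 hiN' (by omega), heq i hiN, hge _ hiN']
        intro x hx y hy hxy
        rw [Finset.mem_filter] at hx hy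
        have := lab_eq_of_reachable E (Y := item E N j)
          (SimpleGraph.Adj.reachable (G := restr E (item E N j)) ⟨hx.1, hy.1, hxy⟩)
        omega
  have h0 := key (N - 1) 0 (by omega)
  have h : (I.filter fun x => 0 ≤ lab E (item E N j) x) = I := by simp
  rw [h] at h0
  exact Cov.keep_child hr hN (by omega) h0

/-- The number of levels of the tree of subproblems that are needed to solve one with `m` vertices,
when separators have size `c * √m`. -/
def budget (c : ℕ) (m : ℕ) : ℕ :=
  if h : m = 0 then 0 else (c + 3) * Nat.sqrt m + budget c (m / 2)
decreasing_by exact Nat.div_lt_self (by omega) (by omega)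

theorem budget_mono (c : ℕ) {m m' : ℕ} (h : m ≤ m') : budget c m ≤ budget c m' := by
  induction m' using Nat.strong_induction_on generalizing m with
  | _ m' ih =>
    by_cases hm : m = 0
    · rw [hm, budget]; simp
    · rw [budget, dif_neg hm, budget.eq_1 c m', dif_neg (by omega)]
      exact Nat.add_le_add (Nat.mul_le_mul_left _ (Nat.sqrt_le_sqrt h))
        (ih (m' / 2) (Nat.div_lt_self (by omega) (by omega)) (Nat.div_le_div_right h))

/-- Halving `m` multiplies the square root by at most `3/4`, so the sum over all levels is at most
four times its first term. -/
theorem budget_le (c m : ℕ) : (budget c m : ℝ) ≤ 4 * (c + 3) * √m := by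
  induction m using Nat.strong_induction_on with
  | _ m ih =>
    rw [budget]
    split_ifs with hm
    · simp [hm]
    · have h1 := ih (m / 2) (Nat.div_lt_self (by omega) (by omega))
      have h2 : (Nat.sqrt m : ℝ) ≤ √m := Real.nat_sqrt_le_real_sqrt
      have h3 : √((m / 2 : ℕ) : ℝ) ≤ 3 / 4 * √m := by
        rw [Real.sqrt_le_left (by positivity), mul_pow, Real.sq_sqrt (by positivity)]
        have : ((m / 2 : ℕ) : ℝ) ≤ m / 2 := by exact_mod_cast Nat.cast_div_le
        have h0 : (0 : ℝ) ≤ m := by positivity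
        linarith
      push_cast
      have hc : (0 : ℝ) ≤ c + 3 := by positivity
      nlinarith [mul_le_mul_of_nonneg_left h2 hc, mul_le_mul_of_nonneg_left h3 hc]

/-- Every subproblem with enough levels below it is solved. -/
theorem solved_of_room {c : ℕ}
    (hsep : ∀ Y ⊆ Finset.range N, ∀ Δ, (∀ x ∈ Y, (nbhd E Y x).card ≤ Δ) →
      ∃ Z : Finset ℕ, Z.card ≤ c * Δ ∧ ∀ x ∈ Y \ Z, (comp E (Y \ Z) x).card ≤ Y.card / 2) :
    ∀ m j, (item E N j).card ≤ m → Room N M j (budget c m) → Solved E N M j := by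
  intro m
  induction m using Nat.strong_induction_on with
  | _ m ih =>
    intro j hm hr
    by_cases hm0 : m = 0
    · intro I hI _
      have : item E N j = ∅ := by rw [← Finset.card_eq_zero]; omega
      rw [this, Finset.subset_empty] at hI
      rw [hI]
      exact .empty j (.inl hr.lt)
    rcases (item E N j).eq_empty_or_nonempty with hemp | hne
    · intro I hI _
      rw [hemp, Finset.subset_empty] at hI
      rw [hI]
      exact .empty j (.inl hr.lt)
    have hcard := Finset.card_le_card (item_subset E N j)
    rw [Finset.card_range] at hcard
    have hpos := hne.card_pos
    set m' := (item E N j).card with hm'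
    have hr' := hr.mono (budget_mono c hm)
    have hs0 : 0 < Nat.sqrt m' := Nat.sqrt_pos.2 hpos
    rw [budget, dif_neg (by omega)] at hr'
    -- The levels used: `√m'` for chosen vertices, `1` for the degree filter, `c * √m'` for the
    -- separator, `1` for the components, then the budget of half the size. As `√m' ≥ 1`, the first
    -- four fit into `(c + 3) * √m'`.
    refine solved_of_sparse (c * Nat.sqrt m' + 1 + budget c (m' / 2)) (Nat.sqrt m') hs0
      ((Nat.sqrt_le_self _).trans hcard) (Nat.sqrt m') j (hr'.mono ?_) (Nat.lt_succ_sqrt m') ?_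
    · rw [add_mul]; omega
    intro j2 hr2 hsub2 hsparse
    obtain ⟨Z, hZ, hZ'⟩ := hsep _ (item_subset E N j2) _ hsparse
    refine solved_of_delete (1 + budget c (m' / 2)) Z j2 (hr2.mono (by omega)) ?_
    intro j3 hr3 hsub3
    have hr3' : Room N M j3 (budget c (m' / 2) + 1) := hr3.mono (by omega)
    refine solved_of_components (budget c (m' / 2)) j3 (by omega) hr3' ?_
    intro i hi
    refine ih (m' / 2) ((Nat.div_lt_self (by omega) (by omega)).trans_le hm) _ ?_
      (hr3'.child hi (by omega))
    have hitem := item_child E N j3 (i := i) (o := 4) hi (by omega)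
    rcases (item E N (child N j3 i 4)).eq_empty_or_nonempty with h | ⟨x, hx⟩
    · rw [h]; simp
    · have hx' := hx
      rw [hitem, Finset.mem_filter] at hx'
      -- The subproblem reached may be smaller than `item E N j2 \ Z`, but its components lie in
      -- components of that set, hence are at most half as large.
      have hle : item E N (child N j3 i 4) ⊆ comp E (item E N j2 \ Z) x := by
        intro y hy
        rw [hitem, Finset.mem_filter] at hy
        refine mem_comp.2 ⟨hsub3 hy.1, ?_⟩
        have h := reachable_of_lab_eq E (Eq.trans hx'.2 hy.2.symm)
        exact h.mono (restr_mono E (by exact_mod_cast hsub3))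
      have h1 := Finset.card_le_card hle
      have h2 := hZ' x (hsub3 hx'.1)
      have h3 := Finset.card_le_card hsub2
      have h4 : (item E N j2).card / 2 ≤ m' / 2 := Nat.div_le_div_right h3
      omega

end search
end MaxPartialColoring

/-! ### Generating the subproblems on the machine. -/

namespace RealRAM

/-- Membership is replaced by a Boolean that evaluates to `false` on concrete programs, so callers
need only name the array. -/
theorem Frame.n {p : Program} {σ τ : Store} (h : Frame p σ τ) (a : ℕ)
    (ha : p.natWrites.contains a = false := by rfl) : τ.nat a = σ.nat a :=
  h.nat a (by simpa using ha)

theorem Frame.r {p : Program} {σ τ : Store} (h : Frame p σ τ) (a : ℕ)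
    (ha : p.realWrites.contains a = false := by rfl) : τ.real a = σ.real a :=
  h.real a (by simpa using ha)

namespace NatExpr

@[simp] theorem eval_const (σ : Store) (c : ℕ) : (const c).eval σ = c := rfl
@[simp] theorem eval_cell (σ : Store) (a : ℕ) (i : NatExpr) :
    (cell a i).eval σ = σ.nat a (i.eval σ) := rfl
@[simp] theorem eval_add (σ : Store) (e f : NatExpr) :
    (add e f).eval σ = e.eval σ + f.eval σ := rfl
@[simp] theorem eval_sub (σ : Store) (e f : NatExpr) :
    (sub e f).eval σ = e.eval σ - f.eval σ := rfl

/-- Entry in row `i` and column `x` of the matrix with name `a`, with row offsets in array `4`. -/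
abbrev entry (a : ℕ) (i x : NatExpr) : NatExpr := .cell a (.add (.cell 4 i) x)

end NatExpr

namespace Test

@[simp] theorem holds_natLt (σ : Store) (e f : NatExpr) :
    (natLt e f).Holds σ ↔ e.eval σ < f.eval σ := Iff.rfl
@[simp] theorem holds_realLt (σ : Store) (e f : RealExpr) :
    (realLt e f).Holds σ ↔ e.eval σ < f.eval σ := Iff.rfl
@[simp] theorem holds_not (σ : Store) (b : Test) : (not b).Holds σ ↔ ¬ b.Holds σ := Iff.rfl
@[simp] theorem holds_and (σ : Store) (b c : Test) :
    (and b c).Holds σ ↔ b.Holds σ ∧ c.Holds σ := Iff.rfl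

end Test
end RealRAM

namespace MaxPartialColoring

open RealRAM NatExpr Program Classical

/-! Use of the arrays of naturals: `3` adjacency matrix of the conflict graph, `4` multiples of the
number of conflict vertices, `5` subproblems, `6` degrees, `7` component labels, `8` solutions of the
subproblems, `9` number of conflict vertices, `10` number of subproblems, `11` square root, `12` its
square, `13`-`16` auxiliary scalars, `17` and `18` vertex and color of a conflict vertex, `19` and
`20` auxiliary scalars, `21` multiples of the number of vertices, `30`-`34` loop counters.  Array `1`
of reals holds the weights of the solutions. -/

section programs

variable (E : SimpleGraph ℕ) (N M : ℕ)

/-- The tables that the main part of the program uses. -/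
structure Tables (σ : Store) : Prop where
  num : σ.nat 9 0 = N
  cap : σ.nat 10 0 = M
  base : ∀ j ≤ M + N, σ.nat 4 j = j * N
  conf : ∀ x < N, ∀ y < N, σ.nat 3 (x * N + y) = if E.Adj x y then 1 else 0

/-- The segment of length `N` of `f` that starts at `o` is the indicator of `Y`. -/
def Ind (f : ℕ → ℕ) (o : ℕ) (Y : Finset ℕ) : Prop := ∀ x < N, f (o + x) = if x ∈ Y then 1 else 0

variable {E N M}

theorem Tables.of_eq {σ τ : Store} (h : Tables E N M σ) (h3 : τ.nat 3 = σ.nat 3)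
    (h4 : τ.nat 4 = σ.nat 4) (h9 : τ.nat 9 = σ.nat 9) (h10 : τ.nat 10 = σ.nat 10) :
    Tables E N M τ :=
  ⟨by rw [h9, h.num], by rw [h10, h.cap], by rw [h4]; exact h.base, by rw [h3]; exact h.conf⟩

/-- Computes the degrees in subproblem `v 32`. -/
def degProg : Program :=
  .for 30 (.var 9) (.seq (.setNat 6 (.var 30) (.const 0))
    (.for 31 (.var 9)
      (.cond (.natLt (.const 1) (.add (entry 5 (.var 32) (.var 31)) (entry 3 (.var 30) (.var 31))))
        (.setNat 6 (.var 30) (.add (.cell 6 (.var 30)) (.const 1))) .skip)))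

theorem runs_degProg {B : ℕ} {σ : Store} {Y : Finset ℕ} {j : ℕ} (hB : N ≤ B)
    (hT : Tables E N M σ) (hj : σ.nat 32 0 = j) (hjM : j ≤ M) (hY : Ind N (σ.nat 5) (j * N) Y)
    (hYN : Y ⊆ Finset.range N) :
    Runs B degProg σ fun τ => ∀ x < N, τ.nat 6 x = deg E Y x := by
  refine Runs.for N (fun i τ => ∀ x < i, τ.nat 6 x = deg E Y x) hB
    (fun τ hF => by simp [hF.n 9, hT.num]) (by decide) (fun i τ v h => by simpa using h)
    (by simp) ?_ (fun τ _ h => h)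
  intro x hx τ hF hv hI
  refine .seq (.setNat ?_)
  refine Runs.for N (fun y υ => (∀ x' < x, υ.nat 6 x' = deg E Y x') ∧
      υ.nat 6 x = ((Finset.range y).filter fun z => z ∈ Y ∧ E.Adj x z).card) hB
    (fun υ hF' => by simp [hF'.n 9, hF.n 9, hT.num]) (by decide) (fun i τ v h => by simpa using h)
    ?_ ?_ ?_
  · refine ⟨fun x' hx' => ?_, by simp [hv]⟩
    simp [hv, hx'.ne, hI x' hx']
  · intro y hy υ hF' hv' hI'
    have h9 : υ.nat 30 0 = x := by simp [hF'.n 30, hv]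
    have h32 : υ.nat 32 0 = j := by simp [hF'.n 32, hF.n 32, hj]
    have h4 : υ.nat 4 = σ.nat 4 := by simp [hF'.n 4, hF.n 4]
    have h5 : υ.nat 5 = σ.nat 5 := by simp [hF'.n 5, hF.n 5]
    have h3 : υ.nat 3 = σ.nat 3 := by simp [hF'.n 3, hF.n 3]
    have e1 : (entry 5 (.var 32) (.var 31)).eval υ = if y ∈ Y then 1 else 0 := by
      simp [h32, hv', h4, h5, hT.base j (by omega), hY y hy]
    have e2 : (entry 3 (.var 30) (.var 31)).eval υ = if E.Adj x y then 1 else 0 := by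
      simp [h9, hv', h4, h3, hT.base x (by omega), hT.conf x hx y hy]
    rw [Finset.range_add_one, Finset.filter_insert]
    refine .cond (fun hc => .setNat ?_) (fun hc => .skip ?_)
    · rw [Test.holds_natLt, eval_add, e1, e2] at hc
      have : y ∈ Y ∧ E.Adj x y := by
        by_contra hno
        rw [not_and_or] at hno
        rcases hno with h | h <;> simp [h] at hc <;> split_ifs at hc <;> omega
      rw [if_pos this, Finset.card_insert_of_notMem (by simp)]
      refine ⟨fun x' hx' => ?_, ?_⟩
      · simp [h9, hx'.ne, hI'.1 x' hx']
      · simp [h9, hI'.2]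
    · rw [Test.holds_natLt, eval_add, e1, e2] at hc
      have : ¬ (y ∈ Y ∧ E.Adj x y) := fun h => hc (by simp [h])
      rwa [if_neg this]
  · rintro υ - ⟨h1, h2⟩ x' hx'
    rcases Nat.lt_succ_iff_lt_or_eq.1 hx' with h | rfl
    · exact h1 x' h
    · rw [h2, deg]
      congr 1
      ext z
      simp only [Finset.mem_filter, Finset.mem_range]
      exact ⟨fun h => h.2, fun h => ⟨Finset.mem_range.1 (hYN h.1), h⟩⟩


/-- Computes the component labels in subproblem `v 32`. -/
def labProg : Program :=
  .seq (.for 30 (.var 9) (.setNat 7 (.var 30) (.var 30)))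
    (.for 33 (.var 9) (.for 30 (.var 9) (.for 31 (.var 9)
      (.cond (.and (.natLt (.const 2) (.add (.add (entry 5 (.var 32) (.var 30))
          (entry 5 (.var 32) (.var 31))) (entry 3 (.var 30) (.var 31))))
          (.natLt (.cell 7 (.var 31)) (.cell 7 (.var 30))))
        (.setNat 7 (.var 30) (.cell 7 (.var 31))) .skip))))

/-- `z` is at distance at most `r` from `x`. -/
def Near (E : SimpleGraph ℕ) (Y : Finset ℕ) (r x z : ℕ) : Prop :=
  ∃ p : (restr E Y).Walk x z, p.length ≤ r

/-- A path that has an edge stays in `Y` and has no repeated vertex, so its length is less than `N`.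
-/
theorem near_of_reachable {Y : Finset ℕ} (hY : Y ⊆ Finset.range N) {x z : ℕ}
    (h : (restr E Y).Reachable x z) : Near E Y N x z := by
  obtain ⟨p, hp⟩ := h.exists_isPath
  refine ⟨p, ?_⟩
  cases hpp : p with
  | nil => simp
  | cons hadj q =>
    rw [← hpp]
    have hsub : ∀ {a b : ℕ} (w : (restr E Y).Walk a b), a ∈ Y → ∀ c ∈ w.support, c ∈ Y := by
      intro a b w
      induction w with
      | nil => intro ha c hc; simp at hc; exact hc ▸ ha
      | cons h w ih =>
        intro ha c hc
        rw [SimpleGraph.Walk.support_cons, List.mem_cons] at hc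
        rcases hc with rfl | hc
        · exact ha
        · exact ih h.2.1 c hc
    have h1 : p.support.toFinset ⊆ Finset.range N := fun c hc =>
      hY (hsub p hadj.1 c (List.mem_toFinset.1 hc))
    have h2 := Finset.card_le_card h1
    rw [List.toFinset_card_of_nodup hp.support_nodup, SimpleGraph.Walk.length_support,
      Finset.card_range] at h2
    omega

theorem Near.succ {Y : Finset ℕ} {r x z : ℕ} (h : Near E Y (r + 1) x z) :
    Near E Y r x z ∨ ∃ y, (restr E Y).Adj x y ∧ Near E Y r y z := by
  obtain ⟨p, hp⟩ := h
  cases p with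
  | nil => exact .inl ⟨.nil, by simp⟩
  | cons hadj q => exact .inr ⟨_, hadj, q, by simpa using hp⟩

/-- Labels start as the vertices themselves and are relaxed along edges. After `r` rounds the label
of `x` is reachable from `x` and at most every vertex within distance `r`, so `N` rounds suffice.
Updates in place do no harm, as labels only decrease. -/
theorem runs_labProg {B : ℕ} {σ : Store} {Y : Finset ℕ} {j : ℕ} (hB : N ≤ B)
    (hT : Tables E N M σ) (hj : σ.nat 32 0 = j) (hjM : j ≤ M) (hY : Ind N (σ.nat 5) (j * N) Y)
    (hYN : Y ⊆ Finset.range N) :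
    Runs B labProg σ fun τ => ∀ x < N, τ.nat 7 x = lab E Y x := by
  refine .seq ?_
  refine Runs.for N (fun i τ => ∀ x < i, τ.nat 7 x = x) hB
    (fun τ hF => by simp [hF.n 9, hT.num]) (by decide) (fun i τ v h => by simpa using h)
    (by simp) ?_ ?_
  · intro x hx τ hF hv hI
    refine .setNat fun y hy => ?_
    rcases Nat.lt_succ_iff_lt_or_eq.1 hy with h | rfl
    · simp [hv, h.ne, hI y h]
    · simp [hv]
  intro σ₁ hF₁ hL₁
  refine Runs.for N (fun r τ => ∀ x < N, (restr E Y).Reachable x (τ.nat 7 x) ∧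
      ∀ z, Near E Y r x z → τ.nat 7 x ≤ z) hB
    (fun τ hF => by simp [hF.n 9, hF₁.n 9, hT.num]) (by decide)
    (fun i τ v h => by simpa using h) ?_ ?_ ?_
  · intro x hx
    rw [hL₁ x hx]
    refine ⟨.refl _, fun z hz => ?_⟩
    obtain ⟨p, hp⟩ := hz
    exact (SimpleGraph.Walk.eq_of_length_eq_zero (by omega : p.length = 0)).le
  · intro r hr σ₂ hF₂ _ hI₂
    refine Runs.for N (fun i τ => ∀ x < N, (restr E Y).Reachable x (τ.nat 7 x) ∧
        (∀ z, Near E Y r x z → τ.nat 7 x ≤ z) ∧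
        (x < i → ∀ z, Near E Y (r + 1) x z → τ.nat 7 x ≤ z)) hB
      (fun τ hF => by simp [hF.n 9, hF₂.n 9, hF₁.n 9, hT.num]) (by decide)
      (fun i τ v h => by simpa using h) ?_ ?_ ?_
    · exact fun x hx => ⟨(hI₂ x hx).1, (hI₂ x hx).2, fun h => absurd h (by omega)⟩
    · intro i hi σ₃ hF₃ hv₃ hI₃
      refine Runs.for N (fun y τ => (∀ x < N, (restr E Y).Reachable x (τ.nat 7 x) ∧
          (∀ z, Near E Y r x z → τ.nat 7 x ≤ z) ∧
          (x < i → ∀ z, Near E Y (r + 1) x z → τ.nat 7 x ≤ z)) ∧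
          ∀ y' < y, (restr E Y).Adj i y' → ∀ z, Near E Y r y' z → τ.nat 7 i ≤ z) hB
        (fun τ hF => by simp [hF.n 9, hF₃.n 9, hF₂.n 9, hF₁.n 9, hT.num]) (by decide)
        (fun i τ v h => by simpa using h) ⟨hI₃, by simp⟩ ?_ ?_
      · intro y hy τ hF hv hI
        have h30 : τ.nat 30 0 = i := by simp [hF.n 30, hv₃]
        have h32 : τ.nat 32 0 = j := by simp [hF.n 32, hF₃.n 32, hF₂.n 32, hF₁.n 32, hj]
        have h4 : τ.nat 4 = σ.nat 4 := by simp [hF.n 4, hF₃.n 4, hF₂.n 4, hF₁.n 4]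
        have h5 : τ.nat 5 = σ.nat 5 := by simp [hF.n 5, hF₃.n 5, hF₂.n 5, hF₁.n 5]
        have h3 : τ.nat 3 = σ.nat 3 := by simp [hF.n 3, hF₃.n 3, hF₂.n 3, hF₁.n 3]
        have e1 : (entry 5 (.var 32) (.var 31)).eval τ = if y ∈ Y then 1 else 0 := by
          simp [h32, hv, h4, h5, hT.base j (by omega), hY y hy]
        have e1' : (entry 5 (.var 32) (.var 30)).eval τ = if i ∈ Y then 1 else 0 := by
          simp [h32, h30, h4, h5, hT.base j (by omega), hY i hi]
        have e2 : (entry 3 (.var 30) (.var 31)).eval τ = if E.Adj i y then 1 else 0 := by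
          simp [h30, hv, h4, h3, hT.base i (by omega), hT.conf i hi y hy]
        have hiff : (Test.natLt (.const 2) (.add (.add (entry 5 (.var 32) (.var 30))
            (entry 5 (.var 32) (.var 31))) (entry 3 (.var 30) (.var 31)))).Holds τ ↔
            (restr E Y).Adj i y := by
          rw [Test.holds_natLt, eval_add, eval_add, e1, e1', e2, eval_const]
          change _ ↔ i ∈ Y ∧ y ∈ Y ∧ E.Adj i y
          split_ifs <;> simp_all
        refine .cond (fun hc => .setNat ?_) (fun hc => .skip ?_)
        · rw [Test.holds_and, hiff, Test.holds_natLt] at hc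
          obtain ⟨hadj, hlt⟩ := hc
          simp only [eval_cell, eval_const, h30, hv] at hlt ⊢
          obtain ⟨hI1, hI2⟩ := hI
          refine ⟨fun x hx => ?_, fun y' hy' hadj' z hz => ?_⟩
          · by_cases hxi : x = i
            · subst hxi
              simp only [setNat_nat_same, if_true]
              exact ⟨hadj.reachable.trans (hI1 y hy).1,
                fun z hz => hlt.le.trans ((hI1 x hx).2.1 z hz), fun h => absurd h (by omega)⟩
            · simpa [hxi] using hI1 x hx
          · simp only [setNat_nat_same, if_true]
            rcases Nat.lt_succ_iff_lt_or_eq.1 hy' with h | rfl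
            · exact hlt.le.trans (hI2 y' h hadj' z hz)
            · exact (hI1 y' hy).2.1 z hz
        · rw [Test.holds_and, hiff, Test.holds_natLt] at hc
          simp only [eval_cell, eval_const, h30, hv] at hc
          obtain ⟨hI1, hI2⟩ := hI
          refine ⟨hI1, fun y' hy' hadj' z hz => ?_⟩
          rcases Nat.lt_succ_iff_lt_or_eq.1 hy' with h | rfl
          · exact hI2 y' h hadj' z hz
          · have : ¬ τ.nat 7 y' < τ.nat 7 i := fun h => hc ⟨hadj', h⟩
            exact (not_lt.1 this).trans ((hI1 y' hy).2.1 z hz)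
      · rintro τ - ⟨hI1, hI2⟩ x hx
        refine ⟨(hI1 x hx).1, (hI1 x hx).2.1, fun hxi z hz => ?_⟩
        rcases Nat.lt_succ_iff_lt_or_eq.1 hxi with h | rfl
        · exact (hI1 x hx).2.2 h z hz
        · rcases hz.succ with hz | ⟨y, hadj, hz⟩
          · exact (hI1 x hx).2.1 z hz
          · exact hI2 y (Finset.mem_range.1 (hYN hadj.2.1)) hadj z hz
    · intro τ _ hI x hx
      exact ⟨(hI x hx).1, (hI x hx).2.2 hx⟩
  · intro τ _ hI x hx
    exact le_antisymm ((hI x hx).2 _ (near_of_reachable hYN (reachable_lab E Y x)))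
      (lab_le E (hI x hx).1)

/-- The test whether vertex `v 30` is kept by operation `o` with parameter `v 34`. -/
def opTest : ℕ → Test
  | 0 => .and (.natLt (.const 0) (.add (.sub (.var 30) (.var 34)) (.sub (.var 34) (.var 30))))
      (.natLt (entry 3 (.var 34) (.var 30)) (.const 1))
  | 1 => .natLt (.const 0) (.add (.sub (.var 30) (.var 34)) (.sub (.var 34) (.var 30)))
  | 2 => .not (.natLt (.var 34) (.cell 6 (.var 30)))
  | 3 => .not (.natLt (.cell 7 (.var 30)) (.var 34))
  | _ => .and (.not (.natLt (.cell 7 (.var 30)) (.var 34)))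
      (.not (.natLt (.var 34) (.cell 7 (.var 30))))

/-- Appends the result of operation `o` with parameter `v 34` on subproblem `v 32`. -/
def opProg (o : ℕ) : Program :=
  .seq (.for 30 (.var 9)
    (.cond (.and (.natLt (.const 0) (entry 5 (.var 32) (.var 30))) (opTest o))
      (.setNat 5 (.add (.var 15) (.var 30)) (.const 1))
      (.setNat 5 (.add (.var 15) (.var 30)) (.const 0))))
    (.assign 15 (.add (.var 15) (.var 9)))

/-- The first `q` subproblems have been computed. -/
def Gen (E : SimpleGraph ℕ) (N q : ℕ) (σ : Store) : Prop :=
  (∀ q' < q, Ind N (σ.nat 5) (q' * N) (item E N q')) ∧ σ.nat 15 0 = q * N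

theorem holds_opTest {σ : Store} {Y : Finset ℕ} {i x : ℕ} (o : ℕ) (hT : Tables E N M σ)
    (hi : i < N) (hx : x < N) (h34 : σ.nat 34 0 = i) (h30 : σ.nat 30 0 = x)
    (hdeg : σ.nat 6 x = deg E Y x) (hlab : σ.nat 7 x = lab E Y x) :
    (opTest o).Holds σ ↔ keeps E Y i x o := by
  have hne : 0 < x - i + (i - x) ↔ x ≠ i := by omega
  match o with
  | 0 =>
    simp only [opTest, Test.holds_and, Test.holds_natLt, eval_const, eval_add, eval_sub, eval_cell,
      h30, h34, hT.base i (by omega), hT.conf i hi x hx, hne, keeps]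
    split_ifs with h <;> simp [h]
  | 1 => simp only [opTest, Test.holds_natLt, eval_const, eval_add, eval_sub, eval_cell,
      h30, h34, hne, keeps]
  | 2 => simp [opTest, h30, h34, hdeg, keeps]
  | 3 => simp [opTest, h30, h34, hlab, keeps]
  | n + 4 =>
    simp [opTest, h30, h34, hlab, keeps]
    omega

theorem runs_opProg {B : ℕ} {σ : Store} {i j o : ℕ} (hB : N ≤ B)
    (hT : Tables E N M σ) (hj : σ.nat 32 0 = j) (hjM : j ≤ M) (hi : i < N) (ho : o < 5)
    (h34 : σ.nat 34 0 = i) (hdeg : ∀ x < N, σ.nat 6 x = deg E (item E N j) x)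
    (hlab : ∀ x < N, σ.nat 7 x = lab E (item E N j) x) (hG : Gen E N (child N j i o) σ) :
    Runs B (opProg o) σ (Gen E N (child N j i o + 1)) := by
  have hjc : j < child N j i o := lt_child hi
  set c := child N j i o with hc
  -- The row of the parent ends before the row being written, so it is read unchanged.
  have hjN : j * N + N ≤ c * N := by
    rw [← Nat.succ_mul]; exact Nat.mul_le_mul_right _ hjc
  refine .seq ?_
  refine Runs.for N (fun x τ => (∀ a < c * N, τ.nat 5 a = σ.nat 5 a) ∧
      ∀ y < x, τ.nat 5 (c * N + y) = if y ∈ item E N c then 1 else 0) hB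
    (fun τ hF => by simp [hF.n 9, hT.num]) (by simp [Program.natWrites])
    (fun i τ v h => by simpa using h) (by simp) ?_ ?_
  · intro x hx τ hF hv hI
    have h32 : τ.nat 32 0 = j := by simp [hF.n 32, hj]
    have h15 : τ.nat 15 0 = c * N := by simp [hF.n 15, hG.2]
    have hTτ : Tables E N M τ := hT.of_eq (hF.n 3) (hF.n 4) (hF.n 9) (hF.n 10)
    have htest := holds_opTest (Y := item E N j) o hTτ hi hx (by simp [hF.n 34, h34]) hv
      (by simp [hF.n 6, hdeg x hx]) (by simp [hF.n 7, hlab x hx])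
    have e1 : (entry 5 (.var 32) (.var 30)).eval τ = if x ∈ item E N j then 1 else 0 := by
      have := hI.1 (j * N + x) (by omega)
      simp [h32, hv, hTτ.base j (by omega), this, hG.1 j hjc x hx]
    have hiff : (Test.and (.natLt (.const 0) (entry 5 (.var 32) (.var 30))) (opTest o)).Holds τ ↔
        x ∈ item E N c := by
      rw [Test.holds_and, htest, Test.holds_natLt, e1, hc, item_child E N j hi ho,
        Finset.mem_filter]
      by_cases hxj : x ∈ item E N j <;> simp [hxj]
    have step : ∀ b : ℕ, b = (if x ∈ item E N c then 1 else 0) →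
        (∀ a < c * N, (τ.setNat 5 (c * N + x) b).nat 5 a = σ.nat 5 a) ∧
        ∀ y < x + 1, (τ.setNat 5 (c * N + x) b).nat 5 (c * N + y) =
          if y ∈ item E N c then 1 else 0 := by
      intro b hb
      refine ⟨fun a ha => ?_, fun y hy => ?_⟩
      · rw [setNat_nat_same, if_neg (by omega), hI.1 a ha]
      · rw [setNat_nat_same]
        rcases Nat.lt_succ_iff_lt_or_eq.1 hy with h | rfl
        · rw [if_neg (by omega), hI.2 y h]
        · rw [if_pos rfl, hb]
    refine .cond (fun h => .setNat ?_) (fun h => .setNat ?_)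
    · rw [hiff] at h
      simpa [h15, hv] using step 1 (by rw [if_pos h])
    · rw [hiff] at h
      simpa [h15, hv] using step 0 (by rw [if_neg h])
  · intro τ hF hI
    refine .setNat ⟨fun q' hq' x hx => ?_, ?_⟩
    · have hne : (5 : ℕ) ≠ 15 := by decide
      rw [setNat_nat_ne _ _ _ _ _ hne]
      rcases Nat.lt_succ_iff_lt_or_eq.1 hq' with h | rfl
      · have : q' * N + N ≤ c * N := by
          rw [← Nat.succ_mul]; exact Nat.mul_le_mul_right _ h
        rw [hI.1 _ (by omega), hG.1 q' h x hx]
      · exact hI.2 x hx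
    · simp [hF.n 15, hF.n 9, hG.2, hT.num, add_mul]

/-- Computes the subproblems. -/
def genProg : Program :=
  .seq (.for 30 (.var 9) (.setNat 5 (.var 30) (.const 1)))
  (.seq (.assign 15 (.var 9))
  (.for 32 (.var 10) (.seq degProg (.seq labProg (.for 34 (.var 9)
    (.seq (opProg 0) (.seq (opProg 1) (.seq (opProg 2) (.seq (opProg 3) (opProg 4))))))))))

theorem runs_genProg {B : ℕ} {σ : Store} (hB : N ≤ B) (hM : M ≤ B) (hT : Tables E N M σ) :
    Runs B genProg σ fun τ => ∀ q < M, Ind N (τ.nat 5) (q * N) (item E N q) := by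
  refine .seq ?_
  refine Runs.for N (fun i τ => ∀ x < i, τ.nat 5 x = 1) hB
    (fun τ hF => by simp [hF.n 9, hT.num]) (by decide) (fun i τ v h => by simpa using h)
    (by simp) ?_ ?_
  · intro x hx τ hF hv hI
    refine .setNat fun y hy => ?_
    rcases Nat.lt_succ_iff_lt_or_eq.1 hy with h | rfl
    · simp [hv, hI y h]
    · simp [hv]
  intro σ₁ hF₁ hL₁
  refine .seq (.setNat ?_)
  set σ₂ := σ₁.setNat 15 ((const 0).eval σ₁) ((NatExpr.var 9).eval σ₁) with hσ₂
  have hT₂ : Tables E N M σ₂ := hT.of_eq (by simp [hσ₂, hF₁.n 3]) (by simp [hσ₂, hF₁.n 4])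
    (by simp [hσ₂, hF₁.n 9]) (by simp [hσ₂, hF₁.n 10])
  have hG₂ : Gen E N 1 σ₂ := by
    refine ⟨fun q hq x hx => ?_, by simp [hσ₂, hF₁.n 9, hT.num]⟩
    obtain rfl : q = 0 := by omega
    simp [hσ₂, hL₁ x hx, item, hx]
  -- Before `j` is expanded, all rows below its first child are present, among them row `j`. More
  -- than `M` rows may be written; the surplus is never used.
  refine Runs.for M (fun j τ => Gen E N (child N j 0 0) τ) hM
    (fun τ hF => by simp [hF.n 10, hT₂.cap]) (by decide) (fun i τ v h => by simpa [Gen] using h)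
    (by simpa [child] using hG₂) ?_ ?_
  · intro j hj σ₃ hF₃ hv₃ hG₃
    have hT₃ : Tables E N M σ₃ := hT₂.of_eq (hF₃.n 3) (hF₃.n 4) (hF₃.n 9) (hF₃.n 10)
    have hY : Ind N (σ₃.nat 5) (j * N) (item E N j) := by
      intro x hx
      exact hG₃.1 j (lt_child (by omega)) x hx
    refine .seq ((runs_degProg hB hT₃ hv₃ hj.le hY (item_subset E N j)).mono_frame
      fun σ₄ hF₄ hdeg => ?_)
    have hT₄ : Tables E N M σ₄ := hT₃.of_eq (hF₄.n 3) (hF₄.n 4) (hF₄.n 9) (hF₄.n 10)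
    refine .seq ((runs_labProg hB hT₄ (by rw [hF₄.n 32, hv₃]) hj.le (by rw [hF₄.n 5]; exact hY)
      (item_subset E N j)).mono_frame fun σ₅ hF₅ hlab => ?_)
    have hT₅ : Tables E N M σ₅ := hT₄.of_eq (hF₅.n 3) (hF₅.n 4) (hF₅.n 9) (hF₅.n 10)
    refine Runs.for N (fun i τ => Gen E N (child N j i 0) τ) hB
      (fun τ hF => by simp [hF.n 9, hT₅.num]) (by decide)
      (fun i τ v h => by simpa [Gen] using h)
      (by simpa [Gen, hF₄.n 5, hF₅.n 5, hF₄.n 15, hF₅.n 15] using hG₃) ?_ ?_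
    · intro i hi σ₆ hF₆ hv₆ hG₆
      have hT₆ : Tables E N M σ₆ := hT₅.of_eq (hF₆.n 3) (hF₆.n 4) (hF₆.n 9) (hF₆.n 10)
      have h32 : σ₆.nat 32 0 = j := by rw [hF₆.n 32, hF₅.n 32, hF₄.n 32, hv₃]
      have hd : ∀ x < N, σ₆.nat 6 x = deg E (item E N j) x := by
        rw [hF₆.n 6, hF₅.n 6]; exact hdeg
      have hl : ∀ x < N, σ₆.nat 7 x = lab E (item E N j) x := by rw [hF₆.n 7]; exact hlab
      have next : ∀ (o : ℕ), o < 5 → ∀ (τ : Store), (∀ a ∉ [5, 15, 30], τ.nat a = σ₆.nat a) →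
          Gen E N (child N j i o) τ → Runs B (opProg o) τ fun τ' =>
            (∀ a ∉ [5, 15, 30], τ'.nat a = σ₆.nat a) ∧ Gen E N (child N j i (o + 1)) τ' := by
        intro o ho τ hτ hG
        have n : ∀ a, a ∉ [5, 15, 30] → τ.nat a = σ₆.nat a := hτ
        refine (runs_opProg hB (hT₆.of_eq (n 3 (by decide)) (n 4 (by decide)) (n 9 (by decide))
          (n 10 (by decide))) (by rw [n 32 (by decide), h32]) hj.le hi ho
          (by rw [n 34 (by decide), hv₆]) (by rw [n 6 (by decide)]; exact hd)
          (by rw [n 7 (by decide)]; exact hl) hG).mono_frame fun τ' hF' hG' => ⟨fun a ha => ?_, hG'⟩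
        rw [← hτ a ha]
        refine hF'.nat a fun hmem => ha ?_
        simp only [opProg, Program.for, Program.natWrites, List.mem_append, List.mem_singleton]
          at hmem
        simp only [List.mem_cons, List.not_mem_nil, or_false]
        tauto
      refine .seq ((next 0 (by omega) σ₆ (fun _ _ => rfl) hG₆).mono_frame
        fun τ₁ _ h₁ => .seq ((next 1 (by omega) τ₁ h₁.1 h₁.2).mono_frame
        fun τ₂ _ h₂ => .seq ((next 2 (by omega) τ₂ h₂.1 h₂.2).mono_frame
        fun τ₃ _ h₃ => .seq ((next 3 (by omega) τ₃ h₃.1 h₃.2).mono_frame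
        fun τ₄ _ h₄ => (next 4 (by omega) τ₄ h₄.1 h₄.2).mono_frame fun τ₅ _ h₅ => ?_))))
      exact h₅.2
    · intro τ _ h
      -- The blocks of children of consecutive subproblems are contiguous.
      have : child N j N 0 = child N (j + 1) 0 0 := by simp only [child]; ring
      rwa [this] at h
  · intro τ _ hG q hq x hx
    refine hG.1 q ?_ x hx
    rw [child]
    have : M * 1 ≤ M * (5 * N) := Nat.mul_le_mul_left _ (by omega)
    omega

end programs
end MaxPartialColoring

/-! ### Dynamic programming over the subproblems. -/

namespace RealRAM
namespace RealExpr

@[simp] theorem eval_cell (σ : Store) (a : ℕ) (i : NatExpr) :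
    (cell a i).eval σ = σ.real a (i.eval σ) := rfl
@[simp] theorem eval_add (σ : Store) (r s : RealExpr) :
    (add r s).eval σ = r.eval σ + s.eval σ := rfl

end RealExpr
end RealRAM

namespace MaxPartialColoring

open RealRAM NatExpr Program Classical

section dynamic_programming

variable {E : SimpleGraph ℕ} {N M : ℕ}

theorem row_unique {a b x y : ℕ} (hx : x < N) (hy : y < N) (h : a * N + x = b * N + y) :
    a = b ∧ x = y := by
  have h1 : (a * N + x) / N = a := by
    rw [mul_comm, Nat.mul_add_div (by omega), Nat.div_eq_of_lt hx, add_zero]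
  have h2 : (b * N + y) / N = b := by
    rw [mul_comm, Nat.mul_add_div (by omega), Nat.div_eq_of_lt hy, add_zero]
  have hab : a = b := by rw [← h1, h, h2]
  subst hab
  exact ⟨rfl, by omega⟩

/-- The set whose indicator is row `p` of `f`. -/
def row (N : ℕ) (f : ℕ → ℕ) (p : ℕ) : Finset ℕ := (Finset.range N).filter fun x => f (p * N + x) = 1

theorem mem_row {f : ℕ → ℕ} {p x : ℕ} : x ∈ row N f p ↔ x < N ∧ f (p * N + x) = 1 := by
  simp [row]

/-- All sets in the table of solutions are independent, and their weights are correct. -/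
structure Valid (E : SimpleGraph ℕ) (N M : ℕ) (w : ℕ → ℝ) (σ : Store) : Prop where
  bin : ∀ p ≤ M + N, ∀ x < N, σ.nat 8 (p * N + x) ≤ 1
  sub : ∀ p ≤ M + N, row N (σ.nat 8) p ⊆ part E N M p
  indep : ∀ p ≤ M + N, IsIndep E (row N (σ.nat 8) p)
  val : ∀ p ≤ M + N, σ.real 1 p = ∑ x ∈ row N (σ.nat 8) p, w x

/-- Enters the singletons into the table of solutions. -/
def singleProg : Program :=
  .for 30 (.var 9) (.seq
    (.setNat 8 (.add (.cell 4 (.add (.var 10) (.var 30))) (.var 30)) (.const 1))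
    (.setReal 1 (.add (.var 10) (.var 30)) (.cell 0 (.var 30))))

theorem runs_singleProg {B : ℕ} {σ : Store} (hB : N ≤ B) (hT : Tables E N M σ)
    (h8 : ∀ a, σ.nat 8 a = 0) (h1 : ∀ a, σ.real 1 a = 0) :
    Runs B singleProg σ fun τ => Valid E N M (σ.real 0) τ ∧ (∀ p < M, τ.real 1 p = 0) ∧
      τ.real 1 (M + N) = 0 ∧ ∀ v < N, τ.real 1 (M + v) = σ.real 0 v := by
  refine Runs.for N (fun i τ =>
      (∀ a, τ.nat 8 a = if ∃ v < i, a = (M + v) * N + v then 1 else 0) ∧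
      ∀ p, τ.real 1 p = if M ≤ p ∧ p < M + i then σ.real 0 (p - M) else 0) hB
    (fun τ hF => by simp [hF.n 9, hT.num]) (by decide) (fun i τ v h => by simpa using h)
    ⟨by simpa using h8, fun p => by rw [if_neg (by omega), h1]⟩ ?_ ?_
  · intro v hv τ hF hi hI
    have e1 : (NatExpr.add (.cell 4 (.add (.var 10) (.var 30))) (.var 30)).eval τ =
        (M + v) * N + v := by
      simp [hi, hF.n 10, hF.n 4, hT.cap, hT.base (M + v) (by omega)]
    refine .seq (.setNat (.setReal ?_))
    rw [e1]
    refine ⟨fun a => ?_, fun p => ?_⟩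
    · simp only [setReal_nat, setNat_nat_same, eval_const, hI.1 a]
      by_cases ha : a = (M + v) * N + v
      · rw [if_pos ha, if_pos ⟨v, by omega, ha⟩]
      · rw [if_neg ha]
        congr 1
        refine propext ⟨fun ⟨u, hu, h⟩ => ⟨u, by omega, h⟩, fun ⟨u, hu, h⟩ => ⟨u, ?_, h⟩⟩
        rcases Nat.lt_succ_iff_lt_or_eq.1 hu with h' | rfl
        · exact h'
        · exact absurd h ha
    · have h10 : τ.nat 10 0 = M := by rw [hF.n 10, hT.cap]
      have h0 : τ.real 0 = σ.real 0 := hF.r 0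
      simp only [setReal_real_same, eval_add, eval_cell, eval_const, RealExpr.eval_cell, setNat_real]
      simp only [setNat_nat_ne _ _ _ _ _ (show (10 : ℕ) ≠ 8 by decide),
        setNat_nat_ne _ _ _ _ _ (show (30 : ℕ) ≠ 8 by decide), h10, hi, h0, hI.2 p]
      by_cases hp : p = M + v
      · subst hp
        rw [if_pos rfl, if_pos (by omega)]
        congr 1
        omega
      · rw [if_neg hp]
        congr 1
        refine propext ⟨fun h => ⟨h.1, by omega⟩, fun h => ⟨h.1, by omega⟩⟩
  · intro τ hF hI
    have hrow : ∀ p x, x < N → (τ.nat 8 (p * N + x) = if p = M + x then 1 else 0) := by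
      intro p x hx
      rw [hI.1]
      congr 1
      refine propext ⟨fun ⟨v, hv, h⟩ => ?_, fun h => ⟨x, hx, by rw [h]⟩⟩
      obtain ⟨h1, h2⟩ := row_unique hx hv h
      rw [h1, h2]
    have hrow' : ∀ p, row N (τ.nat 8) p = if M ≤ p ∧ p < M + N then {p - M} else ∅ := by
      intro p
      ext x
      rw [mem_row]
      constructor
      · rintro ⟨hx, h⟩
        rw [hrow p x hx] at h
        have : p = M + x := by by_contra hne; simp [hne] at h
        rw [if_pos (by omega), Finset.mem_singleton]
        omega
      · intro h
        split_ifs at h with hp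
        · rw [Finset.mem_singleton] at h
          have hx : x < N := by omega
          exact ⟨hx, by rw [hrow p x hx, if_pos (by omega)]⟩
        · simp at h
    refine ⟨⟨fun p _ x hx => ?_, fun p _ => ?_, fun p _ => ?_, fun p _ => ?_⟩, fun p hp => ?_, ?_,
      fun v hv => ?_⟩
    · rw [hrow p x hx]; split_ifs <;> omega
    · rw [hrow' p, part]
      split_ifs <;> first | omega | simp
    · rw [hrow' p]
      split_ifs
      · intro x hx y hy
        rw [Finset.mem_singleton] at hx hy
        rw [hx, hy]
        exact E.loopless.irrefl _
      · intro x hx; simp at hx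
    · rw [hrow' p, hI.2]
      split_ifs <;> simp
    · rw [hI.2, if_neg (by omega)]
    · rw [hI.2, if_neg (by omega)]
    · rw [hI.2, if_pos (by omega)]
      congr 1
      omega

/-- Tests whether the sets with indices `v 33` and `v 34` can be combined within subproblem `v 14`. -/
def checkProg : Program :=
  .seq (.assign 16 (.const 1)) (.for 30 (.var 9) (.seq
    (.cond (.natLt (entry 5 (.var 14) (.var 30))
        (.add (entry 8 (.var 33) (.var 30)) (entry 8 (.var 34) (.var 30))))
      (.assign 16 (.const 0)) .skip)
    (.for 31 (.var 9)
      (.cond (.natLt (.const 2) (.add (.add (entry 8 (.var 33) (.var 30))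
          (entry 8 (.var 34) (.var 31))) (entry 3 (.var 30) (.var 31))))
        (.assign 16 (.const 0)) .skip))))

/-- For 0/1 entries, the first inequality says at once that the stored sets are disjoint and
contained in subproblem `j`; the second says that no edge joins them. -/
theorem runs_checkProg {B : ℕ} {σ : Store} {j p q : ℕ} (hB : N ≤ B) (hT : Tables E N M σ)
    (hj : σ.nat 14 0 = j) (hjM : j < M) (hp : σ.nat 33 0 = p) (hpM : p ≤ M + N)
    (hq : σ.nat 34 0 = q) (hqM : q ≤ M + N) :
    Runs B checkProg σ fun τ => (0 < τ.nat 16 0 ↔ ∀ x < N,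
      σ.nat 8 (p * N + x) + σ.nat 8 (q * N + x) ≤ σ.nat 5 (j * N + x) ∧
      ∀ y < N, σ.nat 8 (p * N + x) + σ.nat 8 (q * N + y) + (if E.Adj x y then 1 else 0) ≤ 2) := by
  refine .seq (.setNat ?_)
  set σ₁ := σ.setNat 16 ((const 0).eval σ) ((const 1).eval σ) with hσ₁
  have s : ∀ a, a ≠ 16 → σ₁.nat a = σ.nat a := fun a ha => setNat_nat_ne _ _ _ _ _ ha
  refine Runs.for N (fun i τ => (0 < τ.nat 16 0 ↔ ∀ x < i,
      σ.nat 8 (p * N + x) + σ.nat 8 (q * N + x) ≤ σ.nat 5 (j * N + x) ∧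
      ∀ y < N, σ.nat 8 (p * N + x) + σ.nat 8 (q * N + y) + (if E.Adj x y then 1 else 0) ≤ 2)) hB
    (fun τ hF => by simp [hF.n 9, s 9, hT.num]) (by decide) (fun i τ v h => by simpa using h)
    (by simp [hσ₁]) ?_ (fun τ _ h => h)
  intro x hx τ hF hv hI
  have h14 : τ.nat 14 0 = j := by simp [hF.n 14, s 14, hj]
  have h33 : τ.nat 33 0 = p := by simp [hF.n 33, s 33, hp]
  have h34 : τ.nat 34 0 = q := by simp [hF.n 34, s 34, hq]
  have h4 : τ.nat 4 = σ.nat 4 := by rw [hF.n 4, s 4 (by decide)]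
  have h5 : τ.nat 5 = σ.nat 5 := by rw [hF.n 5, s 5 (by decide)]
  have h8 : τ.nat 8 = σ.nat 8 := by rw [hF.n 8, s 8 (by decide)]
  have h3 : τ.nat 3 = σ.nat 3 := by rw [hF.n 3, s 3 (by decide)]
  have hc : (Test.natLt (entry 5 (.var 14) (.var 30))
        (.add (entry 8 (.var 33) (.var 30)) (entry 8 (.var 34) (.var 30)))).Holds τ ↔
      ¬ σ.nat 8 (p * N + x) + σ.nat 8 (q * N + x) ≤ σ.nat 5 (j * N + x) := by
    simp [h14, h33, h34, h4, h5, h8, hv, hT.base j (by omega), hT.base p hpM, hT.base q hqM]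
  have cont : ∀ τ₁ : Store, (∀ a, a ≠ 16 → τ₁.nat a = τ.nat a) →
      (0 < τ₁.nat 16 0 ↔ 0 < τ.nat 16 0 ∧
        σ.nat 8 (p * N + x) + σ.nat 8 (q * N + x) ≤ σ.nat 5 (j * N + x)) →
      Runs B (.for 31 (.var 9)
      (.cond (.natLt (.const 2) (.add (.add (entry 8 (.var 33) (.var 30))
          (entry 8 (.var 34) (.var 31))) (entry 3 (.var 30) (.var 31))))
        (.assign 16 (.const 0)) .skip)) τ₁ fun τ => (0 < τ.nat 16 0 ↔ ∀ x' < x + 1,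
      σ.nat 8 (p * N + x') + σ.nat 8 (q * N + x') ≤ σ.nat 5 (j * N + x') ∧
      ∀ y < N, σ.nat 8 (p * N + x') + σ.nat 8 (q * N + y) + (if E.Adj x' y then 1 else 0) ≤ 2) := by
    intro τ₁ t h16
    refine Runs.for N (fun i υ => (0 < υ.nat 16 0 ↔ 0 < τ₁.nat 16 0 ∧
      ∀ y < i, σ.nat 8 (p * N + x) + σ.nat 8 (q * N + y) + (if E.Adj x y then 1 else 0) ≤ 2)) hB
      (fun υ hF' => by simp [hF'.n 9, t 9, hF.n 9, s 9, hT.num]) (by decide)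
      (fun i τ v h => by simpa using h) (by simp) ?_ ?_
    · intro y hy υ hF' hv' hI'
      have hc' : (Test.natLt (.const 2) (.add (.add (entry 8 (.var 33) (.var 30))
          (entry 8 (.var 34) (.var 31))) (entry 3 (.var 30) (.var 31)))).Holds υ ↔
          ¬ σ.nat 8 (p * N + x) + σ.nat 8 (q * N + y) + (if E.Adj x y then 1 else 0) ≤ 2 := by
        have n : ∀ a, a ≠ 16 → a ≠ 31 → υ.nat a = τ.nat a := by
          intro a ha ha'
          rw [← t a ha]
          refine hF'.nat a ?_
          simp [Program.for, Program.natWrites, ha, ha']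
        have k33 : υ.nat 33 0 = p := by rw [n 33 (by decide) (by decide), h33]
        have k34 : υ.nat 34 0 = q := by rw [n 34 (by decide) (by decide), h34]
        have k30 : υ.nat 30 0 = x := by rw [n 30 (by decide) (by decide), hv]
        simp [k33, k34, k30, hv', n 4, n 8, n 3, h4, h8, h3, hT.base p hpM, hT.base q hqM,
          hT.base x (by omega), hT.conf x hx y hy]
      have hall : (∀ y' < y + 1, σ.nat 8 (p * N + x) + σ.nat 8 (q * N + y') +
          (if E.Adj x y' then 1 else 0) ≤ 2) ↔ (∀ y' < y, σ.nat 8 (p * N + x) +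
          σ.nat 8 (q * N + y') + (if E.Adj x y' then 1 else 0) ≤ 2) ∧
          σ.nat 8 (p * N + x) + σ.nat 8 (q * N + y) + (if E.Adj x y then 1 else 0) ≤ 2 :=
        Nat.forall_lt_succ_right
      refine .cond (fun h => .setNat ?_) (fun h => .skip ?_)
      · rw [hc'] at h
        rw [hall]
        simp [h]
      · rw [hc', not_not] at h
        rw [hI', hall]
        simp [h]
    · intro υ _ hI'
      rw [hI', h16, hI, Nat.forall_lt_succ_right]
      tauto
  refine .seq (.cond (fun h => .setNat (cont _ ?_ ?_)) (fun h => .skip (cont _ ?_ ?_)))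
  · exact fun a ha => setNat_nat_ne _ _ _ _ _ ha
  · rw [hc] at h
    simp [h]
  · exact fun _ _ => rfl
  · rw [hc, not_not] at h
    simp [h]

/-- The sets with indices `p` and `q` can be combined within subproblem `j`. -/
structure Joinable (E : SimpleGraph ℕ) (N M j p q : ℕ) : Prop where
  left : part E N M p ⊆ item E N j
  right : part E N M q ⊆ item E N j
  disj : Disjoint (part E N M p) (part E N M q)
  anti : ∀ x ∈ part E N M p, ∀ y ∈ part E N M q, ¬ E.Adj x y

/-- Combines the sets with indices `v 33` and `v 34` if this improves the solution of subproblem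
`v 14`. -/
def mergeProg : Program :=
  .seq checkProg (.cond
    (.and (.natLt (.const 0) (.var 16))
      (.realLt (.cell 1 (.var 14)) (.add (.cell 1 (.var 33)) (.cell 1 (.var 34)))))
    (.seq (.for 30 (.var 9) (.setNat 8 (.add (.cell 4 (.var 14)) (.var 30))
        (.add (entry 8 (.var 33) (.var 30)) (entry 8 (.var 34) (.var 30)))))
      (.setReal 1 (.var 14) (.add (.cell 1 (.var 33)) (.cell 1 (.var 34)))))
    .skip)

/-- Soundness needs only the check on the stored sets. No order between `j`, `p` and `q` is assumed,
so the program may try all pairs of indices, even `j` itself. -/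
theorem Valid.update {w : ℕ → ℝ} {σ τ : Store} {j p q : ℕ} (hV : Valid E N M w σ) (hjM : j < M)
    (hpM : p ≤ M + N) (hqM : q ≤ M + N) (hY : Ind N (σ.nat 5) (j * N) (item E N j))
    (hok : ∀ x < N, σ.nat 8 (p * N + x) + σ.nat 8 (q * N + x) ≤ σ.nat 5 (j * N + x) ∧
      ∀ y < N, σ.nat 8 (p * N + x) + σ.nat 8 (q * N + y) + (if E.Adj x y then 1 else 0) ≤ 2)
    (h8 : ∀ x < N, τ.nat 8 (j * N + x) = σ.nat 8 (p * N + x) + σ.nat 8 (q * N + x))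
    (h8' : ∀ a, (¬ ∃ x < N, a = j * N + x) → τ.nat 8 a = σ.nat 8 a)
    (h1 : τ.real 1 j = σ.real 1 p + σ.real 1 q) (h1' : ∀ a ≠ j, τ.real 1 a = σ.real 1 a) :
    Valid E N M w τ := by
  have hle : ∀ x < N, σ.nat 8 (p * N + x) + σ.nat 8 (q * N + x) ≤ if x ∈ item E N j then 1 else 0 :=
    fun x hx => by have := (hok x hx).1; rwa [hY x hx] at this
  have hle1 : ∀ x < N, σ.nat 8 (p * N + x) + σ.nat 8 (q * N + x) ≤ 1 := fun x hx => by
    have := hle x hx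
    split_ifs at this <;> omega
  have hrow : row N (τ.nat 8) j = row N (σ.nat 8) p ∪ row N (σ.nat 8) q := by
    ext x
    simp only [Finset.mem_union, mem_row, ← and_or_left]
    refine and_congr_right fun hx => ?_
    have := hle1 x hx
    rw [h8 x hx]
    omega
  have hdisj : Disjoint (row N (σ.nat 8) p) (row N (σ.nat 8) q) := by
    rw [Finset.disjoint_left]
    intro x hx hx'
    rw [mem_row] at hx hx'
    have := hle1 x hx.1
    omega
  have hother : ∀ p', p' ≠ j → ∀ x < N, τ.nat 8 (p' * N + x) = σ.nat 8 (p' * N + x) :=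
    fun p' hp' x hx => h8' _ fun ⟨y, hy, h⟩ => hp' (row_unique hx hy h).1
  have hrow' : ∀ p', p' ≠ j → row N (τ.nat 8) p' = row N (σ.nat 8) p' := by
    intro p' hp'
    ext x
    rw [mem_row, mem_row]
    exact and_congr_right fun hx => by rw [hother p' hp' x hx]
  have hcross : ∀ x ∈ row N (σ.nat 8) p, ∀ y ∈ row N (σ.nat 8) q, ¬ E.Adj x y := by
    intro x hx y hy hxy
    rw [mem_row] at hx hy
    have := (hok x hx.1).2 y hy.1
    rw [if_pos hxy] at this
    omega
  refine ⟨fun p' hp' x hx => ?_, fun p' hp' => ?_, fun p' hp' => ?_, fun p' hp' => ?_⟩ <;>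
    by_cases hpj : p' = j
  · subst hpj; rw [h8 x hx]; exact hle1 x hx
  · rw [hother p' hpj x hx]; exact hV.bin p' hp' x hx
  · subst hpj
    rw [part, if_pos hjM]
    intro x hx
    rw [mem_row] at hx
    have h2 := hle x hx.1
    rw [← h8 x hx.1, hx.2] at h2
    by_contra hno
    simp [hno] at h2
  · rw [hrow' p' hpj]; exact hV.sub p' hp'
  · subst hpj
    rw [hrow]
    intro x hx y hy hxy
    rcases Finset.mem_union.1 hx with hx | hx <;> rcases Finset.mem_union.1 hy with hy | hy
    · exact hV.indep p hpM x hx y hy hxy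
    · exact hcross x hx y hy hxy
    · exact hcross y hy x hx hxy.symm
    · exact hV.indep q hqM x hx y hy hxy
  · rw [hrow' p' hpj]; exact hV.indep p' hp'
  · subst hpj
    rw [hrow, h1, Finset.sum_union hdisj, hV.val p hpM, hV.val q hqM]
  · rw [hrow' p' hpj, h1' p' hpj]; exact hV.val p' hp'

theorem Valid.of_eq {w : ℕ → ℝ} {σ τ : Store} (hV : Valid E N M w σ) (h8 : τ.nat 8 = σ.nat 8)
    (h1 : τ.real 1 = σ.real 1) : Valid E N M w τ :=
  ⟨by rw [h8]; exact hV.bin, by rw [h8]; exact hV.sub, by rw [h8]; exact hV.indep,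
    by rw [h8, h1]; exact hV.val⟩

theorem runs_mergeProg {B : ℕ} {σ : Store} {w : ℕ → ℝ} {j p q : ℕ} (hB : N ≤ B)
    (hT : Tables E N M σ) (hV : Valid E N M w σ)
    (hj : σ.nat 14 0 = j) (hjM : j < M) (hp : σ.nat 33 0 = p) (hpM : p ≤ M + N)
    (hq : σ.nat 34 0 = q) (hqM : q ≤ M + N) (hY : Ind N (σ.nat 5) (j * N) (item E N j)) :
    Runs B mergeProg σ fun τ => Valid E N M w τ ∧ (∀ p' ≠ j, τ.real 1 p' = σ.real 1 p') ∧
      σ.real 1 j ≤ τ.real 1 j ∧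
      (Joinable E N M j p q → σ.real 1 p + σ.real 1 q ≤ τ.real 1 j) := by
  refine .seq ((runs_checkProg hB hT hj hjM hp hpM hq hqM).mono_frame fun σ₁ hF₁ hok => ?_)
  have h14 : σ₁.nat 14 0 = j := by rw [hF₁.n 14, hj]
  have h33 : σ₁.nat 33 0 = p := by rw [hF₁.n 33, hp]
  have h34 : σ₁.nat 34 0 = q := by rw [hF₁.n 34, hq]
  have hT₁ : Tables E N M σ₁ := hT.of_eq (hF₁.n 3) (hF₁.n 4) (hF₁.n 9) (hF₁.n 10)
  have hc : (Test.and (.natLt (.const 0) (.var 16))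
      (.realLt (.cell 1 (.var 14)) (.add (.cell 1 (.var 33)) (.cell 1 (.var 34))))).Holds σ₁ ↔
      0 < σ₁.nat 16 0 ∧ σ.real 1 j < σ.real 1 p + σ.real 1 q := by
    simp [h14, h33, h34, hF₁.r 1]
  refine .cond (fun h => ?_) (fun h => .skip ?_)
  · rw [hc, hok] at h
    obtain ⟨hok', hlt⟩ := h
    refine .seq (Runs.for N (fun i τ =>
      (∀ x < i, τ.nat 8 (j * N + x) = σ.nat 8 (p * N + x) + σ.nat 8 (q * N + x)) ∧
      ∀ a, (¬ ∃ x < i, a = j * N + x) → τ.nat 8 a = σ.nat 8 a) hB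
      (fun τ hF => by simp [hF.n 9, hT₁.num]) (by decide) (fun i τ v h => by simpa using h)
      (by simp [hF₁.n 8]) ?_ ?_)
    · intro x hx τ hF hv hI
      have e1 : (NatExpr.add (.cell 4 (.var 14)) (.var 30)).eval τ = j * N + x := by
        simp [hF.n 4, hF.n 14, h14, hv, hT₁.base j (by omega)]
      -- One of the two rows may be the row `j` under construction; its entry `x` is read before it
      -- is overwritten.
      have rd : ∀ p, τ.nat 8 (p * N + x) = σ.nat 8 (p * N + x) := fun p =>
        hI.2 _ fun ⟨y, hy, h⟩ => by
          have := (row_unique hx (by omega) h).2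
          omega
      have e2 : (NatExpr.add (entry 8 (.var 33) (.var 30)) (entry 8 (.var 34) (.var 30))).eval τ =
          σ.nat 8 (p * N + x) + σ.nat 8 (q * N + x) := by
        simp [hF.n 4, hF.n 33, hF.n 34, h33, h34, hv, hT₁.base p hpM, hT₁.base q hqM, rd]
      refine .setNat ?_
      rw [e1, e2]
      refine ⟨fun y hy => ?_, fun a ha => ?_⟩
      · rw [setNat_nat_same]
        rcases Nat.lt_succ_iff_lt_or_eq.1 hy with h | rfl
        · rw [if_neg (by omega), hI.1 y h]
        · rw [if_pos rfl]
      · rw [setNat_nat_same, if_neg fun h => ha ⟨x, by omega, h⟩]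
        exact hI.2 a fun ⟨y, hy, h⟩ => ha ⟨y, by omega, h⟩
    · intro τ hF hI
      have e14 : (NatExpr.var 14).eval τ = j := by simp [hF.n 14, h14]
      have ew : (RealExpr.add (.cell 1 (.var 33)) (.cell 1 (.var 34))).eval τ =
          σ.real 1 p + σ.real 1 q := by
        simp [hF.n 33, hF.n 34, h33, h34, hF.r 1, hF₁.r 1]
      refine .setReal ?_
      rw [e14, ew]
      have hr : τ.real 1 = σ.real 1 := by rw [hF.r 1, hF₁.r 1]
      refine ⟨hV.update hjM hpM hqM hY hok' hI.1 hI.2 (by simp) fun a ha => by simp [ha, hr],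
        fun a ha => by simp [ha, hr], ?_, fun _ => by simp⟩
      simpa using hlt.le
  · rw [hc] at h
    refine ⟨hV.of_eq (hF₁.n 8) (hF₁.r 1), fun a _ => by rw [hF₁.r 1], by rw [hF₁.r 1],
      fun hJ => ?_⟩
    rw [hF₁.r 1]
    -- Joinability of the parts passes to the stored sets inside them, so the check has succeeded
    -- and only the comparison of weights can have failed.
    by_contra hlt
    refine h ⟨hok.2 fun x hx => ?_, not_le.1 hlt⟩
    have hmem : ∀ p ≤ M + N, ∀ x < N, σ.nat 8 (p * N + x) = 0 ∨
        (σ.nat 8 (p * N + x) = 1 ∧ x ∈ part E N M p) := by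
      intro p hp x hx
      have h1 := hV.bin p hp x hx
      by_cases h : σ.nat 8 (p * N + x) = 1
      · exact .inr ⟨h, hV.sub p hp (mem_row.2 ⟨hx, h⟩)⟩
      · exact .inl (by omega)
    refine ⟨?_, fun y hy => ?_⟩
    · rw [hY x hx]
      rcases hmem p hpM x hx with h1 | ⟨h1, h1'⟩ <;> rcases hmem q hqM x hx with h2 | ⟨h2, h2'⟩
      · omega
      · rw [if_pos (hJ.right h2')]; omega
      · rw [if_pos (hJ.left h1')]; omega
      · exact absurd h2' (Finset.disjoint_left.1 hJ.disj h1')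
    · have h1 := hV.bin p hpM x hx
      have h2 := hV.bin q hqM y hy
      split_ifs with hxy
      · rcases hmem p hpM x hx with h1 | ⟨h1, h1'⟩
        · omega
        · rcases hmem q hqM y hy with h2 | ⟨h2, h2'⟩
          · omega
          · exact absurd hxy (hJ.anti x h1' y h2')
      · omega

/-- Solves the subproblems, those with larger index first. -/
def dpProg : Program :=
  .for 32 (.var 10) (.seq (.assign 14 (.sub (.sub (.var 10) (.var 32)) (.const 1)))
    (.for 33 (.add (.add (.var 10) (.var 9)) (.const 1))
      (.for 34 (.add (.add (.var 10) (.var 9)) (.const 1)) mergeProg)))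

/-- While `j` is processed no other value changes, and the larger indices already dominate
everything that `Cov` yields there. A union in `Cov.join` uses larger indices only, so its weight is
dominated once all pairs have been tried. -/
theorem runs_dpProg {B : ℕ} {σ : Store} {w : ℕ → ℝ} (hB : M + N + 1 ≤ B)
    (hT : Tables E N M σ) (hV : Valid E N M w σ)
    (hY : ∀ j < M, Ind N (σ.nat 5) (j * N) (item E N j)) (h0 : ∀ p < M, σ.real 1 p = 0)
    (h0' : σ.real 1 (M + N) = 0) (h1 : ∀ v < N, σ.real 1 (M + v) = w v) :
    Runs B dpProg σ fun τ => Valid E N M w τ ∧ ∀ j < M, ∀ I, Cov E N M j I →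
      ∑ x ∈ I, w x ≤ τ.real 1 j := by
  -- Nonnegativity is part of the invariant to dominate the empty set at `j < M`.
  refine Runs.for M (fun i τ => Valid E N M w τ ∧ (∀ p < M, 0 ≤ τ.real 1 p) ∧
      ∀ j, M ≤ j + i → ∀ I, Cov E N M j I → ∑ x ∈ I, w x ≤ τ.real 1 j) (by omega)
    (fun τ hF => by simp [hF.n 10, hT.cap]) (by decide)
    (fun i τ v h => ⟨h.1.of_eq (by simp) (by simp), by simpa using h.2⟩)
    ⟨hV, fun p hp => (h0 p hp).ge, fun j hj I hI => ?_⟩ ?_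
    (fun τ _ h => ⟨h.1, fun j _ => h.2.2 j (by omega)⟩)
  · cases hI with
    | empty _ h =>
      obtain rfl : j = M + N := by omega
      simp [h0']
    | single v hv => simp [h1 v hv]
    | join _ _ _ _ _ h => omega
  intro i hi σ₁ hF₁ hv₁ hI₁
  refine .seq (.setNat ?_)
  obtain ⟨j, hj⟩ : ∃ j, j = M - i - 1 := ⟨_, rfl⟩
  have ej : ((NatExpr.sub (.sub (.var 10) (.var 32)) (.const 1))).eval σ₁ = j := by
    simp [hF₁.n 10, hT.cap, hv₁, hj]
  rw [ej]
  set σ₂ := σ₁.setNat 14 ((const 0).eval σ₁) j with hσ₂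
  have hjM : j < M := by omega
  have n : ∀ a, a ∉ [14, 16, 30, 31, 32, 33, 34, 8] → σ₂.nat a = σ.nat a := by
    intro a ha
    simp only [List.mem_cons, List.not_mem_nil, or_false, not_or] at ha
    rw [hσ₂, setNat_nat_ne _ _ _ _ _ ha.1]
    refine hF₁.nat a ?_
    simp [Program.for, Program.natWrites, mergeProg, checkProg, ha]
  have h14 : σ₂.nat 14 0 = j := by simp [hσ₂]
  have hV₂ : Valid E N M w σ₂ := hI₁.1.of_eq (by simp [hσ₂]) (by simp [hσ₂])
  have hr₂ : σ₂.real 1 = σ₁.real 1 := rfl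
  have hbound : ∀ τ : Store, τ.nat 9 = σ.nat 9 → τ.nat 10 = σ.nat 10 →
      (NatExpr.add (.add (.var 10) (.var 9)) (.const 1)).eval τ = M + N + 1 := fun τ h9 h10 => by
    simp [h9, h10, hT.num, hT.cap]
  refine Runs.for (M + N + 1) (fun p τ => Valid E N M w τ ∧
      (∀ p' ≠ j, τ.real 1 p' = σ₁.real 1 p') ∧ σ₁.real 1 j ≤ τ.real 1 j ∧
      ∀ p' < p, ∀ q' < M + N + 1, j < p' → j < q' → Joinable E N M j p' q' →
        σ₁.real 1 p' + σ₁.real 1 q' ≤ τ.real 1 j) hB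
    (fun τ hF => hbound τ (by rw [hF.n 9, n 9 (by decide)]) (by rw [hF.n 10, n 10 (by decide)]))
    (by decide) (fun i τ v h => ⟨h.1.of_eq (by simp) (by simp), by simpa using h.2⟩)
    ⟨hV₂, fun _ _ => rfl, le_rfl, by simp⟩ ?_ ?_
  · intro p hp σ₃ hF₃ hv₃ hI₃
    refine Runs.for (M + N + 1) (fun q τ => Valid E N M w τ ∧
        (∀ p' ≠ j, τ.real 1 p' = σ₁.real 1 p') ∧ σ₃.real 1 j ≤ τ.real 1 j ∧
        ∀ q' < q, j < p → j < q' → Joinable E N M j p q' →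
          σ₁.real 1 p + σ₁.real 1 q' ≤ τ.real 1 j) hB
      (fun τ hF => hbound τ (by rw [hF.n 9, hF₃.n 9, n 9 (by decide)])
        (by rw [hF.n 10, hF₃.n 10, n 10 (by decide)]))
      (by decide) (fun i τ v h => ⟨h.1.of_eq (by simp) (by simp), by simpa using h.2⟩)
      ⟨hI₃.1, hI₃.2.1, le_rfl, by simp⟩ ?_ ?_
    · intro q hq σ₄ hF₄ hv₄ hI₄
      have n4 : ∀ a, a ∉ [14, 16, 30, 31, 32, 33, 34, 8] → σ₄.nat a = σ.nat a := by
        intro a ha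
        rw [← n a ha]
        simp only [List.mem_cons, List.not_mem_nil, or_false, not_or] at ha
        rw [hF₄.nat a (by simp [Program.for, Program.natWrites, mergeProg, checkProg, ha]),
          hF₃.nat a (by simp [Program.for, Program.natWrites, mergeProg, checkProg, ha])]
      have hT₄ : Tables E N M σ₄ := hT.of_eq (n4 3 (by decide)) (n4 4 (by decide))
        (n4 9 (by decide)) (n4 10 (by decide))
      refine (runs_mergeProg (j := j) (p := p) (q := q) (by omega) hT₄ hI₄.1
        (by rw [hF₄.n 14, hF₃.n 14, h14]) hjM (by rw [hF₄.n 33, hv₃]) (by omega) hv₄ (by omega)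
        (by rw [n4 5 (by decide)]; exact hY j hjM)).mono_frame fun τ _ h => ?_
      obtain ⟨hV', hne, hle, hjoin⟩ := h
      refine ⟨hV', fun p' hp' => (hne p' hp').trans (hI₄.2.1 p' hp'), hI₄.2.2.1.trans hle,
        fun q' hq' hjp hjq hJ => ?_⟩
      rcases Nat.lt_succ_iff_lt_or_eq.1 hq' with h | rfl
      · exact (hI₄.2.2.2 q' h hjp hjq hJ).trans hle
      · rw [← hI₄.2.1 p (by omega), ← hI₄.2.1 q' (by omega)]
        exact hjoin hJ
    · intro τ _ h
      refine ⟨h.1, h.2.1, hI₃.2.2.1.trans h.2.2.1, fun p' hp' q' hq' hjp hjq hJ => ?_⟩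
      rcases Nat.lt_succ_iff_lt_or_eq.1 hp' with h' | rfl
      · exact (hI₃.2.2.2 p' h' q' hq' hjp hjq hJ).trans h.2.2.1
      · exact h.2.2.2 q' hq' hjp hjq hJ
  · rintro τ - ⟨hV', hne, hle, hjoin⟩
    have hpos : ∀ p < M, 0 ≤ τ.real 1 p := by
      intro p hp
      by_cases hpj : p = j
      · rw [hpj]; exact (hI₁.2.1 j hjM).trans hle
      · rw [hne p hpj]; exact hI₁.2.1 p hp
    refine ⟨hV', hpos, fun j' hj' I hI => ?_⟩
    by_cases hjj : j' = j
    · subst hjj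
      cases hI with
      | empty _ h => simpa using hpos _ hjM
      | single v hv => omega
      | join _ p q I J _ hjp hp hjq hq hps hqs hd ha hIp hJq =>
        have hdIJ : Disjoint I J := Finset.disjoint_of_subset_left hIp.subset
          (Finset.disjoint_of_subset_right hJq.subset hd)
        rw [Finset.sum_union hdIJ]
        refine le_trans (add_le_add ?_ ?_)
          (hjoin p (by omega) q (by omega) hjp hjq ⟨hps, hqs, hd, ha⟩)
        · exact hI₁.2.2 p (by omega) I hIp
        · exact hI₁.2.2 q (by omega) J hJq
    · rw [hne j' hjj]
      exact hI₁.2.2 j' (by omega) I hI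

end dynamic_programming
end MaxPartialColoring

/-! ### Preparing the tables without multiplication or division, and writing the output. -/

namespace RealRAM

/-- Multiplication by a constant. -/
def NatExpr.smul : ℕ → NatExpr → NatExpr
  | 0, _ => .const 0
  | c + 1, e => .add (smul c e) e

@[simp] theorem NatExpr.eval_smul (σ : Store) (c : ℕ) (e : NatExpr) :
    (NatExpr.smul c e).eval σ = c * e.eval σ := by
  induction c with
  | zero => simp [smul]
  | succ c ih => simp [smul, ih, add_mul]

/-- Equality of two natural numbers. -/
def Test.eq (e f : NatExpr) : Test := .and (.not (.natLt e f)) (.not (.natLt f e))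

@[simp] theorem Test.holds_eq (σ : Store) (e f : NatExpr) :
    (Test.eq e f).Holds σ ↔ e.eval σ = f.eval σ := by
  simp only [Test.eq, Test.holds_and, Test.holds_not, Test.holds_natLt]
  omega

end RealRAM

namespace MaxPartialColoring

open RealRAM NatExpr Program Classical

section setup

/-- Computes the least number `v 11` whose square `v 12` is at least `v 9`. -/
def sqrtProg : Program :=
  .seq (.assign 11 (.const 0)) (.seq (.assign 12 (.const 0))
    (.for 30 (.var 9) (.cond (.natLt (.var 12) (.var 9))
      (.seq (.assign 12 (.add (.add (.var 12) (.var 11)) (.add (.var 11) (.const 1))))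
        (.assign 11 (.add (.var 11) (.const 1)))) .skip)))

/-- The square is updated by `(r + 1)² = r² + r + (r + 1)`. After `i` rounds either the root has
reached `i` or the square has reached `N`, so `N` rounds suffice. -/
theorem runs_sqrtProg {B N : ℕ} {σ : Store} (hB : N ≤ B) (hN : σ.nat 9 0 = N) :
    Runs B sqrtProg σ fun τ => N ≤ τ.nat 11 0 * τ.nat 11 0 ∧
      (τ.nat 11 0 = 0 ∨ (τ.nat 11 0 - 1) * (τ.nat 11 0 - 1) < N) := by
  refine .seq (.setNat (.seq (.setNat ?_)))
  refine Runs.for N (fun i τ => τ.nat 12 0 = τ.nat 11 0 * τ.nat 11 0 ∧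
      (τ.nat 11 0 = 0 ∨ (τ.nat 11 0 - 1) * (τ.nat 11 0 - 1) < N) ∧
      (i ≤ τ.nat 11 0 ∨ N ≤ τ.nat 11 0 * τ.nat 11 0)) hB
    (fun τ hF => by simp [hF.n 9, hN]) (by decide) (fun i τ v h => by simpa using h)
    (by simp) ?_ ?_
  · intro i hi τ hF hv hI
    have h9 : τ.nat 9 0 = N := by simp [hF.n 9, hN]
    obtain ⟨h1, h2, h3⟩ := hI
    refine .cond (fun h => .seq (.setNat (.setNat ?_))) (fun h => .skip ?_)
    · simp only [Test.holds_natLt, eval_cell, eval_const, h9, h1] at h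
      have h4 : i ≤ τ.nat 11 0 := by omega
      simp [h1, h]
      exact ⟨by ring, .inl h4⟩
    · simp only [Test.holds_natLt, eval_cell, eval_const, h9, h1] at h
      exact ⟨h1, h2, .inr (by omega)⟩
  · rintro τ - ⟨h1, h2, h3⟩
    refine ⟨h3.elim (fun h => h.trans ?_) id, h2⟩
    exact Nat.le_mul_self _

/-- Computes the number `v 10` of subproblems. -/
def capProg (C : ℕ) : Program :=
  .seq (.assign 10 (.const 1)) (.for 30 (.smul C (.var 11))
    (.seq (.assign 13 (.const 0)) (.seq
      (.for 31 (.add (.smul 5 (.var 9)) (.const 1)) (.assign 13 (.add (.var 13) (.var 10))))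
      (.assign 10 (.var 13)))))

/-- Each factor `5 * N + 1` is applied by repeated addition into cell `13`. -/
theorem runs_capProg {B C N r : ℕ} {σ : Store} (hB : 5 * N + 1 ≤ B) (hB' : C * r ≤ B)
    (hN : σ.nat 9 0 = N) (hr : σ.nat 11 0 = r) :
    Runs B (capProg C) σ fun τ => τ.nat 10 0 = (5 * N + 1) ^ (C * r) := by
  refine .seq (.setNat ?_)
  refine Runs.for (C * r) (fun i τ => τ.nat 10 0 = (5 * N + 1) ^ i) hB'
    (fun τ hF => by simp [hF.n 11, hr]) (by decide) (fun i τ v h => by simpa using h)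
    (by simp) ?_ (fun τ _ h => h)
  intro i hi τ hF hv hI
  refine .seq (.setNat (.seq ?_))
  refine Runs.for (5 * N + 1) (fun a τ => τ.nat 13 0 = a * (5 * N + 1) ^ i) hB
    (fun τ hF' => by simp [hF'.n 9, hF.n 9, hN]) (by decide) (fun i τ v h => by simpa using h)
    (by simp) ?_ ?_
  · intro a ha υ hF' hv' hI'
    refine .setNat ?_
    simp [hI', hF'.n 10, hI, add_mul]
  · intro υ hF' hI'
    refine .setNat ?_
    simp [hI', pow_succ']

/-- Tabulates the multiples of `v b` in array `a`. -/
def multiplesProg (a b : ℕ) (e : NatExpr) : Program :=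
  .seq (.setNat a (.const 0) (.const 0)) (.for 30 e
    (.setNat a (.add (.var 30) (.const 1)) (.add (.cell a (.var 30)) (.var b))))

theorem runs_multiplesProg {B a b c m : ℕ} {e : NatExpr} {σ : Store} (hB : c ≤ B)
    (hm : σ.nat b 0 = m) (ha : a ≠ 30) (hb : b ≠ 30) (hab : b ≠ a)
    (he : ∀ τ : Store, (∀ d, d ≠ a → d ≠ 30 → τ.nat d = σ.nat d) → e.eval τ = c) :
    Runs B (multiplesProg a b e) σ fun τ => ∀ j ≤ c, τ.nat a j = j * m := by
  have fr : ∀ τ : Store, Frame (.for 30 e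
      (.setNat a (.add (.var 30) (.const 1)) (.add (.cell a (.var 30)) (.var b))))
      (σ.setNat a 0 0) τ → ∀ d, d ≠ a → d ≠ 30 → τ.nat d = σ.nat d := by
    intro τ hF d hd hd'
    rw [hF.nat d (by simp [Program.for, Program.natWrites, hd, hd']), setNat_nat_ne _ _ _ _ _ hd]
  refine .seq (.setNat ?_)
  refine Runs.for c (fun i τ => ∀ j ≤ i, τ.nat a j = j * m) hB
    (fun τ hF => he τ (fr τ hF)) (by simp [Program.natWrites, ha.symm])
    (fun i τ v h => by simpa [ha] using h) (by simp) ?_ (fun τ _ h => h)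
  intro i hi τ hF hv hI
  refine .setNat fun j hj => ?_
  have hbm : τ.nat b 0 = m := by rw [fr τ hF b hab hb, hm]
  simp only [eval_add, eval_cell, eval_const, hv, hbm, setNat_nat_same]
  rcases Nat.lt_succ_iff_lt_or_eq.1 (Nat.lt_succ_of_le hj) with h | rfl
  · rw [if_neg (by omega), hI j (by omega)]
  · rw [if_pos rfl, hI i le_rfl, add_mul, one_mul]

/-- Tabulates the vertices and the colors of the conflict vertices. -/
def splitProg (k : ℕ) : Program :=
  .seq (.assign 19 (.const 0)) (.seq (.assign 20 (.const 0)) (.for 30 (.var 9)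
    (.seq (.setNat 17 (.var 30) (.var 19)) (.seq (.setNat 18 (.var 30) (.var 20))
      (.seq (.assign 20 (.add (.var 20) (.const 1)))
        (.cond (.natLt (.var 20) (.const k)) .skip
          (.seq (.assign 20 (.const 0)) (.assign 19 (.add (.var 19) (.const 1))))))))))

/-- Quotient and remainder by `k` are kept as two counters with a carry. -/
theorem runs_splitProg {B N k : ℕ} {σ : Store} (hB : N ≤ B) (hN : σ.nat 9 0 = N)
    (hk : 0 < N → 0 < k) :
    Runs B (splitProg k) σ fun τ => ∀ x < N, τ.nat 17 x = x / k ∧ τ.nat 18 x = x % k := by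
  refine .seq (.setNat (.seq (.setNat ?_)))
  refine Runs.for N (fun i τ => (τ.nat 19 0 = i / k ∧ τ.nat 20 0 = i % k) ∧
      ∀ x < i, τ.nat 17 x = x / k ∧ τ.nat 18 x = x % k) hB
    (fun τ hF => by simp [hF.n 9, hN]) (by simp [Program.natWrites]) (fun i τ v h => by simpa using h)
    (by simp) ?_ (fun τ _ h => h.2)
  intro i hi τ hF hv hI
  have hk' : 0 < k := hk (by omega)
  obtain ⟨⟨h1, h2⟩, h3⟩ := hI
  have hmod := Nat.mod_lt i hk'
  have hdm := Nat.div_add_mod i k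
  refine .seq (.setNat (.seq (.setNat (.seq (.setNat ?_)))))
  refine .cond (fun h => .skip ?_) (fun h => .seq (.setNat (.setNat ?_)))
  · simp [hv, h1, h2] at h ⊢
    refine ⟨⟨?_, ?_⟩, fun x hx => ?_⟩
    · refine (Nat.div_eq_of_lt_le ?_ ?_).symm
      · rw [mul_comm]; omega
      · rw [mul_comm, mul_add]; omega
    · rw [Nat.add_mod, Nat.mod_eq_of_lt (a := 1) (by omega), Nat.mod_eq_of_lt h]
    · rcases Nat.lt_succ_iff_lt_or_eq.1 (Nat.lt_succ_of_le hx) with h | rfl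
      · simp [h.ne, h3 x h]
      · simp
  · simp [hv, h1, h2] at h ⊢
    have hik : i + 1 = k * (i / k + 1) := by rw [mul_add]; omega
    refine ⟨⟨?_, ?_⟩, fun x hx => ?_⟩
    · rw [hik, Nat.mul_div_cancel_left _ hk']
    · rw [hik, Nat.mul_mod_right]
    · rcases Nat.lt_succ_iff_lt_or_eq.1 (Nat.lt_succ_of_le hx) with h | rfl
      · simp [h.ne, h3 x h]
      · simp

/-- Tests whether the pair of colors of `v 30` and `v 31` does not belong to a list. -/
def noneOf : List (ℕ × ℕ) → Test
  | [] => .natLt (.const 0) (.const 1)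
  | q :: l => .and (.not (.and (.eq (.cell 18 (.var 30)) (.const q.1))
      (.eq (.cell 18 (.var 31)) (.const q.2)))) (noneOf l)

/-- The pairs are constants of the test; in the application they are the edges of the fixed graph
`H`. -/
theorem holds_noneOf (σ : Store) (l : List (ℕ × ℕ)) : (noneOf l).Holds σ ↔
    (σ.nat 18 (σ.nat 30 0), σ.nat 18 (σ.nat 31 0)) ∉ l := by
  induction l with
  | nil => simp [noneOf]
  | cons q l ih =>
    simp only [noneOf, Test.holds_and, Test.holds_not, Test.holds_eq, ih, eval_cell, eval_const,
      List.mem_cons, not_or, Prod.ext_iff]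

/-- Computes the adjacency matrix of the conflict graph. -/
def confProg (l : List (ℕ × ℕ)) : Program :=
  .for 30 (.var 9) (.for 31 (.var 9)
    (.cond (.eq (.var 30) (.var 31)) (.setNat 3 (.add (.cell 4 (.var 30)) (.var 31)) (.const 0))
    (.cond (.eq (.cell 17 (.var 30)) (.cell 17 (.var 31)))
      (.setNat 3 (.add (.cell 4 (.var 30)) (.var 31)) (.const 1))
    (.cond (.and (.natLt (.const 0)
          (.cell 1 (.add (.cell 21 (.cell 17 (.var 30))) (.cell 17 (.var 31))))) (noneOf l))
      (.setNat 3 (.add (.cell 4 (.var 30)) (.var 31)) (.const 1))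
      (.setNat 3 (.add (.cell 4 (.var 30)) (.var 31)) (.const 0))))))

theorem runs_confProg {B N M : ℕ} {σ : Store} {l : List (ℕ × ℕ)} {E : SimpleGraph ℕ} (hB : N ≤ B)
    (hN : σ.nat 9 0 = N) (hb : ∀ j ≤ M + N, σ.nat 4 j = j * N)
    (hE : ∀ x < N, ∀ y < N, E.Adj x y ↔ x ≠ y ∧ (σ.nat 17 x = σ.nat 17 y ∨
      (0 < σ.nat 1 (σ.nat 21 (σ.nat 17 x) + σ.nat 17 y) ∧ (σ.nat 18 x, σ.nat 18 y) ∉ l))) :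
    Runs B (confProg l) σ fun τ => ∀ x < N, ∀ y < N,
      τ.nat 3 (x * N + y) = if E.Adj x y then 1 else 0 := by
  refine Runs.for N (fun i τ => ∀ x < i, ∀ y < N,
      τ.nat 3 (x * N + y) = if E.Adj x y then 1 else 0) hB
    (fun τ hF => by simp [hF.n 9, hN]) (by simp [Program.for, Program.natWrites]) (fun i τ v h => by simpa using h)
    (by simp) ?_ (fun τ _ h => h)
  intro x hx τ hF hv hI
  refine Runs.for N (fun i τ => (∀ x' < x, ∀ y < N,
      τ.nat 3 (x' * N + y) = if E.Adj x' y then 1 else 0) ∧ ∀ y < i,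
      τ.nat 3 (x * N + y) = if E.Adj x y then 1 else 0) hB
    (fun τ hF' => by simp [hF'.n 9, hF.n 9, hN]) (by simp [Program.natWrites]) (fun i τ v h => by simpa using h)
    ⟨hI, by simp⟩ ?_ ?_
  · intro y hy υ hF' hv' hI'
    have h30 : υ.nat 30 0 = x := by simp [hF'.n 30, hv]
    have h4 : υ.nat 4 = σ.nat 4 := by rw [hF'.n 4, hF.n 4]
    have h17 : υ.nat 17 = σ.nat 17 := by rw [hF'.n 17, hF.n 17]
    have h18 : υ.nat 18 = σ.nat 18 := by rw [hF'.n 18, hF.n 18]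
    have h21 : υ.nat 21 = σ.nat 21 := by rw [hF'.n 21, hF.n 21]
    have h1 : υ.nat 1 = σ.nat 1 := by rw [hF'.n 1, hF.n 1]
    have e : (NatExpr.add (.cell 4 (.var 30)) (.var 31)).eval υ = x * N + y := by
      simp [h30, hv', h4, hb x (by omega)]
    have step : ∀ b : ℕ, b = (if E.Adj x y then 1 else 0) →
        (∀ x' < x, ∀ y' < N, (υ.setNat 3 (x * N + y) b).nat 3 (x' * N + y') =
          if E.Adj x' y' then 1 else 0) ∧ ∀ y' < y + 1,
        (υ.setNat 3 (x * N + y) b).nat 3 (x * N + y') = if E.Adj x y' then 1 else 0 := by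
      intro b hb
      refine ⟨fun x' hx' y' hy' => ?_, fun y' hy' => ?_⟩
      · rw [setNat_nat_same, if_neg fun h => hx'.ne (row_unique hy' hy h).1, hI'.1 x' hx' y' hy']
      · rw [setNat_nat_same]
        rcases Nat.lt_succ_iff_lt_or_eq.1 hy' with h | rfl
        · rw [if_neg (by omega), hI'.2 y' h]
        · rw [if_pos rfl, hb]
    have hE' := hE x hx y hy
    refine .cond (fun h => .setNat ?_) fun h => .cond (fun h' => .setNat ?_) fun h' =>
      .cond (fun h'' => .setNat ?_) fun h'' => .setNat ?_ <;> rw [e] <;> refine step _ ?_ <;>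
      simp only [Test.holds_eq, Test.holds_and, Test.holds_natLt, holds_noneOf, eval_cell, eval_add,
        eval_const, h30, hv', h17, h18, h21, h1] at *
    · rw [if_neg (fun hadj => (hE'.1 hadj).1 h)]
    · rw [if_pos (hE'.2 ⟨h, .inl h'⟩)]
    · rw [if_pos (hE'.2 ⟨h, .inr h''⟩)]
    · rw [if_neg (fun hadj => (hE'.1 hadj).2.elim h' h'')]
  · rintro υ - ⟨h1, h2⟩ x' hx' y hy
    rcases Nat.lt_succ_iff_lt_or_eq.1 hx' with h | rfl
    · exact h1 x' h y hy
    · exact h2 y hy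

/-- Prepares the tables. -/
def setupProg (k C : ℕ) (l : List (ℕ × ℕ)) : Program :=
  .seq (.assign 9 (.smul k (.var 0)))
  (.seq sqrtProg (.seq (capProg C)
  (.seq (multiplesProg 4 9 (.add (.var 10) (.var 9)))
  (.seq (multiplesProg 21 0 (.var 0))
  (.seq (splitProg k) (confProg l))))))

theorem runs_setupProg {B n k C : ℕ} {l : List (ℕ × ℕ)} {σ : Store} {E : SimpleGraph ℕ}
    {r : ℕ} (hr : n * k ≤ r * r ∧ (r = 0 ∨ (r - 1) * (r - 1) < n * k))
    (hB : (5 * (n * k) + 1) ^ (C * r) + 5 * (n * k) + n + C * r + 1 ≤ B)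
    (hn : σ.nat 0 0 = n)
    (hE : ∀ x < n * k, ∀ y < n * k, E.Adj x y ↔ x ≠ y ∧ (x / k = y / k ∨
      (0 < σ.nat 1 (x / k * n + y / k) ∧ (x % k, y % k) ∉ l))) :
    Runs B (setupProg k C l) σ fun τ => Tables E (n * k) ((5 * (n * k) + 1) ^ (C * r)) τ ∧
      ∀ x < n * k, τ.nat 17 x = x / k ∧ τ.nat 18 x = x % k := by
  set N := n * k with hNdef
  set M := (5 * N + 1) ^ (C * r) with hM
  have hk : 0 < N → 0 < k := fun h => Nat.pos_of_mul_pos_left (hNdef ▸ h)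
  refine .seq (.setNat ?_)
  set σ₁ := σ.setNat 9 ((const 0).eval σ) ((NatExpr.smul k (.var 0)).eval σ) with hσ₁
  have h9 : σ₁.nat 9 0 = N := by simp [hσ₁, hn, hNdef, mul_comm]
  have h0 : σ₁.nat 0 0 = n := by simp [hσ₁, hn]
  refine .seq ((runs_sqrtProg (by omega) h9).mono_frame fun σ₂ hF₂ hr₂ => ?_)
  -- The two inequalities determine the rounded-up square root, so the computed value is the given
  -- `r`.
  have hr' : σ₂.nat 11 0 = r := by
    generalize σ₂.nat 11 0 = s at hr₂
    have h1 : ¬ r < s := fun h => by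
      have := Nat.mul_le_mul (Nat.le_sub_one_of_lt h) (Nat.le_sub_one_of_lt h)
      omega
    have h2 : ¬ s < r := fun h => by
      have := Nat.mul_le_mul (Nat.le_sub_one_of_lt h) (Nat.le_sub_one_of_lt h)
      omega
    omega
  have h9₂ : σ₂.nat 9 0 = N := by rw [hF₂.n 9, h9]
  have h0₂ : σ₂.nat 0 0 = n := by rw [hF₂.n 0, h0]
  refine .seq ((runs_capProg (C := C) (by omega) (by omega) h9₂ hr').mono_frame fun σ₃ hF₃ hM₃ => ?_)
  have h9₃ : σ₃.nat 9 0 = N := by rw [hF₃.n 9, h9₂]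
  have h0₃ : σ₃.nat 0 0 = n := by rw [hF₃.n 0, h0₂]
  refine .seq ((runs_multiplesProg (c := M + N) (by omega) h9₃ (by decide) (by decide) (by decide)
    fun τ hτ => by simp [hτ 10, hτ 9, hM₃, h9₃, hM]).mono_frame fun σ₄ hF₄ hb => ?_)
  have h9₄ : σ₄.nat 9 0 = N := by rw [hF₄.n 9, h9₃]
  have h0₄ : σ₄.nat 0 0 = n := by rw [hF₄.n 0, h0₃]
  refine .seq ((runs_multiplesProg (c := n) (by omega) h0₄ (by decide) (by decide) (by decide)
    fun τ hτ => by simp [hτ 0, h0₄]).mono_frame fun σ₅ hF₅ hnb => ?_)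
  have h9₅ : σ₅.nat 9 0 = N := by rw [hF₅.n 9, h9₄]
  refine .seq ((runs_splitProg (by omega) h9₅ hk).mono_frame fun σ₆ hF₆ hs => ?_)
  have hb₆ : ∀ j ≤ M + N, σ₆.nat 4 j = j * N := by rw [hF₆.n 4, hF₅.n 4]; exact hb
  refine (runs_confProg (M := M) (E := E) (by omega) (by rw [hF₆.n 9, h9₅]) hb₆ ?_).mono_frame
    fun σ₇ hF₇ hc => ?_
  · intro x hx y hy
    rw [hE x hx y hy, (hs x hx).1, (hs x hx).2, (hs y hy).1, (hs y hy).2]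
    have h1 : σ₆.nat 1 = σ.nat 1 := by
      rw [hF₆.n 1, hF₅.n 1, hF₄.n 1, hF₃.n 1, hF₂.n 1, hσ₁, setNat_nat_ne _ _ _ _ _ (by decide)]
    have hlt : x / k < n := Nat.div_lt_of_lt_mul (by rw [mul_comm]; exact hx)
    rw [h1, hF₆.n 21, hnb _ hlt.le]
  · refine ⟨⟨?_, ?_, ?_, hc⟩, by rw [hF₇.n 17, hF₇.n 18]; exact hs⟩
    · rw [hF₇.n 9, hF₆.n 9, h9₅]
    · rw [hF₇.n 10, hF₆.n 10, hF₅.n 10, hF₄.n 10, hM₃]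
    · rw [hF₇.n 4]; exact hb₆

/-- Writes the output. -/
def outProg : Program :=
  .for 30 (.var 9) (.cond (.natLt (.const 0) (.cell 8 (.var 30)))
    (.setNat 2 (.cell 17 (.var 30)) (.add (.cell 18 (.var 30)) (.const 1))) .skip)

theorem runs_outProg {B N k : ℕ} {σ : Store} {I : Finset ℕ} (hB : N ≤ B) (hN : σ.nat 9 0 = N)
    (hs : ∀ x < N, σ.nat 17 x = x / k ∧ σ.nat 18 x = x % k) (h2 : ∀ u, σ.nat 2 u = 0)
    (hI : ∀ x < N, (0 < σ.nat 8 x ↔ x ∈ I)) (hinj : ∀ x ∈ I, ∀ y ∈ I, x / k = y / k → x = y) :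
    Runs B outProg σ fun τ => (∀ u, (∀ x < N, x ∈ I → x / k ≠ u) → τ.nat 2 u = 0) ∧
      ∀ x < N, x ∈ I → τ.nat 2 (x / k) = x % k + 1 := by
  refine Runs.for N (fun i τ => (∀ u, (∀ x < i, x ∈ I → x / k ≠ u) → τ.nat 2 u = 0) ∧
      ∀ x < i, x ∈ I → τ.nat 2 (x / k) = x % k + 1) hB
    (fun τ hF => by simp [hF.n 9, hN]) (by decide) (fun i τ v h => by simpa using h)
    (by simpa using h2) ?_ (fun τ _ h => h)
  intro x hx τ hF hv hI'
  have hc : (Test.natLt (.const 0) (.cell 8 (.var 30))).Holds τ ↔ x ∈ I := by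
    rw [← hI x hx]
    simp [hv, hF.n 8]
  refine .cond (fun h => .setNat ?_) (fun h => .skip ?_)
  · rw [hc] at h
    simp only [eval_add, eval_cell, eval_const, hv, hF.n 17, hF.n 18, (hs x hx).1, (hs x hx).2]
    refine ⟨fun u hu => ?_, fun y hy hyI => ?_⟩
    · rw [setNat_nat_same, if_neg (hu x (by omega) h).symm]
      exact hI'.1 u fun y hy => hu y (by omega)
    · rw [setNat_nat_same]
      rcases Nat.lt_succ_iff_lt_or_eq.1 hy with hlt | rfl
      -- Different elements of `I` belong to different vertices, so an earlier output is not
      -- overwritten.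
      · rw [if_neg fun h' => hlt.ne (hinj y hyI x h h'), hI'.2 y hlt hyI]
      · rw [if_pos rfl]
  · rw [hc] at h
    refine ⟨fun u hu => hI'.1 u fun y hy => hu y (by omega), fun y hy hyI => ?_⟩
    rcases Nat.lt_succ_iff_lt_or_eq.1 hy with hlt | rfl
    · exact hI'.2 y hlt hyI
    · exact absurd hyI h

end setup
end MaxPartialColoring

/-! ### Colorings as independent sets of the conflict graph, and the solver. -/

namespace MaxPartialColoring

open RealRAM NatExpr Program Classical

section coloring

variable {n k : ℕ} (G : SimpleGraph (Fin n)) (H : SimpleGraph (Fin k))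

/-- The conflict graph: assigning color `c` to vertex `u` is represented by the number
`u * k + c`, and two assignments are adjacent if they are not both possible. -/
def conflict : SimpleGraph ℕ where
  Adj x y := x ≠ y ∧ ∃ (u v : Fin n) (c d : Fin k), x = u * k + c ∧ y = v * k + d ∧
    (u = v ∨ (G.Adj u v ∧ ¬ H.Adj c d))
  symm := ⟨fun _ _ ⟨hne, u, v, c, d, hx, hy, h⟩ => ⟨hne.symm, v, u, d, c, hy, hx,
    h.imp Eq.symm fun h => ⟨h.1.symm, fun h' => h.2 h'.symm⟩⟩⟩
  loopless := ⟨fun _ h => h.1 rfl⟩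

theorem div_row (u : ℕ) (c : Fin k) : (u * k + c) / k = u := by
  rw [mul_comm, Nat.mul_add_div c.pos, Nat.div_eq_of_lt c.2, add_zero]

theorem mod_row (u : ℕ) (c : Fin k) : (u * k + c) % k = c := by
  rw [mul_comm, Nat.mul_add_mod, Nat.mod_eq_of_lt c.2]

theorem row_lt (u : Fin n) (c : Fin k) : (u : ℕ) * k + c < n * k := by
  have : (u + 1 : ℕ) * k ≤ n * k := Nat.mul_le_mul_right _ u.2
  rw [add_mul] at this
  omega

theorem exists_row {x : ℕ} (hx : x < n * k) : ∃ (u : Fin n) (c : Fin k), x = u * k + c := by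
  have hk : 0 < k := Nat.pos_of_ne_zero fun h => by simp [h] at hx
  exact ⟨⟨x / k, Nat.div_lt_of_lt_mul (by rw [mul_comm]; exact hx)⟩, ⟨x % k, Nat.mod_lt _ hk⟩,
    by simp only; rw [mul_comm]; exact (Nat.div_add_mod x k).symm⟩

theorem conflict_adj (u v : Fin n) (c d : Fin k) :
    (conflict G H).Adj (u * k + c) (v * k + d) ↔
      (u : ℕ) * k + c ≠ v * k + d ∧ (u = v ∨ (G.Adj u v ∧ ¬ H.Adj c d)) := by
  refine and_congr_right fun _ => ⟨?_, fun h => ⟨u, v, c, d, rfl, rfl, h⟩⟩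
  rintro ⟨u', v', c', d', hu, hv, h⟩
  obtain ⟨h1, h2⟩ := row_unique c.2 c'.2 hu
  obtain ⟨h3, h4⟩ := row_unique d.2 d'.2 hv
  rw [Fin.ext h1, Fin.ext h2, Fin.ext h3, Fin.ext h4]
  exact h

/-- The reduction `% n` does nothing below `n * k`; it only makes the vertex of a number defined on
all of `ℕ`. -/
theorem isConflict_conflict (hn : 0 < n) (hk : 0 < k) {Y : Finset ℕ}
    (hY : Y ⊆ Finset.range (n * k)) :
    IsConflict (conflict G H) G H (fun x => ⟨x / k % n, Nat.mod_lt _ hn⟩)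
      (fun x => ⟨x % k, Nat.mod_lt _ hk⟩) Y := by
  intro x hx y hy
  obtain ⟨u, c, rfl⟩ := exists_row (Finset.mem_range.1 (hY hx))
  obtain ⟨v, d, rfl⟩ := exists_row (Finset.mem_range.1 (hY hy))
  simp only [conflict_adj, div_row, mod_row, Nat.mod_eq_of_lt u.2, Nat.mod_eq_of_lt v.2, Fin.eta]

/-- Sparse parts of the conflict graph have small balanced separators. -/
theorem conflict_separator {t : ℕ} (hG : P6StFree t G) (Y : Finset ℕ)
    (hY : Y ⊆ Finset.range (n * k)) (Δ : ℕ)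
    (hΔ : ∀ x ∈ Y, (nbhd (conflict G H) Y x).card ≤ Δ) :
    ∃ Z : Finset ℕ, Z.card ≤ k * 5 * (1 + k * k * (t * 2)) * Δ ∧
      ∀ x ∈ Y \ Z, (comp (conflict G H) (Y \ Z) x).card ≤ Y.card / 2 := by
  by_cases h : 0 < n * k
  · have hn : 0 < n := Nat.pos_of_mul_pos_right h
    have hk : 0 < k := Nat.pos_of_mul_pos_left h
    obtain ⟨Z, hZ, hZ'⟩ := exists_separator hG.2 hG.1 (isConflict_conflict G H hn hk hY) hΔ
    rw [Fintype.card_fin] at hZ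
    exact ⟨Z, hZ, by convert hZ'⟩
  · have : Y = ∅ := by
      rw [← Finset.subset_empty]
      simpa [show n * k = 0 by omega] using hY
    subst this
    exact ⟨∅, by simp, by simp⟩

variable {G H}

/-- The set of assignments that make up a partial function. -/
noncomputable def assignments (φ : Fin n → Option (Fin k)) : Finset ℕ :=
  (Finset.range (n * k)).filter fun x => ∃ (u : Fin n) (c : Fin k), x = u * k + c ∧ φ u = some c

theorem mem_assignments {φ : Fin n → Option (Fin k)} {u : Fin n} {c : Fin k} :
    (u : ℕ) * k + c ∈ assignments φ ↔ φ u = some c := by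
  simp only [assignments, Finset.mem_filter, Finset.mem_range]
  constructor
  · rintro ⟨-, u', c', h, h'⟩
    obtain ⟨h1, h2⟩ := row_unique c.2 c'.2 h
    rwa [Fin.ext h1, Fin.ext h2]
  · exact fun h => ⟨row_lt u c, u, c, rfl, h⟩

/-- Distinct assignments of a function have distinct vertices, so only conflicts along edges of `G`
can occur. -/
theorem isIndep_assignments_iff {φ : Fin n → Option (Fin k)} :
    IsIndep (conflict G H) (assignments φ) ↔ IsPartialColoring H G φ := by
  constructor
  · intro h u v a b huv hu hv
    by_contra hab
    refine h _ (mem_assignments.2 hu) _ (mem_assignments.2 hv)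
      ((conflict_adj G H u v a b).2 ⟨fun he => ?_, .inr ⟨huv, hab⟩⟩)
    exact huv.ne (Fin.ext (row_unique a.2 b.2 he).1)
  · intro h x hx y hy hxy
    obtain ⟨hne, u, v, c, d, rfl, rfl, h'⟩ := hxy
    rw [mem_assignments] at hx hy
    rcases h' with rfl | ⟨huv, hcd⟩
    · rw [hx, Option.some_inj] at hy
      rw [hy] at hne
      exact hne rfl
    · exact hcd (h u v c d huv hx hy)

theorem inputStore_rev (rev : Fin n → Fin k → ℝ) (u : Fin n) (c : Fin k) :
    (inputStore G rev).real 0 (u * k + c) = rev u c := by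
  simp only [inputStore, row_lt u c, and_self, dif_pos]
  congr
  · exact div_row _ _
  · exact mod_row _ _

theorem inputStore_adj (rev : Fin n → Fin k → ℝ) (u v : Fin n) :
    0 < (inputStore G rev).nat 1 (u * n + v) ↔ G.Adj u v := by
  simp only [inputStore]
  rw [if_neg (by omega)]
  constructor
  · intro h
    split_ifs at h with h'
    · obtain ⟨-, u', v', he, hadj⟩ := h'
      obtain ⟨h1, h2⟩ := row_unique v.2 v'.2 he
      rwa [Fin.ext h1, Fin.ext h2]
    · omega
  · intro h
    rw [if_pos ⟨trivial, u, v, rfl, h⟩]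
    exact one_pos

theorem sum_assignments (rev : Fin n → Fin k → ℝ) (φ : Fin n → Option (Fin k)) :
    ∑ x ∈ assignments φ, (inputStore G rev).real 0 x = revenue rev φ := by
  let f : Fin n → Finset ℕ := fun u => (φ u).elim ∅ fun c => {(u : ℕ) * k + c}
  have hf : ∀ u x, x ∈ f u ↔ ∃ c, φ u = some c ∧ x = u * k + c := by
    intro u x
    simp only [f]
    cases h : φ u <;> simp
  have he : assignments φ = Finset.univ.biUnion f := by
    ext x
    simp only [Finset.mem_biUnion, Finset.mem_univ, true_and, hf]
    constructor
    · intro h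
      obtain ⟨-, u, c, h1, h2⟩ := Finset.mem_filter.1 h
      exact ⟨u, c, h2, h1⟩
    · rintro ⟨u, c, h1, rfl⟩
      exact mem_assignments.2 h1
  rw [he, Finset.sum_biUnion, revenue]
  · refine Finset.sum_congr rfl fun u _ => ?_
    simp only [f]
    cases h : φ u with
    | none => simp
    | some c => simp [inputStore_rev]
  · intro u _ v _ huv
    rw [Function.onFun, Finset.disjoint_left]
    intro x hx hx'
    obtain ⟨c, -, h⟩ := (hf u x).1 hx
    obtain ⟨d, -, h'⟩ := (hf v x).1 hx'
    exact huv (Fin.ext (row_unique c.2 d.2 (h.symm.trans h')).1)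

/-- Every independent set of the conflict graph comes from a partial function. -/
theorem exists_assignments_eq {I : Finset ℕ} (hI : I ⊆ Finset.range (n * k))
    (hind : IsIndep (conflict G H) I) : ∃ φ : Fin n → Option (Fin k), assignments φ = I := by
  -- Two colors of one vertex are in conflict, so an independent set is the graph of a partial
  -- function.
  have huniq : ∀ (u : Fin n) (c d : Fin k), (u : ℕ) * k + c ∈ I → (u : ℕ) * k + d ∈ I → c = d := by
    intro u c d hc hd
    by_contra hcd
    exact hind _ hc _ hd ((conflict_adj G H u u c d).2
      ⟨fun h => hcd (Fin.ext (row_unique c.2 d.2 h).2), .inl rfl⟩)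
  refine ⟨fun u => if h : ∃ c : Fin k, (u : ℕ) * k + c ∈ I then some h.choose else none, ?_⟩
  have key : ∀ (u : Fin n) (c : Fin k),
      ((if h : ∃ c : Fin k, (u : ℕ) * k + c ∈ I then some h.choose else none) = some c) ↔
        (u : ℕ) * k + c ∈ I := by
    intro u c
    constructor
    · intro h
      split_ifs at h with h'
      rw [Option.some_inj] at h
      exact h ▸ h'.choose_spec
    · intro h
      have h' : ∃ c : Fin k, (u : ℕ) * k + c ∈ I := ⟨c, h⟩
      rw [dif_pos h', huniq u _ _ h'.choose_spec h]
  ext x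
  constructor
  · intro h
    obtain ⟨-, u, c, rfl, h2⟩ := Finset.mem_filter.1 h
    exact (key u c).1 h2
  · intro h
    obtain ⟨u, c, rfl⟩ := exists_row (Finset.mem_range.1 (hI h))
    exact mem_assignments.2 ((key u c).2 h)

/-- The edges of `H`, as a list of pairs of numbers. -/
noncomputable def edgeList (H : SimpleGraph (Fin k)) : List (ℕ × ℕ) :=
  ((Finset.univ.filter fun q : Fin k × Fin k => H.Adj q.1 q.2).toList).map
    fun q => ((q.1 : ℕ), (q.2 : ℕ))

theorem mem_edgeList (c d : Fin k) : ((c : ℕ), (d : ℕ)) ∈ edgeList H ↔ H.Adj c d := by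
  simp only [edgeList, List.mem_map, Finset.mem_toList, Finset.mem_filter, Finset.mem_univ,
    true_and, Prod.mk.injEq]
  constructor
  · rintro ⟨⟨a, b⟩, h, h1, h2⟩
    rwa [← Fin.ext h1, ← Fin.ext h2]
  · exact fun h => ⟨(c, d), h, rfl, rfl⟩

/-- The program that solves Max Partial `H`-Coloring. -/
noncomputable def solver (H : SimpleGraph (Fin k)) (C : ℕ) : Program :=
  .seq (setupProg k C (edgeList H)) (.seq genProg (.seq singleProg (.seq dpProg outProg)))

theorem runs_solver {B c r : ℕ} (rev : Fin n → Fin k → ℝ)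
    (hr : n * k ≤ r * r ∧ (r = 0 ∨ (r - 1) * (r - 1) < n * k))
    (hB : (5 * (n * k) + 1) ^ (4 * (c + 3) * r) + 5 * (n * k) + n + 4 * (c + 3) * r + 1 ≤ B)
    (hsep : ∀ Y ⊆ Finset.range (n * k), ∀ Δ, (∀ x ∈ Y, (nbhd (conflict G H) Y x).card ≤ Δ) →
      ∃ Z : Finset ℕ, Z.card ≤ c * Δ ∧
        ∀ x ∈ Y \ Z, (comp (conflict G H) (Y \ Z) x).card ≤ Y.card / 2) :
    Runs B (solver H (4 * (c + 3))) (inputStore G rev) fun τ =>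
      ∃ φ : Fin n → Option (Fin k), Outputs τ φ ∧ IsOptimum H G rev φ := by
  set N := n * k with hN
  set M := (5 * N + 1) ^ (4 * (c + 3) * r) with hM
  have hM0 : 0 < M := Nat.pow_pos (Nat.succ_pos _)
  have hin : ∀ a, 1 < a → ∀ i, (inputStore G rev).nat a i = 0 := fun a ha i => by
    simp only [inputStore]
    rw [if_neg (by omega), if_neg (by omega)]
  have hin' : ∀ i, (inputStore G rev).real 1 i = 0 := fun i => by simp [inputStore]
  refine .seq ((runs_setupProg (E := conflict G H) hr hB (by simp [inputStore]) ?_).mono_frame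
    fun σ₁ hF₁ h₁ => ?_)
  · intro x hx y hy
    obtain ⟨u, c, rfl⟩ := exists_row hx
    obtain ⟨v, d, rfl⟩ := exists_row hy
    simp only [conflict_adj, div_row, mod_row, inputStore_adj, mem_edgeList, Fin.ext_iff]
  have hT₁ : Tables (conflict G H) N M σ₁ := h₁.1
  have hs₁ := h₁.2
  refine .seq ((runs_genProg (by omega) (by omega) hT₁).mono_frame fun σ₂ hF₂ hY₂ => ?_)
  have hT₂ := hT₁.of_eq (hF₂.n 3) (hF₂.n 4) (hF₂.n 9) (hF₂.n 10)
  refine .seq ((runs_singleProg (by omega) hT₂ (fun a => ?_) (fun a => ?_)).mono_frame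
    fun σ₃ hF₃ h₃ => ?_)
  · rw [hF₂.n 8, hF₁.n 8, hin 8 (by omega)]
  · rw [hF₂.r 1, hF₁.r 1, hin']
  have hT₃ := hT₂.of_eq (hF₃.n 3) (hF₃.n 4) (hF₃.n 9) (hF₃.n 10)
  obtain ⟨hV₃, h0, h0', hw⟩ := h₃
  refine .seq ((runs_dpProg (by omega) hT₃ hV₃ (by rw [hF₃.n 5]; exact hY₂) h0 h0' hw).mono_frame
    fun σ₄ hF₄ h₄ => ?_)
  obtain ⟨hV₄, hopt⟩ := h₄
  have hrev : σ₂.real 0 = (inputStore G rev).real 0 := by rw [hF₂.r 0, hF₁.r 0]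
  -- Row `0` belongs to the root, the set of all assignments.
  set I := row N (σ₄.nat 8) 0 with hI
  have hind : IsIndep (conflict G H) I := hV₄.indep 0 (by omega)
  obtain ⟨φ, hφ⟩ := exists_assignments_eq (G := G) (H := H) (I := I) (Finset.filter_subset _ _) hind
  have hT₄ := hT₃.of_eq (hF₄.n 3) (hF₄.n 4) (hF₄.n 9) (hF₄.n 10)
  refine (runs_outProg (k := k) (I := I) (by omega) hT₄.num ?_ ?_ ?_ ?_).mono_frame fun τ _ h => ?_
  · rw [hF₄.n 17, hF₃.n 17, hF₂.n 17, hF₄.n 18, hF₃.n 18, hF₂.n 18]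
    exact hs₁
  · intro u
    rw [hF₄.n 2, hF₃.n 2, hF₂.n 2, hF₁.n 2, hin 2 (by omega)]
  · intro x hx
    have := hV₄.bin 0 (by omega) x hx
    simp only [zero_mul, zero_add] at this
    simp only [hI, mem_row, zero_mul, zero_add]
    omega
  · intro x hx y hy hxy
    rw [← hφ] at hx hy
    obtain ⟨-, u, c, rfl, h2⟩ := Finset.mem_filter.1 hx
    obtain ⟨-, v, d, rfl, h4⟩ := Finset.mem_filter.1 hy
    rw [div_row, div_row] at hxy
    rw [Fin.ext hxy, h4, Option.some_inj] at h2
    rw [hxy, h2]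
  · obtain ⟨hnone, hsome⟩ := h
    refine ⟨φ, fun u => ?_, isIndep_assignments_iff.1 (hφ ▸ hind), fun ψ hψ => ?_⟩
    · cases h : φ u with
      | none =>
        refine hnone u fun x hx hxI hxu => ?_
        obtain ⟨v, d, rfl⟩ := exists_row hx
        rw [div_row] at hxu
        rw [← hφ, mem_assignments, Fin.ext hxu, h] at hxI
        exact absurd hxI (by simp)
      | some c =>
        have := hsome (u * k + c) (row_lt u c) (by rw [← hφ]; exact mem_assignments.2 h)
        rw [div_row, mod_row] at this
        simpa using this
    · rw [← sum_assignments (G := G), ← sum_assignments (G := G), hφ, ← hrev, ← hV₄.val 0 (by omega)]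
      -- The assignments of any competitor `ψ` are independent, hence covered at the root, hence
      -- weigh at most the stored value. The root has room since its budget is at most `4 * (c + 3)
      -- * √N`, and `√N ≤ r`.
      refine hopt 0 hM0 _ (solved_of_room hsep N 0 ?_ ?_ _ ?_ (isIndep_assignments_iff.2 hψ))
      · rw [item, Finset.card_range]
      · rw [Room, zero_add, one_mul]
        refine Nat.pow_le_pow_right (Nat.succ_pos _) ?_
        have h1 := budget_le c N
        have h2 : √(N : ℝ) ≤ r := by
          rw [Real.sqrt_le_left (by positivity), sq]
          exact_mod_cast hr.1
        have h3 : (budget c N : ℝ) ≤ ((4 * (c + 3) * r : ℕ) : ℝ) := by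
          push_cast
          exact h1.trans (mul_le_mul_of_nonneg_left h2 (by positivity))
        exact_mod_cast h3
      · rw [item]
        exact Finset.filter_subset _ _

/-! ### Estimate of the running time. -/

/-- The running time is `2 ^ O(√x log x)`. -/
theorem time_le {k C n r B m s d : ℕ} {x : ℝ} (hx : x = max (n : ℝ) 2)
    (hr : r = 0 ∨ (r - 1) * (r - 1) < n * k)
    (hB : B = (5 * (n * k) + 1) ^ (C * r) + 5 * (n * k) + n + C * r + 1)
    (hm : m ≤ s * (B + 1) ^ d) :
    (m : ℝ) ≤ x ^ (((s + d * ((5 * k + 2) * (C * (k + 1)) + (5 * k + C * (k + 1) + 4) + 2) : ℕ) : ℝ) *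
      √x) := by
  have hx2 : 2 ≤ x := hx ▸ le_max_right _ _
  have hxn : (n : ℝ) ≤ x := hx ▸ le_max_left _ _
  have hs1 : 1 ≤ √x := Real.one_le_sqrt.2 (by linarith)
  have hsx : √x ≤ x := by
    have := Real.mul_self_sqrt (show 0 ≤ x by linarith)
    nlinarith
  -- As `x ≥ 2`, constants are absorbed into powers of `x`.
  have hconst : ∀ a : ℕ, (a : ℝ) ≤ x ^ a := fun a =>
    calc (a : ℝ) ≤ (2 : ℝ) ^ a := by exact_mod_cast Nat.lt_two_pow_self.le
      _ ≤ x ^ a := pow_le_pow_left₀ (by norm_num) hx2 a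
  have hpow : ∀ (a : ℕ), x ^ a ≤ x ^ ((a : ℝ) * √x) := fun a => by
    rw [← Real.rpow_natCast]
    refine Real.rpow_le_rpow_of_exponent_le (by linarith) ?_
    exact le_mul_of_one_le_right (by positivity) hs1
  -- This uses `(r - 1)² < n * k ≤ k² * x`; the rounding adds `1 ≤ √x`.
  have hrx : (r : ℝ) ≤ (k + 1 : ℕ) * √x := by
    rcases hr with rfl | hr
    · simp only [Nat.cast_zero]; positivity
    · have h1 : ((r - 1 : ℕ) : ℝ) ≤ k * √x := by
        refine (pow_le_pow_iff_left₀ (Nat.cast_nonneg _) (by positivity) two_ne_zero).1 ?_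
        rw [mul_pow, Real.sq_sqrt (by linarith), sq]
        have h1 : (((r - 1 : ℕ) : ℝ)) * ((r - 1 : ℕ) : ℝ) ≤ n * k := by exact_mod_cast hr.le
        have h2 : (k : ℝ) ≤ k ^ 2 := by exact_mod_cast Nat.le_self_pow two_ne_zero k
        have h3 := mul_le_mul_of_nonneg_right hxn (Nat.cast_nonneg (α := ℝ) k)
        have h4 := mul_le_mul_of_nonneg_left h2 (show 0 ≤ x by linarith)
        linarith
      have h2 : (r : ℝ) ≤ ((r - 1 : ℕ) : ℝ) + 1 := by
        have : r ≤ (r - 1) + 1 := by omega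
        exact_mod_cast this
      push_cast
      linarith
  have hA : (((5 * (n * k) + 1) ^ (C * r) : ℕ) : ℝ) ≤
      x ^ ((((5 * k + 2) * (C * (k + 1)) : ℕ) : ℝ) * √x) := by
    have h1 : ((5 * (n * k) + 1 : ℕ) : ℝ) ≤ x ^ (5 * k + 2) := by
      have h2 := hconst (5 * k + 1)
      have h3 : ((5 * (n * k) + 1 : ℕ) : ℝ) ≤ ((5 * k + 1 : ℕ) : ℝ) * x := by
        push_cast
        nlinarith [mul_le_mul_of_nonneg_right hxn (show (0 : ℝ) ≤ 5 * k by positivity)]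
      rw [pow_succ]
      exact h3.trans (mul_le_mul_of_nonneg_right h2 (by linarith))
    rw [Nat.cast_pow]
    refine (pow_le_pow_left₀ (by positivity) h1 _).trans ?_
    rw [← pow_mul, ← Real.rpow_natCast]
    refine Real.rpow_le_rpow_of_exponent_le (by linarith) ?_
    have := mul_le_mul_of_nonneg_left hrx (show (0 : ℝ) ≤ ((5 * k + 2) * C : ℕ) by positivity)
    push_cast at this ⊢
    linarith
  have hD : ((5 * (n * k) + n + C * r + 2 : ℕ) : ℝ) ≤
      x ^ (((5 * k + C * (k + 1) + 4 : ℕ) : ℝ) * √x) := by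
    refine le_trans ?_ (hpow _)
    have h1 := hconst (5 * k + C * (k + 1) + 3)
    rw [pow_succ]
    refine le_trans ?_ (mul_le_mul_of_nonneg_right h1 (show 0 ≤ x by linarith))
    have h2 := mul_le_mul_of_nonneg_left hrx (show (0 : ℝ) ≤ C by positivity)
    have h3 := mul_le_mul_of_nonneg_left hsx (show (0 : ℝ) ≤ C * (k + 1 : ℕ) by positivity)
    have h4 := mul_le_mul_of_nonneg_right hxn (show (0 : ℝ) ≤ 5 * k by positivity)
    push_cast at h2 h3 h4 ⊢
    linarith
  have hB1 : ((B + 1 : ℕ) : ℝ) ≤ x ^ ((((5 * k + 2) * (C * (k + 1)) +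
      (5 * k + C * (k + 1) + 4) + 2 : ℕ) : ℝ) * √x) := by
    have one : ∀ a : ℕ, (1 : ℝ) ≤ x ^ ((a : ℝ) * √x) := fun a =>
      Real.one_le_rpow (by linarith) (by positivity)
    have h1 := one ((5 * k + 2) * (C * (k + 1)))
    have h2 := one (5 * k + C * (k + 1) + 4)
    have h3 : (2 : ℝ) ≤ x ^ (((2 : ℕ) : ℝ) * √x) := (hconst 2).trans (hpow 2)
    have h4 : ((B + 1 : ℕ) : ℝ) = (((5 * (n * k) + 1) ^ (C * r) : ℕ) : ℝ) +
        ((5 * (n * k) + n + C * r + 2 : ℕ) : ℝ) := by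
      rw [hB]; push_cast; ring
    rw [Nat.cast_add _ 2, Nat.cast_add ((5 * k + 2) * (C * (k + 1))), add_mul, add_mul,
      Real.rpow_add (by linarith), Real.rpow_add (by linarith), h4]
    set P := x ^ ((((5 * k + 2) * (C * (k + 1)) : ℕ) : ℝ) * √x)
    set Q := x ^ (((5 * k + C * (k + 1) + 4 : ℕ) : ℝ) * √x)
    -- Both factors are at least `1`; the remaining `2` is absorbed by the summand `2` of the
    -- exponent.
    have h5 : P + Q ≤ P * Q * 2 := by nlinarith
    exact (add_le_add hA hD).trans (h5.trans (mul_le_mul_of_nonneg_left h3 (by positivity)))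
  calc (m : ℝ) ≤ (s : ℝ) * ((B + 1 : ℕ) : ℝ) ^ d := by exact_mod_cast hm
    _ ≤ x ^ ((s : ℝ) * √x) * (x ^ ((((5 * k + 2) * (C * (k + 1)) +
      (5 * k + C * (k + 1) + 4) + 2 : ℕ) : ℝ) * √x)) ^ d :=
        mul_le_mul ((hconst s).trans (hpow s)) (pow_le_pow_left₀ (by positivity) hB1 d)
          (by positivity) (by positivity)
    _ = _ := by
        rw [← Real.rpow_mul_natCast (by linarith), ← Real.rpow_add (by linarith)]
        congr 1
        push_cast
        ring

/-- `S_0` is a single vertex. -/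
theorem eq_zero_of_P6StFree_zero (hG : P6StFree 0 G) : n = 0 := by
  by_contra hn
  refine hG.2 ⟨⟨⟨fun _ => ⟨0, Nat.pos_of_ne_zero hn⟩, ?_⟩, ?_⟩⟩
  · rintro (_ | ⟨i, _⟩) (_ | ⟨j, _⟩) _
    · rfl
    · exact j.elim0
    · exact i.elim0
    · exact i.elim0
  · rintro (_ | ⟨i, _⟩) (_ | ⟨j, _⟩)
    · simp
    · exact j.elim0
    · exact i.elim0
    · exact i.elim0

/-- For `t ≥ 1` the exponent is at least `1/2`. The factor `2` is needed only for `t = 0`, where the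
exponent is `0` but `n = 0`, so that the left side is `√2`. -/
theorem sqrt_le_rpow {t : ℕ} (hG : P6StFree t G) :
    √(max (n : ℝ) 2) ≤ 2 * (max (n : ℝ) 2) ^ ((t : ℝ) / ((t : ℝ) + 1)) := by
  have hx2 : (2 : ℝ) ≤ max (n : ℝ) 2 := le_max_right _ _
  rcases Nat.eq_zero_or_pos t with rfl | ht
  · obtain rfl := eq_zero_of_P6StFree_zero hG
    simp
  · have ht' : (1 : ℝ) ≤ t := by exact_mod_cast ht
    have h1 : (1 / 2 : ℝ) ≤ (t : ℝ) / (t + 1) := by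
      rw [div_le_div_iff₀ (by norm_num) (by linarith)]; linarith
    rw [Real.sqrt_eq_rpow]
    have h2 := Real.rpow_le_rpow_of_exponent_le (show (1 : ℝ) ≤ max (n : ℝ) 2 by linarith) h1
    have h3 : 0 ≤ (max (n : ℝ) 2) ^ ((t : ℝ) / (t + 1)) := by positivity
    linarith

theorem exists_ceil_sqrt (N : ℕ) : ∃ r, N ≤ r * r ∧ (r = 0 ∨ (r - 1) * (r - 1) < N) := by
  have h : ∃ r, N ≤ r * r := ⟨N, Nat.le_mul_self N⟩
  refine ⟨Nat.find h, Nat.find_spec h, ?_⟩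
  rcases Nat.eq_zero_or_pos (Nat.find h) with h0 | h0
  · exact .inl h0
  · exact .inr (not_le.1 (Nat.find_min h (Nat.sub_lt h0 one_pos)))

end coloring
end MaxPartialColoring

theorem mainTheorem6 (t k : ℕ) (H : SimpleGraph (Fin k)) :
    ∃ C : ℝ, MaxPartialColoring.SolvableInTime H (MaxPartialColoring.P6StFree t)
      (fun n : ℕ => (max (n : ℝ) 2) ^ (C * (max (n : ℝ) 2) ^ ((t : ℝ) / ((t : ℝ) + 1)))) := by
  set c := k * 5 * (1 + k * k * (t * 2)) with hc
  set p := MaxPartialColoring.solver H (4 * (c + 3)) with hp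
  set D := p.size + p.depth * ((5 * k + 2) * (4 * (c + 3) * (k + 1)) +
    (5 * k + 4 * (c + 3) * (k + 1) + 4) + 2) with hD
  -- `D` is the constant from `time_le`; the factor `2` comes from `sqrt_le_rpow`.
  refine ⟨D * 2, p, fun n G hG rev => ?_⟩
  obtain ⟨r, hr⟩ := MaxPartialColoring.exists_ceil_sqrt (n * k)
  obtain ⟨m, τ, hexec, hm, φ, hout, hopt⟩ := MaxPartialColoring.runs_solver (c := c) rev hr le_rfl
    (MaxPartialColoring.conflict_separator G H hG)
  refine ⟨m, τ, φ, hexec, ?_, hout, hopt⟩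
  have h1 := MaxPartialColoring.time_le rfl hr.2 rfl (hm.trans (p.bound_le _))
  refine h1.trans (Real.rpow_le_rpow_of_exponent_le ?_ ?_)
  · exact le_trans (by norm_num) (le_max_right (n : ℝ) 2)
  · rw [mul_assoc (D : ℝ)]
    exact mul_le_mul_of_nonneg_left (MaxPartialColoring.sqrt_le_rpow hG) (Nat.cast_nonneg D)
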